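/- An imprecise terrain $T$ is a finite simple graph $G$ with vertex set $V$ consisting of distinct points in the plane, together with an elevation interval $[\mathrm{low}(v),\mathrm{high}(v)]$, $\mathrm{low}(v)\le\mathrm{high}(v)$, for every $v\in V$. A realization $R$ assigns to every $v$ an elevation $\mathrm{elev}_R(v)\in[\mathrm{low}(v),\mathrm{high}(v)]$. The slope of an edge from $p$ to $q$ is $(\mathrm{elev}_R(p)-\mathrm{elev}_R(q))/|pq|$; $q$ is a steepest descent neighbour of $p$ if this slope is nonnegative and maximal among all neighbours of $p$. A local minimum of $R$ is a connected set of nodes at one common elevation that is strictly lower than the elevation of every node outside the set adjacent to it. Water in $p$ flows on to each steepest descent neighbour of $p$ if $p$ lies in no local minimum; if $p$ lies in a local minimum $P$, it flows to the neighbours of $p$ in $P$. Write $p\to_R q$ if $q=p$ or water from $p$ reaches $q$ in finitely many such steps. For $Q\subseteq V$ put $$\mathrm{PoDel}(Q)=\bigcup_{R}\bigcup_{q\in Q}\{p : q\to_R p\},$$ the union being over all realizations $R$ of $T$. For a node $q'$ and an elevation $z'$ let $\mathrm{ExpandDown}(q',z')$ be the set of pairs $(p,z)$ such that $p$ is a neighbour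 of $q'$, there is a realization $R$ with $\mathrm{elev}_R(q')\in[\mathrm{low}(q'),z']$ and $q'\to_R p$, and $z$ is the maximum of $\mathrm{elev}_R(p)$ over all such $R$. Consider the following algorithm: enqueue $(q,\mathrm{high}(q))$ for every $q\in Q$; while the queue is not empty, dequeue a pair $(q',z')$ with largest key $z'$ (ties broken arbitrarily), and if $q'$ has not been output yet, output $q'$ with elevation $z'$ and enqueue all pairs of $\mathrm{ExpandDown}(q',z')$. Theorem. (a) Every run of this algorithm terminates, and it outputs each node of $\mathrm{PoDel}(Q)$ exactly once and no other node; the elevation output with $p$ is the maximum of $\mathrm{elev}_R(p)$ over all realizations $R$ with $q\to_R p$ for some $q\in Q$. (b) There is a program for the real RAM (unit-cost arithmetic $+,-,\times,/,\sqrt{\ }$ and comparison on reals, no rounding; indices are integers bounded by a constant times $|V|+n+1$) which, given $T$ by the coordinates and elevation bounds of its nodes and by adjacency lists, and $Q$ by its characteristic vector, computes $\mathrm{PoDel}(Q)$, with the maximum elevations of (a), in time $O(n\log n)$, where $n$ is the number of edges of $T$ and $T$ has no isolated nodes. For arbitrary $T$ the same program takes time at most $C\,(|V|+n+1)\log(|V|+n+2)$,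 with a constant $C$ that does not depend on the input. -/

import Mathlib

/-! ## Imprecise terrains and water flow in the network model -/

/-- An imprecise terrain with node set `V`: a (possibly non-planar) geometric graph whose nodes are
distinct points of the plane, together with an elevation interval `[low v, high v]` for every
node. -/
structure ImpreciseTerrain (V : Type*) where
  pos : V → EuclideanSpace ℝ (Fin 2)
  pos_injective : Function.Injective pos
  graph : SimpleGraph V
  low : V → ℝ
  high : V → ℝ
  low_le_high : ∀ v, low v ≤ high v

namespace ImpreciseTerrain

variable {V : Type*}

/-- A realization assigns to every node an elevation in its interval. -/
structure Realization (T : ImpreciseTerrain V) where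
  elev : V → ℝ
  low_le : ∀ v, T.low v ≤ elev v
  le_high : ∀ v, elev v ≤ T.high v

/-- The number of edges. -/
noncomputable def numEdges (T : ImpreciseTerrain V) : ℕ := T.graph.edgeSet.ncard

/-- The neighbourhood of a set of nodes. -/
def nbhd (T : ImpreciseTerrain V) (P : Set V) : Set V :=
  {s | s ∉ P ∧ ∃ t ∈ P, T.graph.Adj s t}

namespace Realization

variable {T : ImpreciseTerrain V}

/-- Steepness of descent of the edge from `p` to `q`. -/
noncomputable def steep (R : Realization T) (p q : V) : ℝ :=
  (R.elev p - R.elev q) / dist (T.pos p) (T.pos q)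

/-- `q` is a steepest descent neighbour of `p`. -/
def SteepestDescent (R : Realization T) (p q : V) : Prop :=
  T.graph.Adj p q ∧ 0 ≤ R.steep p q ∧ ∀ r, T.graph.Adj p r → R.steep p r ≤ R.steep p q

/-- A local minimum: a connected set of nodes, all at the same elevation, which is strictly lower
than the elevation of every node in its neighbourhood. -/
def IsLocalMinimum (R : Realization T) (P : Set V) : Prop :=
  (T.graph.induce P).Connected ∧
  (∀ p ∈ P, ∀ q ∈ P, R.elev p = R.elev q) ∧
  (∀ p ∈ P, ∀ s ∈ T.nbhd P, R.elev p < R.elev s)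

/-- Water that arrives in `p` continues directly to `q`: outside local minima it flows to each of
the steepest descent neighbours; inside a local minimum `P` it flows to the neighbours of `p`
in `P`. -/
def FlowStep (R : Realization T) (p q : V) : Prop :=
  ((¬ ∃ P, R.IsLocalMinimum P ∧ p ∈ P) ∧ R.SteepestDescent p q) ∨
  (∃ P, R.IsLocalMinimum P ∧ p ∈ P ∧ q ∈ P ∧ T.graph.Adj p q)

/-- Water from `p` reaches `q` in the realization `R`; every node flows to itself. -/
def FlowsTo (R : Realization T) : V → V → Prop := Relation.ReflTransGen R.FlowStep

end Realization

/-- The potential downstream area of `Q`: the nodes that receive water from a node of `Q` in some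
realization. -/
def poDel (T : ImpreciseTerrain V) (Q : Set V) : Set V :=
  ⋃ R : Realization T, ⋃ q ∈ Q, {p | R.FlowsTo q p}

/-- `z` is the maximum elevation that `p` has in a realization in which it receives water
from `Q`. -/
def IsMaxElev (T : ImpreciseTerrain V) (Q : Set V) (p : V) (z : ℝ) : Prop :=
  IsGreatest {y | ∃ R : Realization T, (∃ q ∈ Q, R.FlowsTo q p) ∧ R.elev p = y} z

/-! ## The search algorithm -/

/-- `ExpandDown(q', z')`: the pairs `(p, z)` where `p` is a neighbour of `q'` and `z` is the maximum
elevation of `p` over all realizations with elevation of `q'` in `[low q', z']` in which water flows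
from `q'` to `p` (in particular there is such a realization). -/
def expandDown (T : ImpreciseTerrain V) (q' : V) (z' : ℝ) : Set (V × ℝ) :=
  {x | T.graph.Adj q' x.1 ∧
    IsGreatest {y | ∃ R : Realization T, R.elev q' ∈ Set.Icc (T.low q') z' ∧
      R.FlowsTo q' x.1 ∧ R.elev x.1 = y} x.2}

theorem expandDown_finite [Finite V] (T : ImpreciseTerrain V) (q' : V) (z' : ℝ) :
    (T.expandDown q' z').Finite := by
  refine Set.Finite.of_finite_image (f := Prod.fst) (Set.toFinite _) ?_
  rintro ⟨p, z⟩ hx ⟨p₂, z₂⟩ hy (rfl : p = p₂)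
  exact Prod.ext rfl (hx.2.unique hy.2)

/-- State of the search: a priority queue of pairs (node, key) and the list of output pairs. -/
structure SearchState (V : Type*) where
  queue : Multiset (V × ℝ)
  output : List (V × ℝ)

/-- Initially every `q ∈ Q` is enqueued with its highest possible elevation. -/
def searchStart (T : ImpreciseTerrain V) (Q : Finset V) : SearchState V :=
  ⟨Q.val.map fun q => (q, T.high q), []⟩

/-- One iteration of the main loop: dequeue a pair `(q', z')` with largest key (ties are broken
arbitrarily); if `q'` has not been output before, output it with elevation `z'` and enqueue all
pairs of `ExpandDown(q', z')`; otherwise discard the pair. -/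
def SearchStep [Finite V] (T : ImpreciseTerrain V) (s s' : SearchState V) : Prop :=
  ∃ (q' : V) (z' : ℝ) (rest : Multiset (V × ℝ)),
    s.queue = (q', z') ::ₘ rest ∧ (∀ x ∈ rest, x.2 ≤ z') ∧
    (((∀ x ∈ s.output, x.1 ≠ q') ∧
        s' = ⟨rest + (T.expandDown_finite q' z').toFinset.val, s.output ++ [(q', z')]⟩) ∨
      ((∃ x ∈ s.output, x.1 = q') ∧ s' = ⟨rest, s.output⟩))

end ImpreciseTerrain

/-! ## The real RAM

A program is a fixed finite text in a structured language. Memory consists of arrays of words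
(natural numbers) and arrays of real numbers; array names are literals of the program, indices are
computed. Every arithmetic operation, comparison, memory access and control step costs one time
unit. Words stored by the program must not exceed a bound `w` (the word size), otherwise the
execution is stuck. There is no conversion from reals to words. -/

namespace RealRAM

structure Memory where
  word : ℕ → ℕ → ℕ
  real : ℕ → ℕ → ℝ

/-- Word expressions; `load a i` reads cell `i` of word array `a`. -/
inductive WExp where
  | lit (k : ℕ)
  | load (a : ℕ) (i : WExp)
  | add (e f : WExp)
  | sub (e f : WExp)
  | half (e : WExp)

def WExp.eval (m : Memory) : WExp → ℕ
  | .lit k => k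
  | .load a i => m.word a (i.eval m)
  | .add e f => e.eval m + f.eval m
  | .sub e f => e.eval m - f.eval m
  | .half e => e.eval m / 2

def WExp.cost : WExp → ℕ
  | .lit _ => 1
  | .load _ i => i.cost + 1
  | .add e f => e.cost + f.cost + 1
  | .sub e f => e.cost + f.cost + 1
  | .half e => e.cost + 1

/-- Real expressions; `load a i` reads cell `i` of real array `a`. The only constants are
0 and 1. -/
inductive RExp where
  | zero
  | one
  | load (a : ℕ) (i : WExp)
  | add (e f : RExp)
  | sub (e f : RExp)
  | mul (e f : RExp)
  | div (e f : RExp)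
  | sqrt (e : RExp)

/-- Division by zero and square roots of negative numbers return zero. -/
noncomputable def RExp.eval (m : Memory) : RExp → ℝ
  | .zero => 0
  | .one => 1
  | .load a i => m.real a (i.eval m)
  | .add e f => e.eval m + f.eval m
  | .sub e f => e.eval m - f.eval m
  | .mul e f => e.eval m * f.eval m
  | .div e f => e.eval m / f.eval m
  | .sqrt e => Real.sqrt (e.eval m)

def RExp.cost : RExp → ℕ
  | .zero => 1
  | .one => 1
  | .load _ i => i.cost + 1
  | .add e f => e.cost + f.cost + 1
  | .sub e f => e.cost + f.cost + 1
  | .mul e f => e.cost + f.cost + 1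
  | .div e f => e.cost + f.cost + 1
  | .sqrt e => e.cost + 1

/-- Tests. -/
inductive Test where
  | wle (e f : WExp)
  | rle (e f : RExp)
  | neg (b : Test)
  | conj (b c : Test)

def Test.Holds (m : Memory) : Test → Prop
  | .wle e f => e.eval m ≤ f.eval m
  | .rle e f => e.eval m ≤ f.eval m
  | .neg b => ¬ b.Holds m
  | .conj b c => b.Holds m ∧ c.Holds m

def Test.cost : Test → ℕ
  | .wle e f => e.cost + f.cost + 1
  | .rle e f => e.cost + f.cost + 1
  | .neg b => b.cost + 1
  | .conj b c => b.cost + c.cost + 1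

/-- Programs; `wset a i e` writes `e` to cell `i` of word array `a`, and `rset` writes to a real
array. -/
inductive Prog where
  | skip
  | wset (a : ℕ) (i e : WExp)
  | rset (a : ℕ) (i : WExp) (e : RExp)
  | seq (c d : Prog)
  | ite (b : Test) (c d : Prog)
  | loop (b : Test) (c : Prog)

def Memory.setWord (m : Memory) (a i v : ℕ) : Memory :=
  ⟨Function.update m.word a (Function.update (m.word a) i v), m.real⟩

noncomputable def Memory.setReal (m : Memory) (a i : ℕ) (v : ℝ) : Memory :=
  ⟨m.word, Function.update m.real a (Function.update (m.real a) i v)⟩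

/-- `Exec w c m m' t`: with word bound `w`, the program `c` started in memory `m` halts in memory
`m'` after exactly `t` time units. Addresses and words written must not exceed `w`. -/
inductive Exec (w : ℕ) : Prog → Memory → Memory → ℕ → Prop where
  | skip (m : Memory) : Exec w .skip m m 1
  | wset (a : ℕ) (i e : WExp) (m : Memory) (hi : i.eval m ≤ w) (he : e.eval m ≤ w) :
      Exec w (.wset a i e) m (m.setWord a (i.eval m) (e.eval m)) (i.cost + e.cost + 1)
  | rset (a : ℕ) (i : WExp) (e : RExp) (m : Memory) (hi : i.eval m ≤ w) :
      Exec w (.rset a i e) m (m.setReal a (i.eval m) (e.eval m)) (i.cost + e.cost + 1)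
  | seq {c d : Prog} {m₁ m₂ m₃ : Memory} {t₁ t₂ : ℕ}
      (h₁ : Exec w c m₁ m₂ t₁) (h₂ : Exec w d m₂ m₃ t₂) : Exec w (.seq c d) m₁ m₃ (t₁ + t₂)
  | iteTrue {b : Test} {c d : Prog} {m m' : Memory} {t : ℕ}
      (hb : b.Holds m) (h : Exec w c m m' t) : Exec w (.ite b c d) m m' (b.cost + t + 1)
  | iteFalse {b : Test} {c d : Prog} {m m' : Memory} {t : ℕ}
      (hb : ¬ b.Holds m) (h : Exec w d m m' t) : Exec w (.ite b c d) m m' (b.cost + t + 1)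
  | loopDone {b : Test} {c : Prog} {m : Memory}
      (hb : ¬ b.Holds m) : Exec w (.loop b c) m m (b.cost + 1)
  | loopStep {b : Test} {c : Prog} {m₁ m₂ m₃ : Memory} {t₁ t₂ : ℕ}
      (hb : b.Holds m₁) (h₁ : Exec w c m₁ m₂ t₁) (h₂ : Exec w (.loop b c) m₂ m₃ t₂) :
      Exec w (.loop b c) m₁ m₃ (b.cost + t₁ + t₂ + 1)

/-- The memory `m` holds the terrain `T` with nodes `0, …, N - 1` (coordinates, elevation bounds,
adjacency lists stored consecutively) and the characteristic vector of `Q`. The remaining cells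
are arbitrary. -/
structure Encodes {N : ℕ} (T : ImpreciseTerrain (Fin N)) (Q : Finset (Fin N)) (m : Memory) :
    Prop where
  numNodes : m.word 0 0 = N
  mem_Q : ∀ v : Fin N, m.word 1 v = if v ∈ Q then 1 else 0
  offset_zero : m.word 2 0 = 0
  /-- The neighbours of `v` are listed, in any order, in the cells of word array 3 from
  `word 2 v` (inclusive) to `word 2 (v + 1)` (exclusive). -/
  adjacency : ∀ v : Fin N, ∃ l : List (Fin N), l.Nodup ∧ (∀ u, u ∈ l ↔ T.graph.Adj v u) ∧
    m.word 2 (v + 1) = m.word 2 v + l.length ∧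
    ∀ (i : ℕ) (hi : i < l.length), m.word 3 (m.word 2 v + i) = (l[i] : Fin N)
  xcoord : ∀ v : Fin N, m.real 0 v = T.pos v 0
  ycoord : ∀ v : Fin N, m.real 1 v = T.pos v 1
  low : ∀ v : Fin N, m.real 2 v = T.low v
  high : ∀ v : Fin N, m.real 3 v = T.high v

/-- Word array 4 of `m` holds the characteristic vector of `PoDel(Q)`, and real array 4 holds the
maximum elevations at which the nodes of `PoDel(Q)` can receive water from `Q`. -/
structure HoldsPoDel {N : ℕ} (T : ImpreciseTerrain (Fin N)) (Q : Finset (Fin N)) (m : Memory) :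
    Prop where
  mem : ∀ v : Fin N, v ∈ T.poDel Q → m.word 4 v = 1
  not_mem : ∀ v : Fin N, v ∉ T.poDel Q → m.word 4 v = 0
  elev : ∀ v : Fin N, v ∈ T.poDel Q → T.IsMaxElev Q v (m.real 4 v)

end RealRAM

/-! Water follows steepest descent edges even inside local minima, so flow is a path relation along
which elevations never increase. The geometric core is the splicing lemma
`exists_flowsTo_of_flowStep`. A realization that brings water to `v` and another one that sends it
on from `v` to `r` can be combined if `v` is not higher in the second. The combination keeps the
first realization on the flow paths to `v`, takes `v` and `r` from the second, and raises all other
nodes to their upper bounds. Only `v` and `r` can become lower than before, and water diverted to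
one of them still ends in `r`. Hence lowering a node below its best elevation, and letting water
continue from there, never creates anything unreachable from `Q` (`ReachedAt.flowsTo`).

This is the setting of Dijkstra's algorithm. If a node is reached at elevation `y` and has not been
output, then some pending key is at least `y` (`SearchInv.exists_pending`). Conversely every pending
key is matched or exceeded by a reachable elevation. So the largest key of a node not yet output is
its true maximum (`SearchInv.isMaxElev`). The maxima in ExpandDown exist by compactness, and
termination follows from a lexicographic measure.

For the running time, `SearchInv` only asks for single flow steps, so the program never explores
longer flows when it expands a node. Let `y` be the elevation of `v` and `m` the slope of the step
to `u`. The other neighbours may as well be at their upper bounds, so the admissible pairs are the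
points with `m ≥ 0` below the lines `high s + |vs| m`, and `u` ends at `y - |vu| m`. Maximizing this
for `low v ≤ y ≤ z` is a linear program in two variables. The optimum is the vertex of the lower
envelope where its slope passes `|vu|`, or the leftmost admissible point at height `low v` or `z`
(`sub_le_of_isVertex`).

The vertex does not depend on `z`, so all vertices are precomputed. The directed edges ("slots") are
sorted by length, the envelopes are built as stacks in that order, and a sweep in the opposite order
reads off the vertices. The two leftmost points are found by one scan when `v` is output. Every node
is output once, so every slot is examined once, and a tournament tree over the keys makes each
examination logarithmic. -/

namespace ImpreciseTerrain

variable {V : Type*}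

/-! ## Flow and steepest descent -/

theorem dist_pos_of_adj (T : ImpreciseTerrain V) {p q : V} (h : T.graph.Adj p q) :
    0 < dist (T.pos p) (T.pos q) :=
  dist_pos.2 fun e => h.ne (T.pos_injective e)

namespace Realization

variable {T : ImpreciseTerrain V}

theorem steep_nonneg_iff (R : Realization T) {p q : V} (h : T.graph.Adj p q) :
    0 ≤ R.steep p q ↔ R.elev q ≤ R.elev p := by
  unfold steep
  rw [le_div_iff₀ (T.dist_pos_of_adj h)]
  simp

/-- Local minima play no role: water always follows the steepest descent neighbours. -/
theorem flowStep_iff (R : Realization T) (p q : V) : R.FlowStep p q ↔ R.SteepestDescent p q := by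
  constructor
  · rintro (⟨-, h⟩ | ⟨P, ⟨-, hc, hn⟩, hp, hq, ha⟩)
    · exact h
    · have h0 : R.steep p q = 0 := by simp [steep, hc p hp q hq]
      refine ⟨ha, h0.ge, fun r hr => ?_⟩
      rw [h0]
      by_cases hrP : r ∈ P
      · simp [steep, hc p hp r hrP]
      · have := hn p hp r ⟨hrP, p, hp, hr.symm⟩
        exact div_nonpos_of_nonpos_of_nonneg (by linarith) dist_nonneg
  · intro h
    by_cases hP : ∃ P, R.IsLocalMinimum P ∧ p ∈ P
    · obtain ⟨P, hm, hp⟩ := hP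
      refine Or.inr ⟨P, hm, hp, ?_, h.1⟩
      by_contra hq
      have h1 := hm.2.2 p hp q ⟨hq, p, hp, h.1.symm⟩
      have h2 := (R.steep_nonneg_iff h.1).1 h.2.1
      linarith
    · exact Or.inl ⟨hP, h⟩

theorem FlowStep.elev_le {R : Realization T} {p q : V} (h : R.FlowStep p q) :
    R.elev q ≤ R.elev p := by
  rw [flowStep_iff] at h
  exact (R.steep_nonneg_iff h.1).1 h.2.1

theorem FlowsTo.elev_le {R : Realization T} {p q : V} (h : R.FlowsTo p q) :
    R.elev q ≤ R.elev p := by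
  induction h with
  | refl => exact le_rfl
  | tail _ h ih => exact h.elev_le.trans ih

theorem steep_le_steep {R R' : Realization T} {p q : V} (hp : R.elev p = R'.elev p)
    (hq : R'.elev q ≤ R.elev q) : R.steep p q ≤ R'.steep p q := by
  unfold steep
  rw [hp]
  gcongr

end Realization

/-- Water from `Q` reaches `p` at elevation `y` in some realization. -/
def ReachedAt (T : ImpreciseTerrain V) (Q : Set V) (p : V) (y : ℝ) : Prop :=
  ∃ R : Realization T, (∃ q ∈ Q, R.FlowsTo q p) ∧ R.elev p = y

theorem isMaxElev_iff (T : ImpreciseTerrain V) (Q : Set V) (p : V) (z : ℝ) :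
    T.IsMaxElev Q p z ↔ T.ReachedAt Q p z ∧ ∀ y, T.ReachedAt Q p y → y ≤ z :=
  Iff.rfl

theorem mem_poDel_iff (T : ImpreciseTerrain V) (Q : Set V) (p : V) :
    p ∈ T.poDel Q ↔ ∃ y, T.ReachedAt Q p y := by
  simp [poDel, ReachedAt]

/-- The highest realization. -/
def highest (T : ImpreciseTerrain V) : Realization T := ⟨T.high, T.low_le_high, fun _ => le_rfl⟩

theorem reachedAt_high (T : ImpreciseTerrain V) {Q : Set V} {q : V} (hq : q ∈ Q) :
    T.ReachedAt Q q (T.high q) :=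
  ⟨T.highest, ⟨q, hq, Relation.ReflTransGen.refl⟩, rfl⟩

/-- If water from `q` reaches `v` in `R`, and in a realization `R'` with `v` not higher than in `R`
it continues directly to `r`, then there is a realization in which water from `q` reaches `r` at
least as high as in `R'`. -/
theorem exists_flowsTo_of_flowStep [Finite V] {T : ImpreciseTerrain V} {R R' : Realization T}
    {q v r : V} (hqv : R.FlowsTo q v) (hvr : R'.FlowStep v r) (hv : R'.elev v ≤ R.elev v) :
    ∃ R'' : Realization T, R''.FlowsTo q r ∧ R'.elev r ≤ R''.elev r := by
  classical
  -- If `r` already lies on a flow path from `q` to `v`, then `R` itself works: there `r` is at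
  -- least as high as `v`, which is at least as high as `v`, hence `r`, in `R'`.
  by_cases hr : R.FlowsTo q r ∧ R.FlowsTo r v
  · exact ⟨R, hr.1, hvr.elev_le.trans (hv.trans hr.2.elev_le)⟩
  let A : Set V := {a | R.FlowsTo q a ∧ R.FlowsTo a v}
  have hrv : v ≠ r := ((R'.flowStep_iff v r).1 hvr).1.ne
  -- The spliced realization: `R'` on `v` and `r`, `R` on the flow paths from `q` to `v`, upper
  -- bounds elsewhere.
  let e : V → ℝ := fun a => if a = v then R'.elev v else if a = r then R'.elev r else
    if a ∈ A then R.elev a else T.high a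
  let R'' : Realization T := ⟨e, fun a => by
      simp only [e]; split_ifs with h1 h2
      · exact h1 ▸ R'.low_le v
      · exact h2 ▸ R'.low_le r
      · exact R.low_le a
      · exact T.low_le_high a, fun a => by
      simp only [e]; split_ifs with h1 h2
      · exact h1 ▸ R'.le_high v
      · exact h2 ▸ R'.le_high r
      · exact R.le_high a
      · exact le_rfl⟩
  have ev : R''.elev v = R'.elev v := if_pos rfl
  have er : R''.elev r = R'.elev r := by
    change e r = _
    simp [e, hrv.symm]
  have eA : ∀ a ∈ A, a ≠ v → R''.elev a = R.elev a := fun a ha hav => by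
    have har : a ≠ r := fun h => hr (h ▸ ha)
    change e a = _
    simp [e, hav, har, ha]
  have eO : ∀ a, a ≠ v → a ≠ r → a ∉ A → R''.elev a = T.high a := fun a h1 h2 h3 => by
    change e a = _
    simp [e, h1, h2, h3]
  have hstep : R''.FlowStep v r := by
    rw [Realization.flowStep_iff] at hvr ⊢
    have hsr : R''.steep v r = R'.steep v r := by simp [Realization.steep, ev, er]
    refine ⟨hvr.1, hsr ▸ hvr.2.1, fun s hs => ?_⟩
    rw [hsr]
    have hsv : s ≠ v := hs.ne'
    by_cases h2 : s = r
    · subst h2; exact hsr.le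
    -- Neighbours in `A` drain to `v` in `R`, so they are not below `v` and cannot compete with a
    -- nonnegative slope; the remaining ones have been raised to their upper bounds.
    by_cases h3 : s ∈ A
    · refine le_trans ?_ hvr.2.1
      have := h3.2.elev_le
      exact div_nonpos_of_nonpos_of_nonneg (by rw [ev, eA s h3 hsv]; linarith) dist_nonneg
    · exact (Realization.steep_le_steep ev (by rw [eO s hsv h2 h3]; exact R'.le_high s)).trans
        (hvr.2.2 s hs)
  refine ⟨R'', ?_, er.ge⟩
  have key : ∀ a, R.FlowsTo a v → R.FlowsTo q a → R''.FlowsTo a r := by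
    intro a hav
    induction hav using Relation.ReflTransGen.head_induction_on with
    | refl => exact fun _ => Relation.ReflTransGen.single hstep
    | @head a b hab hbv ih =>
      intro hqa
      have hqb : R.FlowsTo q b := hqa.tail hab
      by_cases hv' : a = v
      · subst hv'; exact Relation.ReflTransGen.single hstep
      have haA : a ∈ A := ⟨hqa, hbv.head hab⟩
      have ea := eA a haA hv'
      rw [Realization.flowStep_iff] at hab
      have hbs : R.steep a b ≤ R''.steep a b := by
        refine Realization.steep_le_steep ea.symm ?_
        by_cases h : b = v
        · subst h; rw [ev]; exact hv
        · exact (eA b ⟨hqb, hbv⟩ h).le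
      -- Let `s` be a steepest neighbour of `a` after the splice. If it is `v` or `r`, water takes a
      -- shortcut to `r`. Otherwise `s` has not been lowered, and the old successor `b` is still
      -- steepest.
      obtain ⟨s, hs, hmax⟩ := Set.exists_max_image {s | T.graph.Adj a s} (R''.steep a)
        (Set.toFinite _) ⟨b, hab.1⟩
      have has : R''.SteepestDescent a s :=
        ⟨hs, hab.2.1.trans (hbs.trans (hmax b hab.1)), hmax⟩
      by_cases h1 : s = v
      · subst h1
        exact (Relation.ReflTransGen.single hstep).head ((R''.flowStep_iff _ _).2 has)
      by_cases h2 : s = r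
      · subst h2
        exact Relation.ReflTransGen.single ((R''.flowStep_iff _ _).2 has)
      have hsb : R''.steep a s ≤ R''.steep a b := by
        refine (Realization.steep_le_steep ea ?_).trans ((hab.2.2 s hs).trans hbs)
        by_cases h3 : s ∈ A
        · exact (eA s h3 h1).ge
        · rw [eO s h1 h2 h3]; exact R.le_high s
      exact (ih hqb).head ((R''.flowStep_iff _ _).2
        ⟨hab.1, hab.2.1.trans hbs, fun t ht => (hmax t ht).trans hsb⟩)
  exact key q hqv Relation.ReflTransGen.refl

/-- The splice is iterated along the path of `R'`. Its conclusion, that the next node is reached at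
least as high as in `R'`, is the hypothesis of the next splice. -/
theorem ReachedAt.flowsTo [Finite V] {T : ImpreciseTerrain V} {Q : Set V} {v p : V} {z : ℝ}
    (h : T.ReachedAt Q v z) {R' : Realization T} (hz : R'.elev v ≤ z) (hvp : R'.FlowsTo v p) :
    ∃ y, T.ReachedAt Q p y ∧ R'.elev p ≤ y := by
  induction hvp with
  | refl => exact ⟨z, h, hz⟩
  | tail _ hs ih =>
    obtain ⟨y, ⟨R, ⟨q, hq, hqv⟩, rfl⟩, hy⟩ := ih
    obtain ⟨R'', h1, h2⟩ := exists_flowsTo_of_flowStep hqv hs hy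
    exact ⟨_, ⟨R'', ⟨q, hq, h1⟩, rfl⟩, h2⟩

/-! ## Existence of the maxima in `ExpandDown` -/

/-- A compactness argument. Being a flow step is a system of non-strict inequalities between
continuous functions of the elevations, so the admissible elevation vectors form a closed subset of
a compact box. -/
theorem exists_isGreatest_expand [Finite V] (T : ImpreciseTerrain V) (q' p : V) (z' : ℝ)
    (hne : ∃ R : Realization T, R.elev q' ≤ z' ∧ R.FlowsTo q' p) :
    ∃ z, IsGreatest {y | ∃ R : Realization T, R.elev q' ∈ Set.Icc (T.low q') z' ∧
      R.FlowsTo q' p ∧ R.elev p = y} z := by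
  let St : (V → ℝ) → V → V → Prop := fun e a b => T.graph.Adj a b ∧
    0 ≤ (e a - e b) / dist (T.pos a) (T.pos b) ∧ ∀ r, T.graph.Adj a r →
      (e a - e r) / dist (T.pos a) (T.pos r) ≤ (e a - e b) / dist (T.pos a) (T.pos b)
  have hSt : ∀ R : Realization T, R.FlowStep = St R.elev := fun R => by
    ext a b; exact R.flowStep_iff a b
  let box : Set (V → ℝ) := Set.univ.pi fun v => Set.Icc (T.low v) (T.high v)
  -- Reachability is a union over the finitely many relations `S` that connect `q'` to `p`, of the
  -- closed condition that all pairs in `S` are flow steps.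
  let good : Set (V → ℝ) := ⋃ S ∈ {S : V → V → Prop | Relation.ReflTransGen S q' p},
    {e | ∀ a b, S a b → St e a b}
  have hgood : IsClosed good := by
    refine Set.Finite.isClosed_biUnion (Set.toFinite _) fun S _ => ?_
    simp only [Set.ofPred_forall]
    refine isClosed_iInter fun a => isClosed_iInter fun b => isClosed_iInter fun _ => ?_
    refine IsClosed.and isClosed_const (IsClosed.and ?_ ?_)
    · exact isClosed_le continuous_const (by fun_prop)
    · simp only [Set.ofPred_forall]
      exact isClosed_iInter fun r => isClosed_iInter fun _ => isClosed_le (by fun_prop) (by fun_prop)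
  have hK : IsCompact (box ∩ ({e | e q' ≤ z'} ∩ good)) :=
    (isCompact_univ_pi fun v => isCompact_Icc).inter_right
      ((isClosed_le (by fun_prop) continuous_const).inter hgood)
  have himg : {y | ∃ R : Realization T, R.elev q' ∈ Set.Icc (T.low q') z' ∧
      R.FlowsTo q' p ∧ R.elev p = y} = (fun e : V → ℝ => e p) '' (box ∩ ({e | e q' ≤ z'} ∩ good)) := by
    ext y
    constructor
    · rintro ⟨R, hR, hf, rfl⟩
      refine ⟨R.elev, ⟨fun v _ => ⟨R.low_le v, R.le_high v⟩, hR.2, ?_⟩, rfl⟩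
      exact Set.mem_biUnion (x := R.FlowStep) hf fun a b h => by rwa [hSt] at h
    · rintro ⟨e, ⟨hb, hz, hg⟩, rfl⟩
      obtain ⟨S, hS, hSe⟩ := Set.mem_iUnion₂.1 hg
      let R : Realization T := ⟨e, fun v => (hb v trivial).1, fun v => (hb v trivial).2⟩
      refine ⟨R, ⟨R.low_le q', hz⟩, ?_, rfl⟩
      have hSR : ∀ a b, S a b → R.FlowStep a b := fun a b h => by rw [hSt]; exact hSe a b h
      exact Relation.ReflTransGen.mono hSR _ _ hS
  rw [himg]
  refine (hK.image (by fun_prop)).exists_isGreatest ?_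
  obtain ⟨R, h1, h2⟩ := hne
  rw [← himg]
  exact ⟨_, R, ⟨R.low_le q', h1⟩, h2, rfl⟩

/-! ## Correctness of best-first search -/

/-- The invariant of best-first search with output pairs `O` and pending pairs `K`. -/
structure SearchInv (T : ImpreciseTerrain V) (Q : Set V) (O K : Set (V × ℝ)) : Prop where
  source : ∀ q ∈ Q, (∃ z, (q, z) ∈ O) ∨ ∃ k, (q, k) ∈ K ∧ T.high q ≤ k
  isMax : ∀ v z, (v, z) ∈ O → T.IsMaxElev Q v z
  expanded : ∀ v z, (v, z) ∈ O → ∀ (R : Realization T) (u : V), R.elev v ≤ z → R.FlowStep v u →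
    (∃ z, (u, z) ∈ O) ∨ ∃ k, (u, k) ∈ K ∧ R.elev u ≤ k
  attained : ∀ v k, (v, k) ∈ K → ∃ y, T.ReachedAt Q v y ∧ k ≤ y

/-- Induction along the flow path: either the current node has been output, and the next one is then
output or pending with a sufficient key, or a pending key at least as large was met before and stays
sufficient because water never rises. -/
theorem SearchInv.exists_pending {T : ImpreciseTerrain V} {Q : Set V} {O K : Set (V × ℝ)}
    (h : T.SearchInv Q O K) {p : V} {y : ℝ} (hy : T.ReachedAt Q p y) :
    (∃ z, (p, z) ∈ O) ∨ ∃ w k, (w, k) ∈ K ∧ y ≤ k := by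
  obtain ⟨R, ⟨q, hq, hqp⟩, rfl⟩ := hy
  induction hqp with
  | refl =>
    rcases h.source q hq with h1 | ⟨k, hk, hle⟩
    · exact Or.inl h1
    · exact Or.inr ⟨q, k, hk, (R.le_high q).trans hle⟩
  | @tail a b hab hs ih =>
    rcases ih with ⟨z, hz⟩ | ⟨w, k, hk, hle⟩
    · rcases h.expanded a z hz R b (((isMaxElev_iff _ _ _ _).1 (h.isMax a z hz)).2 _
        ⟨R, ⟨q, hq, hab⟩, rfl⟩) hs with h1 | ⟨k, hk, hle⟩
      · exact Or.inl h1
      · exact Or.inr ⟨b, k, hk, hle⟩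
    · exact Or.inr ⟨w, k, hk, hs.elev_le.trans hle⟩

/-- The largest key bounds every reachable elevation of `v` by `exists_pending`, while `attained`
supplies a reachable elevation not below the key; the two must coincide. -/
theorem SearchInv.isMaxElev {T : ImpreciseTerrain V} {Q : Set V} {O K : Set (V × ℝ)}
    (h : T.SearchInv Q O K) {v : V} {z : ℝ} (hv : (v, z) ∈ K) (hmax : ∀ x ∈ K, x.2 ≤ z)
    (hO : ∀ z, (v, z) ∉ O) : T.IsMaxElev Q v z := by
  have hub : ∀ y, T.ReachedAt Q v y → y ≤ z := fun y hy => by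
    rcases h.exists_pending hy with ⟨z, hz⟩ | ⟨w, k, hk, hle⟩
    · exact absurd hz (hO z)
    · exact hle.trans (hmax _ hk)
  obtain ⟨y, hy, hle⟩ := h.attained v z hv
  obtain rfl : z = y := le_antisymm hle (hub y hy)
  exact (isMaxElev_iff _ _ _ _).2 ⟨hy, hub⟩

theorem SearchInv.mem_iff {T : ImpreciseTerrain V} {Q : Set V} {O K : Set (V × ℝ)}
    (h : T.SearchInv Q O K) (hK : ∀ x, x ∉ K) (p : V) :
    (∃ z, (p, z) ∈ O) ↔ p ∈ T.poDel Q := by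
  rw [mem_poDel_iff]
  constructor
  · rintro ⟨z, hz⟩
    exact ⟨z, (h.isMax p z hz).1⟩
  · rintro ⟨y, hy⟩
    rcases h.exists_pending hy with h1 | ⟨w, k, hk, -⟩
    · exact h1
    · exact absurd hk (hK _)

/-! ## The search with `ExpandDown` -/

/-- The invariant for states of the search with `ExpandDown`. -/
def StateInv (T : ImpreciseTerrain V) (Q : Finset V) (s : SearchState V) : Prop :=
  (s.output.map Prod.fst).Nodup ∧ T.SearchInv Q {x | x ∈ s.output} {x | x ∈ s.queue}

theorem stateInv_searchStart (T : ImpreciseTerrain V) (Q : Finset V) :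
    T.StateInv Q (T.searchStart Q) := by
  refine ⟨by simp [searchStart], ?_, by simp [searchStart], by simp [searchStart], ?_⟩
  · intro q hq
    exact Or.inr ⟨T.high q, by simpa [searchStart] using hq, le_rfl⟩
  · intro v k hk
    simp only [searchStart, Set.mem_ofPred_eq, Multiset.mem_map] at hk
    obtain ⟨q, hq, hqv⟩ := hk
    simp only [Prod.mk.injEq] at hqv
    obtain ⟨rfl, rfl⟩ := hqv
    exact ⟨_, T.reachedAt_high hq, le_rfl⟩

/-- `expanded` needs only the single steps out of the new output node, which are among the flows of
ExpandDown. The possibly longer flows that ExpandDown allows are harmless for `attained` by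
`ReachedAt.flowsTo`. -/
theorem StateInv.step [Finite V] {T : ImpreciseTerrain V} {Q : Finset V} {s s' : SearchState V}
    (h : T.StateInv Q s) (hs : T.SearchStep s s') : T.StateInv Q s' := by
  obtain ⟨hnd, hI⟩ := h
  obtain ⟨q', z', rest, hq, hmax, ⟨hnew, rfl⟩ | ⟨⟨⟨w, z⟩, hw, rfl⟩, rfl⟩⟩ := hs
  · have hmem : ∀ x, x ∈ s.queue ↔ x = (q', z') ∨ x ∈ rest := fun x => by
      rw [hq, Multiset.mem_cons]
    have hM : T.IsMaxElev Q q' z' := by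
      refine hI.isMaxElev ((hmem _).2 (Or.inl rfl)) (fun x hx => ?_) fun z hz => hnew _ hz rfl
      rcases (hmem x).1 hx with rfl | hx
      · exact le_rfl
      · exact hmax x hx
    refine ⟨?_, ⟨?_, ?_, ?_, ?_⟩⟩
    · rw [List.map_append, List.nodup_append]
      refine ⟨hnd, by simp, fun a ha b hb => ?_⟩
      obtain ⟨x, hx, rfl⟩ := List.mem_map.1 ha
      simp only [List.map_cons, List.map_nil, List.mem_singleton] at hb
      exact hb ▸ hnew x hx
    · intro q hqQ
      rcases hI.source q hqQ with ⟨z, hz⟩ | ⟨k, hk, hle⟩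
      · exact Or.inl ⟨z, List.mem_append_left _ hz⟩
      · rcases (hmem _).1 hk with hk | hk
        · obtain ⟨rfl, rfl⟩ := Prod.mk.inj hk
          exact Or.inl ⟨k, by simp⟩
        · exact Or.inr ⟨k, by simp [hk], hle⟩
    · intro v z hz
      rcases List.mem_append.1 hz with hz | hz
      · exact hI.isMax v z hz
      · obtain ⟨rfl, rfl⟩ := Prod.mk.inj (List.mem_singleton.1 hz)
        exact hM
    · intro v z hz R u hRv hf
      rcases List.mem_append.1 hz with hz | hz
      · rcases hI.expanded v z hz R u hRv hf with ⟨z, hz⟩ | ⟨k, hk, hle⟩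
        · exact Or.inl ⟨z, List.mem_append_left _ hz⟩
        · rcases (hmem _).1 hk with hk | hk
          · obtain ⟨rfl, rfl⟩ := Prod.mk.inj hk
            exact Or.inl ⟨k, by simp⟩
          · exact Or.inr ⟨k, by simp [hk], hle⟩
      · obtain ⟨rfl, rfl⟩ := Prod.mk.inj (List.mem_singleton.1 hz)
        have hfl : R.FlowsTo v u := Relation.ReflTransGen.single hf
        obtain ⟨k, hk⟩ := T.exists_isGreatest_expand v u z ⟨R, hRv, hfl⟩
        refine Or.inr ⟨k, ?_, hk.2 ⟨R, ⟨R.low_le v, hRv⟩, hfl, rfl⟩⟩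
        have : (u, k) ∈ T.expandDown v z := ⟨((R.flowStep_iff v u).1 hf).1, hk⟩
        simp [this]
    · intro v k hk
      simp only [Set.mem_ofPred_eq, Multiset.mem_add, Finset.mem_val, Set.Finite.mem_toFinset] at hk
      rcases hk with hk | hk
      · exact hI.attained v k ((hmem _).2 (Or.inr hk))
      · obtain ⟨R, hR, hf, he⟩ := hk.2.1
        obtain ⟨y, hy, hle⟩ := ReachedAt.flowsTo hM.1 hR.2 hf
        exact ⟨y, hy, he.symm.le.trans hle⟩
  · have hmem : ∀ x, x ∈ s.queue ↔ x = (w, z') ∨ x ∈ rest := fun x => by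
      rw [hq, Multiset.mem_cons]
    refine ⟨hnd, ⟨?_, hI.isMax, ?_, fun v k hk => hI.attained v k ((hmem _).2 (Or.inr hk))⟩⟩
    · intro q hqQ
      rcases hI.source q hqQ with h1 | ⟨k, hk, hle⟩
      · exact Or.inl h1
      · rcases (hmem _).1 hk with hk | hk
        · obtain ⟨rfl, rfl⟩ := Prod.mk.inj hk
          exact Or.inl ⟨z, hw⟩
        · exact Or.inr ⟨k, hk, hle⟩
    · intro v z₁ hz R u hRv hf
      rcases hI.expanded v z₁ hz R u hRv hf with h1 | ⟨k, hk, hle⟩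
      · exact Or.inl h1
      · rcases (hmem _).1 hk with hk | hk
        · obtain ⟨rfl, rfl⟩ := Prod.mk.inj hk
          exact Or.inl ⟨z, hw⟩
        · exact Or.inr ⟨k, hk, hle⟩

/-- An output step decreases the number of nodes not yet output, whatever it does to the queue; a
discarding step keeps that number and shortens the queue. -/
theorem acc_searchStep [Finite V] (T : ImpreciseTerrain V) (s : SearchState V) :
    Acc (fun s' s => T.SearchStep s s') s := by
  let f : SearchState V → ℕ × ℕ := fun s =>
    ({v | ∀ x ∈ s.output, x.1 ≠ v}.ncard, Multiset.card s.queue)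
  have hwf : WellFounded (InvImage (Prod.Lex (· < ·) (· < ·)) f) :=
    InvImage.wf f (WellFounded.prod_lex Nat.lt_wfRel.wf Nat.lt_wfRel.wf)
  refine Subrelation.accessible (fun {s' s} hs => ?_) (hwf.apply s)
  obtain ⟨q', z', rest, hq, -, ⟨hnew, rfl⟩ | ⟨-, rfl⟩⟩ := hs
  · refine Prod.Lex.left _ _ (Set.ncard_lt_ncard ?_ (Set.toFinite _))
    refine (Set.ssubset_iff_of_subset ?_).2 ⟨q', hnew, ?_⟩
    · intro v hv x hx
      exact hv x (List.mem_append_left _ hx)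
    · intro h
      exact h (q', z') (by simp) rfl
  · refine Prod.Lex.right _ ?_
    simp [hq]

theorem queue_eq_zero_of_stuck [Finite V] {T : ImpreciseTerrain V} {s : SearchState V}
    (h : ¬ ∃ s', T.SearchStep s s') : s.queue = 0 := by
  classical
  by_contra hne
  obtain ⟨x, hx⟩ := Multiset.exists_mem_of_ne_zero hne
  obtain ⟨⟨q', z'⟩, hm, hmax⟩ := Finset.exists_max_image s.queue.toFinset Prod.snd
    ⟨x, Multiset.mem_toFinset.2 hx⟩
  obtain ⟨rest, hr⟩ := Multiset.exists_cons_of_mem (Multiset.mem_toFinset.1 hm)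
  have hle : ∀ x ∈ rest, x.2 ≤ z' := fun x hx =>
    hmax x (Multiset.mem_toFinset.2 (hr ▸ Multiset.mem_cons_of_mem hx))
  by_cases ho : ∃ x ∈ s.output, x.1 = q'
  · exact h ⟨_, q', z', rest, hr, hle, Or.inr ⟨ho, rfl⟩⟩
  · exact h ⟨_, q', z', rest, hr, hle, Or.inl ⟨fun x hx e => ho ⟨x, hx, e⟩, rfl⟩⟩

theorem search_correct [Finite V] (T : ImpreciseTerrain V) (Q : Finset V) (s : SearchState V)
    (hs : Relation.ReflTransGen T.SearchStep (T.searchStart Q) s)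
    (hstuck : ¬ ∃ s', T.SearchStep s s') :
    s.queue = 0 ∧ (s.output.map Prod.fst).Nodup ∧
      (∀ p, p ∈ s.output.map Prod.fst ↔ p ∈ T.poDel Q) ∧
      (∀ p z, (p, z) ∈ s.output ↔ T.IsMaxElev Q p z) := by
  have hI : T.StateInv Q s := by
    clear hstuck
    induction hs with
    | refl => exact T.stateInv_searchStart Q
    | tail _ h ih => exact ih.step h
  have h0 := queue_eq_zero_of_stuck hstuck
  have hm := hI.2.mem_iff (K := {x | x ∈ s.queue}) (by simp [h0])
  have hmap : ∀ p, p ∈ s.output.map Prod.fst ↔ ∃ z, (p, z) ∈ s.output := by simp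
  refine ⟨h0, hI.1, fun p => (hmap p).trans (hm p), fun p z => ⟨hI.2.isMax p z, fun hz => ?_⟩⟩
  obtain ⟨z', hz'⟩ := (hm p).2 ((T.mem_poDel_iff Q p).2 ⟨z, hz.1⟩)
  rwa [hz.unique (hI.2.isMax p z' hz')]

end ImpreciseTerrain

/-! ## Direct flow over one edge as a two-variable linear program -/

namespace ImpreciseTerrain

variable {V : Type*}

/-- Sufficiency in the linear program: with all neighbours other than `u` at their upper bounds, the
constraints say exactly that no slope out of `v` exceeds `m`. The constraint for `u` itself keeps
`u` below its upper bound. -/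
theorem exists_flowStep {T : ImpreciseTerrain V} {v u : V} (hvu : T.graph.Adj v u) {y m : ℝ}
    (hl : T.low v ≤ y) (hh : y ≤ T.high v) (hm : 0 ≤ m)
    (hy : ∀ s, T.graph.Adj v s → y ≤ T.high s + dist (T.pos v) (T.pos s) * m)
    (hu : T.low u ≤ y - dist (T.pos v) (T.pos u) * m) :
    ∃ R : Realization T, R.elev v = y ∧ R.FlowStep v u ∧
      R.elev u = y - dist (T.pos v) (T.pos u) * m := by
  classical
  let e : V → ℝ := fun a => if a = v then y else
    if a = u then y - dist (T.pos v) (T.pos u) * m else T.high a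
  let R : Realization T := ⟨e, fun a => by
      simp only [e]; split_ifs with h1 h2
      · exact h1 ▸ hl
      · exact h2 ▸ hu
      · exact T.low_le_high a, fun a => by
      simp only [e]; split_ifs with h1 h2
      · exact h1 ▸ hh
      · have := hy u hvu
        rw [h2]; linarith
      · exact le_rfl⟩
  have ev : R.elev v = y := if_pos rfl
  have eu : R.elev u = y - dist (T.pos v) (T.pos u) * m := by
    change e u = _
    simp [e, hvu.ne']
  have hs : R.steep v u = m := by
    have := T.dist_pos_of_adj hvu
    simp only [Realization.steep, ev, eu]
    field_simp
    ring
  refine ⟨R, ev, (R.flowStep_iff v u).2 ⟨hvu, hs ▸ hm, fun r hr => ?_⟩, eu⟩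
  by_cases h : r = u
  · rw [h]
  · have er : R.elev r = T.high r := by
      change e r = _
      simp [e, hr.ne', h]
    rw [hs, Realization.steep, ev, er, div_le_iff₀ (T.dist_pos_of_adj hr)]
    have := hy r hr
    linarith

/-- Necessity in the linear program: `m` is the slope of the step, and raising the other neighbours
to their upper bounds only weakens the constraints. -/
theorem Realization.FlowStep.exists_steepness {T : ImpreciseTerrain V} {R : Realization T} {v u : V}
    (h : R.FlowStep v u) :
    T.graph.Adj v u ∧ ∃ m, 0 ≤ m ∧ R.elev u = R.elev v - dist (T.pos v) (T.pos u) * m ∧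
      ∀ s, T.graph.Adj v s → R.elev v ≤ T.high s + dist (T.pos v) (T.pos s) * m := by
  rw [R.flowStep_iff] at h
  refine ⟨h.1, R.steep v u, h.2.1, ?_, fun s hs => ?_⟩
  · have := T.dist_pos_of_adj h.1
    simp only [Realization.steep]
    field_simp
    ring
  · have h1 := h.2.2 s hs
    rw [Realization.steep, div_le_iff₀ (T.dist_pos_of_adj hs)] at h1
    have := R.le_high s
    linarith

end ImpreciseTerrain

namespace LineEnvelope

variable {ι : Type*}

/-- The point `(m, y)` with `0 ≤ m` lies below all lines `m ↦ h s + d s * m`, `s ∈ A`. -/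
def Feasible (A : Set ι) (h d : ι → ℝ) (m y : ℝ) : Prop :=
  0 ≤ m ∧ ∀ s ∈ A, y ≤ h s + d s * m

/-- `m` is the least nonnegative number for which `(m, y)` lies below all lines. -/
def IsLevel (A : Set ι) (h d : ι → ℝ) (m y : ℝ) : Prop :=
  Feasible A h d m y ∧ (m = 0 ∨ ∃ s ∈ A, y = h s + d s * m)

/-- `(m, y)` is a vertex of the lower envelope with a supporting line of slope `δ`. -/
def IsVertex (A : Set ι) (h d : ι → ℝ) (δ m y : ℝ) : Prop :=
  Feasible A h d m y ∧ (∃ s ∈ A, d s ≤ δ ∧ y = h s + d s * m) ∧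
    (m = 0 ∨ ∃ s ∈ A, δ ≤ d s ∧ y = h s + d s * m)

variable {A : Set ι} {h d : ι → ℝ}

/-- Optimality certificate. To the right of the vertex a tight line of slope at most `δ` bounds the
feasible region, to the left a tight line of slope at least `δ` or the axis `m = 0`. -/
theorem IsVertex.sub_le {δ m y m' y' : ℝ} (H : IsVertex A h d δ m y) (hf : Feasible A h d m' y') :
    y' - δ * m' ≤ y - δ * m := by
  obtain ⟨⟨h0, -⟩, ⟨s, hs, hsd, hsy⟩, hr⟩ := H
  rcases le_or_gt m m' with hm | hm
  · have := hf.2 s hs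
    nlinarith
  · rcases hr with hr | ⟨r, hr, hrd, hry⟩
    · have := hf.1
      linarith
    · have := hf.2 r hr
      nlinarith

/-- The optimum of `y - δ * m` over the feasible points with `a ≤ y ≤ b`. -/
theorem sub_le_of_isVertex (hd : ∀ s ∈ A, 0 < d s) {δ m y a b ma mb : ℝ}
    (H : IsVertex A h d δ m y) (hδ : 0 < δ) (ha : IsLevel A h d ma a) (hb : IsLevel A h d mb b)
    {m' y' : ℝ} (hf : Feasible A h d m' y') (hay : a ≤ y') (hyb : y' ≤ b) :
    (a ≤ y ∧ y ≤ b ∧ y' - δ * m' ≤ y - δ * m) ∨ y' - δ * m' ≤ a - δ * ma ∨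
      y' - δ * m' ≤ b - δ * mb := by
  have hopt := H.sub_le hf
  by_cases h1 : y < a
  · refine Or.inr (Or.inl ?_)
    obtain ⟨⟨h0, hfe⟩, ⟨s, hs, hsd, hsy⟩, -⟩ := H
    have hsa := ha.1.2 s hs
    have hmma : m < ma := by
      have := hd s hs
      nlinarith
    rcases ha.2 with h2 | ⟨u, hu, huy⟩
    · linarith
    · have e1 := hf.2 u hu
      have e2 := hfe u hu
      have hdu := hd u hu
      have hm' : ma ≤ m' := by nlinarith
      -- The vertex lies below the window, so level `a` is met to its right, where the envelope has
      -- slope at most `δ`. Concavity rules out `δ < d u`, and moving right from `ma` only loses.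
      rcases le_or_gt (d u) δ with h3 | h3 <;> nlinarith
  by_cases h2 : b < y
  · refine Or.inr (Or.inr ?_)
    rcases hb.2 with h3 | ⟨u, hu, huy⟩
    · have := hf.1
      rw [h3]; nlinarith
    · have e1 := hf.2 u hu
      have e2 := H.1.2 u hu
      have hdu := hd u hu
      have hm : mb < m := by nlinarith
      rcases le_or_gt mb m' with h4 | h4
      · nlinarith
      -- The vertex lies above the window, so level `b` is met to its left. A slope `d u < δ` there
      -- would make the point at `b` better than the optimal vertex.
      · rcases le_or_gt δ (d u) with h3 | h3 <;> nlinarith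
  · exact Or.inl ⟨not_lt.1 h1, not_lt.1 h2, hopt⟩

/-! ## The lower envelope as a stack -/

/-- Push a line that is not steeper than the lines on the stack: remove the lines that no longer
contribute. An entry is a line with the left end point of its part of the envelope. -/
noncomputable def push (h d : ι → ℝ) (x : ι) : List (ι × ℝ) → List (ι × ℝ)
  | [] => [(x, 0)]
  | (t, s) :: L => if h x + d x * s ≤ h t + d t * s then push h d x L else
      if d t ≤ d x then (t, s) :: L else (x, (h x - h t) / (d t - d x)) :: (t, s) :: L

/-- Consecutive entries meet in the left end point of the upper one. -/
def Linked (h d : ι → ℝ) : List (ι × ℝ) → Prop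
  | [] => True
  | [(_, s)] => s = 0
  | (t, s) :: (t', s') :: L => s' < s ∧ d t < d t' ∧ h t + d t * s = h t' + d t' * s ∧
      Linked h d ((t', s') :: L)

theorem Linked.tail {x : ι × ℝ} {L : List (ι × ℝ)} (hL : Linked h d (x :: L)) : Linked h d L := by
  cases L with
  | nil => trivial
  | cons y L => exact hL.2.2.2

theorem Linked.suffix {L L' : List (ι × ℝ)} (hL : Linked h d L) (hs : L' <:+ L) :
    Linked h d L' := by
  induction L with
  | nil => rw [List.suffix_nil.1 hs]; trivial
  | cons x L ih =>
    rcases List.suffix_cons_iff.1 hs with h1 | h1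
    · exact h1 ▸ hL
    · exact ih hL.tail h1

theorem Linked.nonneg {L : List (ι × ℝ)} (hL : Linked h d L) : ∀ e ∈ L, 0 ≤ e.2 := by
  induction L with
  | nil => simp
  | cons x L ih =>
    intro e he
    rcases List.mem_cons.1 he with rfl | he
    · cases L with
      | nil => exact (hL : e.2 = 0).ge
      | cons y L => exact (ih hL.tail y (by simp)).trans (hL.1 : y.2 < e.2).le
    · exact ih hL.tail e he

theorem Linked.head_le {t : ι} {s : ℝ} {L : List (ι × ℝ)} (hL : Linked h d ((t, s) :: L)) :
    ∀ e ∈ (t, s) :: L, e.2 ≤ s ∧ d t ≤ d e.1 := by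
  induction L generalizing t s with
  | nil => simp
  | cons y L ih =>
    intro e he
    rcases List.mem_cons.1 he with rfl | he
    · exact ⟨le_rfl, le_rfl⟩
    · have h1 := ih hL.tail e he
      exact ⟨h1.1.trans hL.1.le, hL.2.1.le.trans h1.2⟩

/-- The stack `L` describes the lower envelope of the lines in `P` over the nonnegative reals. -/
structure IsEnvelope (h d : ι → ℝ) (P : Set ι) (L : List (ι × ℝ)) : Prop where
  linked : Linked h d L
  le : ∀ e ∈ L, ∀ e' ∈ L, h e.1 + d e.1 * e.2 ≤ h e'.1 + d e'.1 * e.2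
  cover : ∀ p ∈ P, ∀ m, 0 ≤ m → ∃ e ∈ L, h e.1 + d e.1 * m ≤ h p + d p * m
  mem : ∀ e ∈ L, e.1 ∈ P
  head_le : ∀ e L', L = e :: L' → ∀ p ∈ P, d e.1 ≤ d p

theorem isEnvelope_empty (h d : ι → ℝ) : IsEnvelope h d ∅ [] :=
  ⟨trivial, by simp, by simp, by simp, by simp⟩

/-- While entries are popped, the remaining stack no longer covers all old lines by itself. The
covering hypothesis therefore also admits the new line `x`, which makes it stable under the
recursion. -/
theorem push_aux {P : Set ι} {x : ι} {L : List (ι × ℝ)} (hlin : Linked h d L)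
    (hle : ∀ e ∈ L, ∀ e' ∈ L, h e.1 + d e.1 * e.2 ≤ h e'.1 + d e'.1 * e.2)
    (hcov : ∀ p ∈ P, ∀ m, 0 ≤ m → h x + d x * m ≤ h p + d p * m ∨
      ∃ e ∈ L, h e.1 + d e.1 * m ≤ h p + d p * m)
    (hmem : ∀ e ∈ L, e.1 ∈ P) (hx : ∀ p ∈ P, d x ≤ d p) :
    IsEnvelope h d (insert x P) (push h d x L) := by
  induction L with
  | nil =>
    refine ⟨rfl, by simp [push], ?_, by simp [push], ?_⟩
    · intro p hp m hm
      refine ⟨(x, 0), by simp [push], ?_⟩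
      rcases hp with rfl | hp
      · exact le_rfl
      · simpa using hcov p hp m hm
    · intro e L' he p hp
      obtain ⟨rfl, -⟩ := List.cons.inj he
      rcases hp with rfl | hp
      · exact le_rfl
      · exact hx p hp
  | cons e L ih =>
    obtain ⟨t, s⟩ := e
    have hs0 : 0 ≤ s := hlin.nonneg (t, s) (by simp)
    have htP : t ∈ P := hmem (t, s) (by simp)
    have hdt := hx t htP
    unfold push
    split_ifs with h1 h2
    · refine ih hlin.tail (fun e he e' he' => hle e (by simp [he]) e' (by simp [he'])) ?_
        (fun e he => hmem e (by simp [he]))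
      intro p hp m hm
      rcases hcov p hp m hm with h3 | ⟨e, he, h3⟩
      · exact Or.inl h3
      · rcases List.mem_cons.1 he with rfl | he
        -- The popped line `t` is replaced by `x` to the right of its left end `s`, and by the next
        -- entry to the left of `s`. At the bottom of the stack `s = 0`, and there is nothing to the
        -- left.
        · rcases le_or_gt s m with h4 | h4
          · refine Or.inl (le_trans ?_ h3)
            simp only
            nlinarith
          · cases L with
            | nil =>
              have : s = 0 := hlin
              linarith
            | cons y L =>
              obtain ⟨t', s'⟩ := y
              obtain ⟨h5, h6, h7, -⟩ := hlin
              refine Or.inr ⟨(t', s'), by simp, le_trans ?_ h3⟩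
              simp only
              nlinarith
        · exact Or.inr ⟨e, he, h3⟩
    -- The new line is parallel to the top line and above it, so it contributes nothing.
    · have hd : d t = d x := le_antisymm h2 hdt
      rw [hd] at h1
      refine ⟨hlin, hle, ?_, fun e he => Or.inr (hmem e he), ?_⟩
      · intro p hp m hm
        have hxt : h t + d t * m ≤ h x + d x * m := by rw [hd]; linarith
        rcases hp with rfl | hp
        · exact ⟨(t, s), by simp, hxt⟩
        · rcases hcov p hp m hm with h3 | h3
          · exact ⟨(t, s), by simp, hxt.trans h3⟩
          · exact h3
      · intro e L' he p hp
        obtain ⟨rfl, -⟩ := List.cons.inj he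
        rcases hp with rfl | hp
        · exact h2
        · exact h2.trans (hx p hp)
    · push Not at h1 h2
      set s' := (h x - h t) / (d t - d x) with hs'
      have hpos : 0 < d t - d x := by linarith
      have hmul : s' * (d t - d x) = h x - h t := div_mul_cancel₀ _ hpos.ne'
      have heq : h x + d x * s' = h t + d t * s' := by linarith
      have hss : s < s' := by
        by_contra hc
        push Not at hc
        nlinarith
      refine ⟨⟨hss, h2, heq, hlin⟩, ?_, ?_, ?_, ?_⟩
      · intro e he e' he'
        rcases List.mem_cons.1 he with rfl | he
        · rcases List.mem_cons.1 he' with rfl | he'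
          · exact le_rfl
          · have h3 := hle (t, s) (by simp) e' he'
            simp only at h3 ⊢
            rw [heq]
            have hte := (hlin.head_le e' he').2
            nlinarith
        · rcases List.mem_cons.1 he' with rfl | he'
          · have h3 := hle e he (t, s) (by simp)
            have h4 := (hlin.head_le e he).1
            simp only at h3 ⊢
            nlinarith
          · exact hle e he e' he'
      · intro p hp m hm
        rcases hp with rfl | hp
        · exact ⟨(p, s'), by simp, le_rfl⟩
        · rcases hcov p hp m hm with h3 | ⟨e, he, h3⟩
          · exact ⟨(x, s'), by simp, h3⟩
          · exact ⟨e, by simp [he], h3⟩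
      · intro e he
        rcases List.mem_cons.1 he with rfl | he
        · exact Or.inl rfl
        · exact Or.inr (hmem e he)
      · intro e L' he p hp
        obtain ⟨rfl, -⟩ := List.cons.inj he
        rcases hp with rfl | hp
        · exact le_rfl
        · exact hx p hp

theorem IsEnvelope.push {P : Set ι} {x : ι} {L : List (ι × ℝ)} (H : IsEnvelope h d P L)
    (hx : ∀ p ∈ P, d x ≤ d p) : IsEnvelope h d (insert x P) (push h d x L) :=
  push_aux H.linked H.le (fun p hp m hm => Or.inr (H.cover p hp m hm)) H.mem hx

/-- The entry at which the slopes of the envelope pass `δ` gives an optimal vertex. -/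
theorem IsEnvelope.isVertex {P : Set ι} {L L' : List (ι × ℝ)} (H : IsEnvelope h d P L) {δ : ℝ}
    {t : ι} {s : ℝ} (hs : (t, s) :: L' <:+ L) (ht : d t ≤ δ)
    (hnext : ∀ e L'', L' = e :: L'' → δ ≤ d e.1) :
    IsVertex P h d δ s (h t + d t * s) := by
  have hmem : (t, s) ∈ L := hs.subset (by simp)
  have hs0 : 0 ≤ s := H.linked.nonneg _ hmem
  refine ⟨⟨hs0, fun p hp => ?_⟩, ⟨t, H.mem _ hmem, ht, rfl⟩, ?_⟩
  · obtain ⟨e, he, hle⟩ := H.cover p hp s hs0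
    exact (H.le _ hmem e he).trans hle
  · have hl := H.linked.suffix hs
    cases L' with
    | nil => exact Or.inl hl
    | cons e L'' =>
      exact Or.inr ⟨e.1, H.mem _ (hs.subset (by simp)), hnext e L'' rfl, hl.2.2.1⟩

end LineEnvelope

namespace RealRAM

/-! ## Reasoning about programs -/

/-- Some execution of `c` from `m` halts in a memory and after a time that satisfy `Q`. -/
def Run (w : ℕ) (c : Prog) (m : Memory) (Q : Memory → ℕ → Prop) : Prop :=
  ∃ m' t, Exec w c m m' t ∧ Q m' t

/-- The word arrays that a program may write. -/
def Prog.words : Prog → List ℕ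
  | .skip => []
  | .wset a _ _ => [a]
  | .rset _ _ _ => []
  | .seq c d => c.words ++ d.words
  | .ite _ c d => c.words ++ d.words
  | .loop _ c => c.words

/-- The real arrays that a program may write. -/
def Prog.reals : Prog → List ℕ
  | .skip => []
  | .wset _ _ _ => []
  | .rset a _ _ => [a]
  | .seq c d => c.reals ++ d.reals
  | .ite _ c d => c.reals ++ d.reals
  | .loop _ c => c.reals

/-- `m` and `m'` differ at most in the arrays that `c` may write. -/
structure Prog.Frame (c : Prog) (m m' : Memory) : Prop where
  word : ∀ a, a ∉ c.words → m'.word a = m.word a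
  real : ∀ a, a ∉ c.reals → m'.real a = m.real a

theorem Memory.setWord_word_self (m : Memory) (a i v : ℕ) :
    (m.setWord a i v).word a = Function.update (m.word a) i v := by
  simp [Memory.setWord]

theorem Memory.setWord_word_ne (m : Memory) {a b : ℕ} (i v : ℕ) (h : b ≠ a) :
    (m.setWord a i v).word b = m.word b := by
  simp [Memory.setWord, h]

theorem Memory.setWord_real (m : Memory) (a i v : ℕ) : (m.setWord a i v).real = m.real := rfl

theorem Memory.setReal_word (m : Memory) (a i : ℕ) (v : ℝ) : (m.setReal a i v).word = m.word := rfl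

theorem Memory.setReal_real_self (m : Memory) (a i : ℕ) (v : ℝ) :
    (m.setReal a i v).real a = Function.update (m.real a) i v := by
  simp [Memory.setReal]

theorem Memory.setReal_real_ne (m : Memory) {a b : ℕ} (i : ℕ) (v : ℝ) (h : b ≠ a) :
    (m.setReal a i v).real b = m.real b := by
  simp [Memory.setReal, h]

/-- Together with `Run.mono` and `Run.loop` this allows postconditions to mention only what changes;
every other array is recovered from the program text by `decide` or `simp`. -/
theorem Exec.frame {w : ℕ} {c : Prog} {m m' : Memory} {t : ℕ} (h : Exec w c m m' t) :
    c.Frame m m' := by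
  induction h with
  | skip m => exact ⟨fun _ _ => rfl, fun _ _ => rfl⟩
  | wset a i e m =>
    exact ⟨fun b hb => m.setWord_word_ne _ _ (by simpa [Prog.words] using hb), fun _ _ => rfl⟩
  | rset a i e m =>
    exact ⟨fun _ _ => rfl, fun b hb => m.setReal_real_ne _ _ (by simpa [Prog.reals] using hb)⟩
  | seq _ _ ih₁ ih₂ =>
    refine ⟨fun b hb => ?_, fun b hb => ?_⟩
    · simp only [Prog.words, List.mem_append, not_or] at hb
      rw [ih₂.word b hb.2, ih₁.word b hb.1]
    · simp only [Prog.reals, List.mem_append, not_or] at hb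
      rw [ih₂.real b hb.2, ih₁.real b hb.1]
  | iteTrue _ _ ih =>
    refine ⟨fun b hb => ?_, fun b hb => ?_⟩
    · simp only [Prog.words, List.mem_append, not_or] at hb
      exact ih.word b hb.1
    · simp only [Prog.reals, List.mem_append, not_or] at hb
      exact ih.real b hb.1
  | iteFalse _ _ ih =>
    refine ⟨fun b hb => ?_, fun b hb => ?_⟩
    · simp only [Prog.words, List.mem_append, not_or] at hb
      exact ih.word b hb.2
    · simp only [Prog.reals, List.mem_append, not_or] at hb
      exact ih.real b hb.2
  | loopDone => exact ⟨fun _ _ => rfl, fun _ _ => rfl⟩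
  | loopStep _ _ _ ih₁ ih₂ =>
    exact ⟨fun b hb => (ih₂.word b hb).trans (ih₁.word b hb),
      fun b hb => (ih₂.real b hb).trans (ih₁.real b hb)⟩

variable {w : ℕ} {c d : Prog} {b : Test} {m : Memory} {Q Q' : Memory → ℕ → Prop}

theorem Run.mono (h : Run w c m Q) (hQ : ∀ m' t, c.Frame m m' → Q m' t → Q' m' t) :
    Run w c m Q' := by
  obtain ⟨m', t, he, hq⟩ := h
  exact ⟨m', t, he, hQ m' t he.frame hq⟩

theorem run_skip : Run w .skip m Q ↔ Q m 1 :=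
  ⟨fun ⟨_, _, he, hq⟩ => by cases he; exact hq, fun h => ⟨_, _, .skip m, h⟩⟩

theorem run_wset {a : ℕ} {i e : WExp} : Run w (.wset a i e) m Q ↔
    i.eval m ≤ w ∧ e.eval m ≤ w ∧ Q (m.setWord a (i.eval m) (e.eval m)) (i.cost + e.cost + 1) :=
  ⟨fun ⟨_, _, he, hq⟩ => by cases he with | wset _ _ _ _ h1 h2 => exact ⟨h1, h2, hq⟩,
    fun ⟨h1, h2, h⟩ => ⟨_, _, .wset a i e m h1 h2, h⟩⟩

theorem run_rset {a : ℕ} {i : WExp} {e : RExp} : Run w (.rset a i e) m Q ↔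
    i.eval m ≤ w ∧ Q (m.setReal a (i.eval m) (e.eval m)) (i.cost + e.cost + 1) :=
  ⟨fun ⟨_, _, he, hq⟩ => by cases he with | rset _ _ _ _ h1 => exact ⟨h1, hq⟩,
    fun ⟨h1, h⟩ => ⟨_, _, .rset a i e m h1, h⟩⟩

theorem run_seq : Run w (.seq c d) m Q ↔
    Run w c m fun m₁ t₁ => Run w d m₁ fun m₂ t₂ => Q m₂ (t₁ + t₂) :=
  ⟨fun ⟨_, _, he, hq⟩ => by cases he with | seq h1 h2 => exact ⟨_, _, h1, _, _, h2, hq⟩,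
    fun ⟨_, _, h1, _, _, h2, hq⟩ => ⟨_, _, .seq h1 h2, hq⟩⟩

theorem run_ite : Run w (.ite b c d) m Q ↔
    (b.Holds m → Run w c m fun m' t => Q m' (b.cost + t + 1)) ∧
    (¬ b.Holds m → Run w d m fun m' t => Q m' (b.cost + t + 1)) := by
  constructor
  · rintro ⟨_, _, he, hq⟩
    cases he with
    | iteTrue hb h => exact ⟨fun _ => ⟨_, _, h, hq⟩, fun hn => absurd hb hn⟩
    | iteFalse hb h => exact ⟨fun hn => absurd hn hb, fun _ => ⟨_, _, h, hq⟩⟩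
  · rintro ⟨h1, h2⟩
    by_cases hb : b.Holds m
    · obtain ⟨_, _, h, hq⟩ := h1 hb
      exact ⟨_, _, .iteTrue hb h, hq⟩
    · obtain ⟨_, _, h, hq⟩ := h2 hb
      exact ⟨_, _, .iteFalse hb h, hq⟩

theorem Run.seq (h : Run w c m fun m₁ t₁ => Run w d m₁ fun m₂ t₂ => Q m₂ (t₁ + t₂)) :
    Run w (.seq c d) m Q := run_seq.2 h

/-- Loop rule: `I k` is the invariant with remaining time budget `k`. -/
theorem Run.loop (I : ℕ → Memory → Prop) {k : ℕ} (h0 : I k m)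
    (hs : ∀ k' m', (Prog.loop b c).Frame m m' → I k' m' → b.Holds m' →
      Run w c m' fun m'' t => ∃ k'', I k'' m'' ∧ t + b.cost + 1 + k'' ≤ k')
    (hQ : ∀ k' m' t, (Prog.loop b c).Frame m m' → I k' m' → ¬ b.Holds m' →
      t + k' ≤ k + b.cost + 1 → Q m' t) :
    Run w (.loop b c) m Q := by
  have key : ∀ k' m', (Prog.loop b c).Frame m m' → I k' m' →
      ∃ m'' t k'', Exec w (.loop b c) m' m'' t ∧ (Prog.loop b c).Frame m m'' ∧ I k'' m'' ∧
        ¬ b.Holds m'' ∧ t + k'' ≤ k' + b.cost + 1 := by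
    intro k'
    induction k' using Nat.strong_induction_on with
    | _ k' ih =>
      intro m' hf hI
      by_cases hb : b.Holds m'
      · obtain ⟨m₁, t, he, k₁, hI₁, hk⟩ := hs k' m' hf hI hb
        have hf₁ : (Prog.loop b c).Frame m m₁ :=
          ⟨fun a ha => (he.frame.word a ha).trans (hf.word a ha),
            fun a ha => (he.frame.real a ha).trans (hf.real a ha)⟩
        obtain ⟨m₂, t₂, k₂, he₂, hf₂, hI₂, hb₂, hk₂⟩ := ih k₁ (by omega) m₁ hf₁ hI₁
        exact ⟨m₂, _, k₂, .loopStep hb he he₂, hf₂, hI₂, hb₂, by omega⟩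
      · exact ⟨m', _, k', .loopDone hb, hf, hI, hb, by omega⟩
  obtain ⟨m', t, k', he, hf, hI, hb, hk⟩ := key k m ⟨fun _ _ => rfl, fun _ _ => rfl⟩ h0
  exact ⟨m', t, he, hQ k' m' t hf hI hb hk⟩

/-! ## Tournament trees

The leaves of the tree are the cells `M, …, 2 M - 1` of word array 20, and cell `M + x` holds `x`;
the cell of an inner node holds the leaf with largest key (real array 20) below it. -/

/-- Node `i` is an ancestor of node `l`, or `l` itself. -/
def Above (i l : ℕ) : Prop := ∃ k, l / 2 ^ k = i

theorem Above.refl (i : ℕ) : Above i i := ⟨0, by simp⟩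

theorem Above.eq_or_half {i l : ℕ} (h : Above i l) : i = l ∨ Above i (l / 2) := by
  obtain ⟨k, rfl⟩ := h
  cases k with
  | zero => simp
  | succ k => exact Or.inr ⟨k, by rw [pow_succ', Nat.div_div_eq_div_mul]⟩

theorem Above.of_half {i l : ℕ} (h : Above i (l / 2)) : Above i l := by
  obtain ⟨k, rfl⟩ := h
  exact ⟨k + 1, by rw [pow_succ', Nat.div_div_eq_div_mul]⟩

theorem Above.le {i l : ℕ} (h : Above i l) : i ≤ l := by
  obtain ⟨k, rfl⟩ := h
  exact Nat.div_le_self _ _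

theorem Above.parent {i l : ℕ} (h : Above i l) : Above (i / 2) l := by
  obtain ⟨k, rfl⟩ := h
  exact ⟨k + 1, by rw [pow_succ, Nat.div_div_eq_div_mul]⟩

theorem Above.child {i l : ℕ} (h : Above i l) (hne : i ≠ l) :
    Above (2 * i) l ∨ Above (2 * i + 1) l := by
  obtain ⟨k, rfl⟩ := h
  cases k with
  | zero => simp at hne
  | succ k =>
    rw [pow_succ, ← Nat.div_div_eq_div_mul]
    rcases Nat.even_or_odd' (l / 2 ^ k) with ⟨j, hj | hj⟩
    · exact Or.inl ⟨k, by omega⟩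
    · exact Or.inr ⟨k, by omega⟩

theorem above_one {l : ℕ} (h : 1 ≤ l) : Above 1 l := by
  induction l using Nat.strong_induction_on with
  | _ l ih =>
    rcases Nat.lt_or_ge l 2 with h2 | h2
    · obtain rfl : l = 1 := by omega
      exact Above.refl 1
    · exact (ih (l / 2) (by omega) (by omega)).of_half

/-- A winner is required to be a leaf below `i`, not only to have a maximal key. The number `M` of
leaves need not be a power of two: children of inner nodes always have indices in `2, …, 2 M - 1`.
-/
def NodeOK (M : ℕ) (tr : ℕ → ℕ) (ky : ℕ → ℝ) (i : ℕ) : Prop :=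
  tr i < M ∧ Above i (M + tr i) ∧ ∀ x < M, Above i (M + x) → ky x ≤ ky (tr i)

/-- All nodes hold winners. -/
def TreeOK (M : ℕ) (tr : ℕ → ℕ) (ky : ℕ → ℝ) : Prop :=
  ∀ i, 1 ≤ i → i < 2 * M → NodeOK M tr ky i

variable {M : ℕ} {tr : ℕ → ℕ} {ky ky' : ℕ → ℝ}

/-- Halving the index of a leaf gives a number below `M`, so no leaf is a proper ancestor of
another. -/
theorem leaf_eq {x j : ℕ} (hx : x < M) (hj : M ≤ j) (h : Above j (M + x)) : j = M + x := by
  rcases h.eq_or_half with h | h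
  · exact h
  · have := h.le
    omega

theorem nodeOK_leaf {x : ℕ} (hx : x < M) (h : tr (M + x) = x) : NodeOK M tr ky (M + x) := by
  refine ⟨by rw [h]; exact hx, by rw [h]; exact Above.refl _, fun y hy hxy => ?_⟩
  have := leaf_eq hy (Nat.le_add_right M x) hxy
  rw [h, show y = x by omega]

theorem NodeOK.leaf {x : ℕ} (h : NodeOK M tr ky (M + x)) : tr (M + x) = x := by
  have := leaf_eq h.1 (Nat.le_add_right M x) h.2.1
  omega

theorem NodeOK.congr_tree {tr' : ℕ → ℕ} {i : ℕ} (h : NodeOK M tr ky i) (he : tr' i = tr i) :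
    NodeOK M tr' ky i := by
  unfold NodeOK
  rw [he]
  exact h

/-- Neither the winner at `j` nor any leaf competing there is the changed leaf `x`. -/
theorem NodeOK.congr_key {x j : ℕ} (h : NodeOK M tr ky j) (hk : ∀ y, y ≠ x → ky' y = ky y)
    (hj : ¬ Above j (M + x)) : NodeOK M tr ky' j := by
  refine ⟨h.1, h.2.1, fun y hy hjy => ?_⟩
  rw [hk y fun e => hj (e ▸ hjy), hk (tr j) fun e => hj (e ▸ h.2.1)]
  exact h.2.2 y hy hjy

theorem nodeOK_inner {i v : ℕ} (hi : i < M) (hl : NodeOK M tr ky (2 * i))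
    (hr : NodeOK M tr ky (2 * i + 1)) (hv : v = tr (2 * i) ∨ v = tr (2 * i + 1))
    (hvl : ky (tr (2 * i)) ≤ ky v) (hvr : ky (tr (2 * i + 1)) ≤ ky v) :
    NodeOK M (Function.update tr i v) ky i := by
  unfold NodeOK
  rw [Function.update_self]
  refine ⟨?_, ?_, fun y hy hiy => ?_⟩
  · rcases hv with rfl | rfl
    · exact hl.1
    · exact hr.1
  · rcases hv with rfl | rfl
    · simpa using hl.2.1.parent
    · have := hr.2.1.parent
      rwa [show (2 * i + 1) / 2 = i by omega] at this
  · rcases hiy.child (by omega) with h | h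
    · exact (hl.2.2 y hy h).trans hvl
    · exact (hr.2.2 y hy h).trans hvr

theorem TreeOK.root_lt (h : TreeOK M tr ky) (hM : 1 ≤ M) : tr 1 < M :=
  (h 1 le_rfl (by omega)).1

theorem TreeOK.le_root (h : TreeOK M tr ky) {x : ℕ} (hx : x < M) : ky x ≤ ky (tr 1) :=
  (h 1 le_rfl (by omega)).2.2 x hx (above_one (by omega))

/-- Scalar variables are stored in cell 0 of their own array. -/
abbrev var (a : ℕ) : WExp := .load a (.lit 0)

abbrev rvar (a : ℕ) : RExp := .load a (.lit 0)

/-- Recompute the winner at the node in word variable 22. -/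
def fixNode : Prog :=
  .ite (.rle (.load 20 (.load 20 (.add (.add (var 22) (var 22)) (.lit 1))))
      (.load 20 (.load 20 (.add (var 22) (var 22)))))
    (.wset 20 (var 22) (.load 20 (.add (var 22) (var 22))))
    (.wset 20 (var 22) (.load 20 (.add (.add (var 22) (var 22)) (.lit 1))))

def climb : Prog := .loop (.wle (.lit 1) (var 22)) (.seq fixNode (.wset 22 (.lit 0) (.half (var 22))))

/-- Restore the tree after a change of the key of leaf `x`. -/
def treeUpdate (x : WExp) : Prog := .seq (.wset 22 (.lit 0) (.half (.add (var 21) x))) climb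

def treeBuild : Prog :=
  .seq (.wset 22 (.lit 0) (.lit 0))
  (.seq (.loop (.wle (.add (var 22) (.lit 1)) (var 21))
      (.seq (.wset 20 (.add (var 21) (var 22)) (var 22))
        (.wset 22 (.lit 0) (.add (var 22) (.lit 1)))))
  (.seq (.wset 22 (.lit 0) (.sub (var 21) (.lit 1)))
  (.loop (.wle (.lit 1) (var 22)) (.seq fixNode (.wset 22 (.lit 0) (.sub (var 22) (.lit 1)))))))

theorem run_fixNode {i : ℕ} (hi : m.word 22 0 = i) (hiM : i < M) (hw : M ≤ w)
    (hl : NodeOK M (m.word 20) (m.real 20) (2 * i))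
    (hr : NodeOK M (m.word 20) (m.real 20) (2 * i + 1)) :
    Run w fixNode m fun m' t => t ≤ 40 ∧ NodeOK M (m'.word 20) (m.real 20) i ∧
      ∀ j, j ≠ i → m'.word 20 j = m.word 20 j := by
  have h2 : i + i = 2 * i := by omega
  have := hl.1
  have := hr.1
  simp only [fixNode, run_ite, run_wset, Test.Holds, WExp.eval, RExp.eval, Test.cost, WExp.cost,
    RExp.cost, hi, h2, Memory.setWord_word_self]
  refine ⟨fun h => ⟨by omega, by omega, by omega, ?_, fun j hj => Function.update_of_ne hj _ _⟩,
    fun h => ⟨by omega, by omega, by omega, ?_, fun j hj => Function.update_of_ne hj _ _⟩⟩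
  · exact nodeOK_inner hiM hl hr (Or.inl rfl) le_rfl h
  · exact nodeOK_inner hiM hl hr (Or.inr rfl) (not_le.1 h).le le_rfl

/-- Only ancestors of the changed leaf can hold wrong winners. They are repaired bottom-up, and the
loop runs at most `L` times because the index is below `2 ^ L` and is halved each time. -/
theorem run_treeUpdate {x : WExp} {L : ℕ} (hM : m.word 21 0 = M) (hx : x.eval m < M) (hw : M ≤ w)
    (hL : M < 2 ^ L) (hk : ∀ y, y ≠ x.eval m → m.real 20 y = ky y)
    (ht : TreeOK M (m.word 20) ky) :
    Run w (treeUpdate x) m fun m' t => t ≤ 50 * L + x.cost + 20 ∧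
      TreeOK M (m'.word 20) (m.real 20) := by
  set xv := x.eval m with hxv
  refine Run.seq (run_wset.2 ?_)
  simp only [WExp.eval, WExp.cost, hM, ← hxv]
  refine ⟨by omega, by omega, ?_⟩
  refine Run.loop (I := fun k m' => ∃ L i, m'.word 22 0 = i ∧ i < M ∧ i < 2 ^ L ∧ k = 50 * L ∧
      ∀ j, 1 ≤ j → j < 2 * M → NodeOK M (m'.word 20) (m.real 20) j ∨ Above j i) (k := 50 * L) ?_ ?_ ?_
  · refine ⟨L, (M + xv) / 2, by simp [Memory.setWord_word_self], by omega, by omega, rfl, ?_⟩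
    intro j hj1 hj2
    rw [Memory.setWord_word_ne _ _ _ (by decide)]
    have hj := ht j hj1 hj2
    by_cases h : Above j (M + xv)
    · rcases h.eq_or_half with rfl | h
      · exact Or.inl (nodeOK_leaf hx hj.leaf)
      · exact Or.inr h
    · exact Or.inl (hj.congr_key hk h)
  · rintro k m₁ hf ⟨L, i, hi, hiM, hiL, rfl, hok⟩ hb
    have hr : m₁.real 20 = m.real 20 := hf.real 20 (by decide)
    simp only [Test.Holds, WExp.eval, hi] at hb
    -- An ancestor of `i` is at most `i`, so both children of `i` are already correct.
    have hch : ∀ j, i < j → j < 2 * M → NodeOK M (m₁.word 20) (m₁.real 20) j := fun j h1 h2 => by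
      rw [hr]
      exact (hok j (by omega) h2).resolve_right fun h => by have := h.le; omega
    refine Run.seq ((run_fixNode hi hiM hw (hch _ (by omega) (by omega))
      (hch _ (by omega) (by omega))).mono ?_)
    rintro m₂ t hf₂ ⟨ht₂, hn, ho⟩
    have hi₂ : m₂.word 22 0 = i := by rw [hf₂.word 22 (by decide), hi]
    simp only [run_wset, WExp.eval, WExp.cost, Test.cost, hi₂]
    obtain ⟨L, rfl⟩ : ∃ L', L = L' + 1 := ⟨L - 1, by
      cases L with
      | zero => simp at hiL; omega
      | succ L => rfl⟩
    refine ⟨by omega, by omega, 50 * L, ⟨L, i / 2, by simp [Memory.setWord_word_self], by omega,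
      by rw [pow_succ] at hiL; omega, rfl, ?_⟩, by omega⟩
    intro j hj1 hj2
    rw [Memory.setWord_word_ne _ _ _ (by decide)]
    by_cases hji : j = i
    · subst hji
      exact Or.inl (hr ▸ hn)
    · rcases hok j hj1 hj2 with h | h
      · exact Or.inl (h.congr_tree (ho j hji))
      · exact Or.inr (h.eq_or_half.resolve_left hji)
  · rintro k m₁ t hf ⟨L', i, hi, hiM, hiL, rfl, hok⟩ hb ht'
    simp only [Test.Holds, WExp.eval, hi] at hb
    simp only [Test.cost, WExp.cost] at ht'
    refine ⟨by omega, fun j hj1 hj2 => (hok j hj1 hj2).resolve_right fun h => ?_⟩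
    have := h.le
    omega

/-- Inner nodes are filled by decreasing index, so both children are ready; this is linear in `M`,
without a logarithm. -/
theorem run_treeBuild (hM : m.word 21 0 = M) (hw : 2 * M ≤ w) :
    Run w treeBuild m fun m' t => t ≤ 100 * M + 60 ∧ TreeOK M (m'.word 20) (m.real 20) := by
  refine Run.seq (run_wset.2 ?_)
  simp only [WExp.eval, WExp.cost]
  refine ⟨by omega, by omega, Run.seq ?_⟩
  refine Run.loop (I := fun k m' => ∃ i, m'.word 22 0 = i ∧ i ≤ M ∧ k = 40 * (M - i) ∧
      ∀ x < i, m'.word 20 (M + x) = x) (k := 40 * M) ?_ ?_ ?_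
  · exact ⟨0, by simp [Memory.setWord_word_self], by omega, by omega, by simp⟩
  · rintro k m₁ hf ⟨i, hi, hiM, rfl, hx⟩ hb
    have hM₁ : m₁.word 21 0 = M := by
      rw [hf.word 21 (by decide), Memory.setWord_word_ne _ _ _ (by decide), hM]
    simp only [Test.Holds, WExp.eval, hi, hM₁] at hb
    simp (disch := decide) only [run_seq, run_wset, WExp.eval, WExp.cost, Test.cost, hi, hM₁,
      Memory.setWord_word_self, Memory.setWord_word_ne]
    refine ⟨by omega, by omega, by omega, by omega, 40 * (M - (i + 1)), ⟨i + 1, by simp, by omega, rfl,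
      fun x hx' => ?_⟩, by omega⟩
    by_cases h : x = i
    · subst h; simp
    · rw [Function.update_of_ne (by omega)]
      exact hx x (by omega)
  · rintro k m₁ t hf ⟨i, hi, hiM, rfl, hx⟩ hb ht
    have hM₁ : m₁.word 21 0 = M := by
      rw [hf.word 21 (by decide), Memory.setWord_word_ne _ _ _ (by decide), hM]
    have hr₁ : m₁.real 20 = m.real 20 := hf.real 20 (by decide)
    simp only [Test.Holds, WExp.eval, hi, hM₁] at hb
    simp only [Test.cost, WExp.cost] at ht
    obtain rfl : i = M := by omega
    refine Run.seq (run_wset.2 ?_)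
    simp only [WExp.eval, WExp.cost, hM₁]
    refine ⟨by omega, by omega, ?_⟩
    refine Run.loop (I := fun k m' => ∃ j, m'.word 22 0 = j ∧ j ≤ i - 1 ∧ k = 55 * j ∧
      ∀ n, j < n → n < 2 * i → NodeOK i (m'.word 20) (m.real 20) n) (k := 55 * (i - 1)) ?_ ?_ ?_
    · refine ⟨i - 1, by simp [Memory.setWord_word_self], le_rfl, rfl, fun n h1 h2 => ?_⟩
      rw [Memory.setWord_word_ne _ _ _ (by decide)]
      obtain ⟨x, rfl⟩ := Nat.exists_eq_add_of_le (show i ≤ n by omega)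
      exact nodeOK_leaf (by omega) (hx x (by omega))
    · rintro k m₂ hf₂ ⟨j, hj, hjM, rfl, hok⟩ hb₂
      simp only [Test.Holds, WExp.eval, hj] at hb₂
      have hr₂ : m₂.real 20 = m.real 20 := (hf₂.real 20 (by decide)).trans hr₁
      refine Run.seq ((run_fixNode hj (M := i) (by omega) (by omega)
        (by rw [hr₂]; exact hok _ (by omega) (by omega))
        (by rw [hr₂]; exact hok _ (by omega) (by omega))).mono ?_)
      rintro m₃ t₃ hf₃ ⟨ht₃, hn, ho⟩
      have hj₃ : m₃.word 22 0 = j := by rw [hf₃.word 22 (by decide), hj]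
      simp only [run_wset, WExp.eval, WExp.cost, Test.cost, hj₃]
      refine ⟨by omega, by omega, 55 * (j - 1), ⟨j - 1, by simp [Memory.setWord_word_self],
        by omega, rfl, fun n h1 h2 => ?_⟩, by omega⟩
      rw [Memory.setWord_word_ne _ _ _ (by decide)]
      by_cases hnj : n = j
      · subst hnj; exact hr₂ ▸ hn
      · exact (hok n (by omega) h2).congr_tree (ho n hnj)
    · rintro k m₂ t₂ hf₂ ⟨j, hj, hjM, rfl, hok⟩ hb₂ ht₂
      simp only [Test.Holds, WExp.eval, hj] at hb₂
      simp only [Test.cost, WExp.cost] at ht₂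
      exact ⟨by omega, fun n h1 h2 => hok n (by omega) h2⟩

end RealRAM

namespace RealRAM

variable {w : ℕ} {m : Memory} {Q : Memory → ℕ → Prop}

/-- `for a = lo, …, hi - 1 do body`. -/
def forLoop (a : ℕ) (lo hi : WExp) (body : Prog) : Prog :=
  .seq (.wset a (.lit 0) lo) (.loop (.wle (.add (var a) (.lit 1)) hi)
    (.seq body (.wset a (.lit 0) (.add (var a) (.lit 1)))))

/-- The invariant is transferred to the memory after the counter has been advanced, so it may depend
on the whole memory; `c` bounds the cost of every single pass. -/
theorem run_forLoop {a l n c : ℕ} {lo hi : WExp} {body : Prog} (I : ℕ → Memory → Prop)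
    (ha : a ∉ body.words) (hl : lo.eval m = l) (hln : l ≤ n) (hn : n ≤ w)
    (hhi : ∀ m', (forLoop a lo hi body).Frame m m' → hi.eval m' = n)
    (h0 : I l (m.setWord a 0 l))
    (hs : ∀ i m', l ≤ i → i < n → (forLoop a lo hi body).Frame m m' → m'.word a 0 = i → I i m' →
      Run w body m' fun m'' t => I (i + 1) (m''.setWord a 0 (i + 1)) ∧ t ≤ c) :
    Run w (forLoop a lo hi body) m fun m' t =>
      I n m' ∧ t ≤ (n - l) * (c + hi.cost + 15) + lo.cost + hi.cost + 15 := by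
  have hfr : ∀ m', (Prog.loop (.wle (.add (var a) (.lit 1)) hi)
      (.seq body (.wset a (.lit 0) (.add (var a) (.lit 1))))).Frame (m.setWord a 0 l) m' →
      (forLoop a lo hi body).Frame m m' := by
    refine fun m' hf => ⟨fun b hb => ?_, fun b hb => ?_⟩
    · simp only [forLoop, Prog.words, List.mem_append, List.mem_singleton, not_or] at hb
      rw [hf.word b (by simp [Prog.words, hb.1, hb.2.1]), Memory.setWord_word_ne _ _ _ hb.1]
    · simp only [forLoop, Prog.reals, List.mem_append, not_or] at hb
      rw [hf.real b (by simp [Prog.reals, hb.2.1]), Memory.setWord_real]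
  refine Run.seq (run_wset.2 ?_)
  simp only [WExp.eval, WExp.cost, hl]
  refine ⟨by omega, by omega, ?_⟩
  refine Run.loop (I := fun k m' => ∃ i, m'.word a 0 = i ∧ l ≤ i ∧ i ≤ n ∧ I i m' ∧
    k = (n - i) * (c + hi.cost + 15)) (k := (n - l) * (c + hi.cost + 15)) ?_ ?_ ?_
  · exact ⟨l, by simp [Memory.setWord_word_self], le_rfl, hln, h0, rfl⟩
  · rintro k m₁ hf ⟨i, hi', hli, hin, hI, rfl⟩ hb
    simp only [Test.Holds, WExp.eval, hi', hhi m₁ (hfr m₁ hf)] at hb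
    refine Run.seq ((hs i m₁ hli (by omega) (hfr m₁ hf) hi' hI).mono ?_)
    rintro m₂ t hf₂ ⟨hI₂, ht⟩
    have hi₂ : m₂.word a 0 = i := by rw [hf₂.word a ha, hi']
    simp only [run_wset, WExp.eval, WExp.cost, Test.cost, hi₂]
    refine ⟨by omega, by omega, _, ⟨i + 1, by simp [Memory.setWord_word_self], by omega, by omega,
      hI₂, rfl⟩, ?_⟩
    obtain ⟨r, rfl⟩ : ∃ r, n = i + 1 + r := Nat.exists_eq_add_of_le hb
    rw [show i + 1 + r - (i + 1) = r by omega, show i + 1 + r - i = r + 1 by omega, Nat.add_mul]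
    omega
  · rintro k m₁ t hf ⟨i, hi', hli, hin, hI, rfl⟩ hb ht
    simp only [Test.Holds, WExp.eval, hi', hhi m₁ (hfr m₁ hf)] at hb
    simp only [Test.cost, WExp.cost] at ht
    obtain rfl : i = n := by omega
    exact ⟨hI, by omega⟩

/-! ## The adjacency slots -/

/-- Positions in the concatenated adjacency lists. -/
structure Slots {N : ℕ} (T : ImpreciseTerrain (Fin N)) (S : ℕ) (off adj : ℕ → ℕ) : Prop where
  zero : off 0 = 0
  last : off N = S
  mono : ∀ v : Fin N, off v ≤ off (v + 1)
  adj_of_slot : ∀ (v : Fin N) (x : ℕ), off v ≤ x → x < off (v + 1) →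
    ∃ u : Fin N, adj x = u ∧ T.graph.Adj v u
  slot_of_adj : ∀ v u : Fin N, T.graph.Adj v u → ∃ x, off v ≤ x ∧ x < off (v + 1) ∧ adj x = u
  card : S = 2 * T.numEdges

/-- The offsets are partial sums of degrees, so the number of slots is twice the number of edges by
the handshake lemma. -/
theorem Encodes.slots {N : ℕ} {T : ImpreciseTerrain (Fin N)} {Q : Finset (Fin N)}
    (h : Encodes T Q m) : Slots T (m.word 2 N) (m.word 2) (m.word 3) := by
  classical
  refine ⟨h.offset_zero, rfl, fun v => ?_, fun v x h1 h2 => ?_, fun v u hvu => ?_, ?_⟩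
  · obtain ⟨l, -, -, hl, -⟩ := h.adjacency v
    omega
  · obtain ⟨l, -, hl, hlen, hadj⟩ := h.adjacency v
    obtain ⟨i, rfl⟩ := Nat.exists_eq_add_of_le h1
    exact ⟨l[i]'(by omega), hadj i (by omega), (hl _).1 (List.getElem_mem _)⟩
  · obtain ⟨l, -, hl, hlen, hadj⟩ := h.adjacency v
    obtain ⟨i, hi, rfl⟩ := List.getElem_of_mem ((hl u).2 hvu)
    exact ⟨m.word 2 v + i, by omega, by omega, hadj i hi⟩
  · have hdeg : ∀ v : Fin N, m.word 2 (v + 1) = m.word 2 v + T.graph.degree v := by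
      intro v
      obtain ⟨l, hnd, hl, hlen, -⟩ := h.adjacency v
      rw [hlen, ← List.toFinset_card_of_nodup hnd, ← SimpleGraph.card_neighborFinset_eq_degree]
      congr 2
      ext u
      simp [hl]
    have hsum : ∀ n (hn : n ≤ N),
        m.word 2 n = ∑ i : Fin n, T.graph.degree (Fin.castLE hn i) := by
      intro n
      induction n with
      | zero => intro; simpa using h.offset_zero
      | succ n ih =>
        intro hn
        rw [Fin.sum_univ_castSucc, hdeg ⟨n, by omega⟩, ih (by omega)]
        rfl
    have := hsum N le_rfl
    rw [this]
    simp only [Fin.castLE_rfl, id_eq]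
    rw [T.graph.sum_degrees_eq_twice_card_edges, ImpreciseTerrain.numEdges,
      ← SimpleGraph.coe_edgeFinset, Set.ncard_coe_finset]

theorem Slots.mono_le {N : ℕ} {T : ImpreciseTerrain (Fin N)} {S : ℕ} {off adj : ℕ → ℕ}
    (h : Slots T S off adj) {i j : ℕ} (hij : i ≤ j) (hj : j ≤ N) : off i ≤ off j := by
  induction j, hij using Nat.le_induction with
  | base => exact le_rfl
  | succ j _ ih => exact (ih (by omega)).trans (h.mono ⟨j, by omega⟩)

theorem Slots.sum_eq {N : ℕ} {T : ImpreciseTerrain (Fin N)} {S : ℕ} {off adj : ℕ → ℕ}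
    (h : Slots T S off adj) : ∑ v ∈ Finset.range N, (off (v + 1) - off v) = S := by
  have : ∀ n ≤ N, ∑ v ∈ Finset.range n, (off (v + 1) - off v) = off n := by
    intro n
    induction n with
    | zero => simp [h.zero]
    | succ n ih =>
      intro hn
      have := h.mono ⟨n, hn⟩
      simp only at this
      rw [Finset.sum_range_succ, ih (by omega)]
      omega
  rw [this N le_rfl, h.last]

/-- The arrays that hold the source node and the length of every slot are filled. -/
def SlotArrays {N : ℕ} (T : ImpreciseTerrain (Fin N)) (S : ℕ) (off adj src : ℕ → ℕ)
    (len : ℕ → ℝ) : Prop :=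
  ∀ x < S, ∃ v u : Fin N, src x = v ∧ adj x = u ∧ off v ≤ x ∧ x < off (v + 1) ∧
    T.graph.Adj v u ∧ len x = dist (T.pos v) (T.pos u)

/-- Compute source nodes (word array 10) and lengths (real arrays 5 and 20) of all slots. -/
def initSlots : Prog :=
  .seq (.wset 21 (.lit 0) (.load 2 (var 0)))
  (.seq (.wset 23 (.lit 0) (.lit 0))
  (.seq (.wset 24 (.lit 0) (.lit 0))
  (.loop (.wle (.add (var 24) (.lit 1)) (var 21))
    (.ite (.wle (.load 2 (.add (var 23) (.lit 1))) (var 24))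
      (.wset 23 (.lit 0) (.add (var 23) (.lit 1)))
      (.seq (.wset 10 (var 24) (var 23))
      (.seq (.rset 5 (var 24) (.sqrt (.add
          (.mul (.sub (.load 0 (var 23)) (.load 0 (.load 3 (var 24))))
            (.sub (.load 0 (var 23)) (.load 0 (.load 3 (var 24)))))
          (.mul (.sub (.load 1 (var 23)) (.load 1 (.load 3 (var 24))))
            (.sub (.load 1 (var 23)) (.load 1 (.load 3 (var 24))))))))
      (.seq (.rset 20 (var 24) (.load 5 (var 24)))
      (.wset 24 (.lit 0) (.add (var 24) (.lit 1))))))))))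

/-- A merge of nodes and slots: each pass advances either the node `v` or the slot `x`, which gives
the linear budget `80 * ((N - v) + (S - x))`. Nodes without slots are skipped in the same way. -/
theorem run_initSlots {N : ℕ} {T : ImpreciseTerrain (Fin N)} {Q : Finset (Fin N)}
    (h : Encodes T Q m) {S : ℕ} (hS : m.word 2 N = S) (hw : N + S ≤ w) :
    Run w initSlots m fun m' t => t ≤ 100 * (N + S) + 100 ∧ m'.word 21 0 = S ∧
      SlotArrays T S (m.word 2) (m.word 3) (m'.word 10) (m'.real 5) ∧
      ∀ x < S, m'.real 20 x = m'.real 5 x := by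
  have hsl := h.slots
  rw [hS] at hsl
  have hN := h.numNodes
  simp (disch := decide) only [initSlots, run_seq, run_wset, WExp.eval, WExp.cost,
    hN, hS]
  refine ⟨by omega, by omega, by omega, by omega, by omega, by omega, ?_⟩
  set m₀ := ((m.setWord 21 0 S).setWord 23 0 0).setWord 24 0 0 with hm₀
  refine Run.loop (I := fun k m' => ∃ v x, m'.word 23 0 = v ∧ m'.word 24 0 = x ∧ v ≤ N ∧ x ≤ S ∧
    m.word 2 v ≤ x ∧ k = 80 * ((N - v) + (S - x)) ∧
    SlotArrays T x (m.word 2) (m.word 3) (m'.word 10) (m'.real 5) ∧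
      ∀ y < x, m'.real 20 y = m'.real 5 y) (k := 80 * (N + S)) ?_ ?_ ?_
  · refine ⟨0, 0, ?_, ?_, by omega, by omega, hsl.zero.le, by omega, fun x hx => by omega,
      fun y hy => by omega⟩
    · simp (disch := decide) [hm₀, Memory.setWord_word_self, Memory.setWord_word_ne]
    · simp (disch := decide) [hm₀, Memory.setWord_word_self]
  · rintro k m₁ hf ⟨v, x, hv, hx, hvN, hxS, hvx, rfl, hsa, hk⟩ hb
    have hM : m₁.word 21 0 = S := by
      rw [hf.word 21 (by decide)]
      simp (disch := decide) [hm₀, Memory.setWord_word_self, Memory.setWord_word_ne]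
    have h2 : m₁.word 2 = m.word 2 := by
      rw [hf.word 2 (by decide)]
      simp (disch := decide) [hm₀, Memory.setWord_word_ne]
    have h3 : m₁.word 3 = m.word 3 := by
      rw [hf.word 3 (by decide)]
      simp (disch := decide) [hm₀, Memory.setWord_word_ne]
    have hr0 : m₁.real 0 = m.real 0 := hf.real 0 (by decide)
    have hr1 : m₁.real 1 = m.real 1 := hf.real 1 (by decide)
    simp only [Test.Holds, WExp.eval, hM, hx] at hb
    -- At `v = N` the offset is `S`, so an unprocessed slot `x < S` excludes this case.
    have hvN' : v < N := by
      by_contra hc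
      obtain rfl : v = N := by omega
      omega
    rw [run_ite]
    simp only [Test.Holds, WExp.eval, hv, hx, h2]
    refine ⟨fun hb₁ => ?_, fun hb₁ => ?_⟩
    · simp only [run_wset, WExp.eval, WExp.cost, Test.cost, hv]
      refine ⟨by omega, by omega, 80 * ((N - (v + 1)) + (S - x)), ⟨v + 1, x, by
        simp [Memory.setWord_word_self], ?_, by omega, hxS, hb₁, rfl, ?_, ?_⟩, by omega⟩
      · rw [Memory.setWord_word_ne _ _ _ (by decide), hx]
      · rw [Memory.setWord_word_ne _ _ _ (by decide)]; exact hsa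
      · exact hk
    · simp (disch := decide) only [run_seq, run_wset, run_rset, WExp.eval, WExp.cost, Test.cost,
        RExp.eval, RExp.cost, hv, hx, h3, hr0, hr1, Memory.setWord_word_self,
        Memory.setWord_word_ne, Memory.setWord_real, Memory.setReal_word, Memory.setReal_real_self,
        Memory.setReal_real_ne, Function.update_self]
      refine ⟨by omega, by omega, by omega, by omega, by omega, by omega,
        80 * ((N - v) + (S - (x + 1))), ⟨v, x + 1, rfl, rfl, hvN, by omega, by omega, rfl, ?_, ?_⟩,
        by omega⟩
      · intro y hy
        by_cases hyx : y = x
        · subst hyx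
          obtain ⟨u, hu, hvu⟩ := hsl.adj_of_slot ⟨v, hvN'⟩ y hvx (not_le.1 hb₁)
          refine ⟨⟨v, hvN'⟩, u, by simp, hu, hvx, not_le.1 hb₁, hvu, ?_⟩
          have hx1 := h.xcoord ⟨v, hvN'⟩
          have hy1 := h.ycoord ⟨v, hvN'⟩
          simp only at hx1 hy1
          rw [Function.update_self, hu, hx1, hy1, h.xcoord u, h.ycoord u, EuclideanSpace.dist_eq,
            Fin.sum_univ_two, Real.dist_eq, Real.dist_eq, sq_abs, sq_abs, sq, sq]
        · rw [Function.update_of_ne hyx, Function.update_of_ne hyx]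
          exact hsa y (by omega)
      · intro y hy
        by_cases hyx : y = x
        · subst hyx; simp
        · rw [Function.update_of_ne hyx, Function.update_of_ne hyx]
          exact hk y (by omega)
  · rintro k m₁ t hf ⟨v, x, hv, hx, hvN, hxS, hvx, rfl, hsa, hk⟩ hb ht
    have hM : m₁.word 21 0 = S := by
      rw [hf.word 21 (by decide)]
      simp (disch := decide) [hm₀, Memory.setWord_word_self, Memory.setWord_word_ne]
    simp only [Test.Holds, WExp.eval, hM, hx] at hb
    simp only [Test.cost, WExp.cost] at ht
    obtain rfl : x = S := by omega
    exact ⟨by omega, hM, hsa, hk⟩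

end RealRAM

namespace RealRAM

open LineEnvelope

variable {w : ℕ} {m : Memory} {Q : Memory → ℕ → Prop}

/-! ## The envelope stacks

For every node there is a stack of slots, stored in word array 12 from the offset of the node on;
word array 13 holds the numbers of entries, and real array 6 the left end points. -/

def StackRepr (stk : ℕ → ℕ) (st : ℕ → ℝ) (base : ℕ) : List (ℕ × ℝ) → Prop
  | [] => True
  | e :: L => stk (base + L.length) = e.1 ∧ st e.1 = e.2 ∧ StackRepr stk st base L

theorem StackRepr.congr {stk stk' : ℕ → ℕ} {st st' : ℕ → ℝ} {base : ℕ} {L : List (ℕ × ℝ)}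
    (h : StackRepr stk st base L) (h1 : ∀ j, base ≤ j → j < base + L.length → stk' j = stk j)
    (h2 : ∀ e ∈ L, st' e.1 = st e.1) : StackRepr stk' st' base L := by
  induction L with
  | nil => trivial
  | cons e L ih =>
    refine ⟨?_, ?_, ih h.2.2 (fun j hj1 hj2 => h1 j hj1 (by simp; omega))
      fun e he => h2 e (by simp [he])⟩
    · rw [h1 _ (by omega) (by simp)]; exact h.1
    · rw [h2 e (by simp)]; exact h.2.1

theorem StackRepr.suffix {stk : ℕ → ℕ} {st : ℕ → ℝ} {base : ℕ} {L L' : List (ℕ × ℝ)}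
    (h : StackRepr stk st base L) (hs : L' <:+ L) : StackRepr stk st base L' := by
  induction L with
  | nil => rw [List.suffix_nil.1 hs]; trivial
  | cons e L ih =>
    rcases List.suffix_cons_iff.1 hs with rfl | h1
    · exact h
    · exact ih h.2.2 h1

/-- The slot `k` places from the top of the stack of the node in word variable 27. -/
abbrev fromTop (k : ℕ) : WExp :=
  .load 12 (.sub (.add (.load 2 (var 27)) (.load 13 (var 27))) (.lit k))

/-- The value at `e` of the line of slot `s`. -/
abbrev lineAt (s : WExp) (e : RExp) : RExp := .add (.load 3 (.load 3 s)) (.mul (.load 5 s) e)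

/-- Push the slot in word variable 26 on the stack of its source node. -/
def pushLine : Prog :=
  .seq (.wset 27 (.lit 0) (.load 10 (var 26)))
  (.seq (.loop (.conj (.wle (.lit 1) (.load 13 (var 27)))
      (.rle (lineAt (var 26) (.load 6 (fromTop 1))) (lineAt (fromTop 1) (.load 6 (fromTop 1)))))
    (.wset 13 (var 27) (.sub (.load 13 (var 27)) (.lit 1))))
  (.ite (.wle (.load 13 (var 27)) (.lit 0))
    (.seq (.wset 12 (.load 2 (var 27)) (var 26))
    (.seq (.rset 6 (var 26) .zero)
    (.wset 13 (var 27) (.lit 1))))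
    (.ite (.rle (.load 5 (fromTop 1)) (.load 5 (var 26))) .skip
      (.seq (.rset 6 (var 26) (.div
        (.sub (.load 3 (.load 3 (var 26))) (.load 3 (.load 3 (fromTop 1))))
        (.sub (.load 5 (fromTop 1)) (.load 5 (var 26)))))
      (.seq (.wset 12 (.add (.load 2 (var 27)) (.load 13 (var 27))) (var 26))
      (.wset 13 (var 27) (.add (.load 13 (var 27)) (.lit 1))))))))

theorem push_pop {h d : ℕ → ℝ} {x t : ℕ} {s : ℝ} {L : List (ℕ × ℝ)}
    (hc : h x + d x * s ≤ h t + d t * s) : push h d x ((t, s) :: L) = push h d x L := by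
  rw [push, if_pos hc]

/-- The time bound is amortized: the stack length times 90 is a potential that pays for the pops,
and 300 covers the rest. -/
theorem run_pushLine {x v base : ℕ} {L : List (ℕ × ℝ)} {h : ℕ → ℝ}
    (hh : h = fun y => m.real 3 (m.word 3 y))
    (hx : m.word 26 0 = x) (hv : m.word 10 x = v) (hb : m.word 2 v = base)
    (hcnt : m.word 13 v = L.length) (hrep : StackRepr (m.word 12) (m.real 6) base L)
    (hxL : ∀ e ∈ L, e.1 ≠ x) (hxw : x ≤ w) (hvw : v ≤ w) (hLw : L.length ≤ w)
    (hw : base + (push h (m.real 5) x L).length ≤ w) :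
    Run w pushLine m fun m' t =>
      t + 90 * (push h (m.real 5) x L).length ≤ 90 * L.length + 300 ∧
      m'.word 13 v = (push h (m.real 5) x L).length ∧
      (∀ u, u ≠ v → m'.word 13 u = m.word 13 u) ∧
      StackRepr (m'.word 12) (m'.real 6) base (push h (m.real 5) x L) ∧
      (∀ j, j < base ∨ base + (push h (m.real 5) x L).length ≤ j → m'.word 12 j = m.word 12 j) ∧
      (∀ y, y ≠ x → m'.real 6 y = m.real 6 y) := by
  simp only [pushLine, run_seq (c := .wset _ _ _), run_wset, WExp.eval, WExp.cost, hx, hv]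
  refine ⟨by omega, hvw, ?_⟩
  set m₀ := m.setWord 27 0 v with hm₀
  -- A pop does not change the final result of `push`, so the loop keeps a suffix of the stack with
  -- the same result.
  refine Run.seq (Run.loop (I := fun k m' => ∃ L', push h (m.real 5) x L' = push h (m.real 5) x L ∧
    L' <:+ L ∧ m'.word 13 v = L'.length ∧ (∀ u, u ≠ v → m'.word 13 u = m.word 13 u) ∧
    k = 90 * L'.length) (k := 90 * L.length) ?_ ?_ ?_)
  · refine ⟨L, rfl, List.suffix_rfl, ?_, ?_, rfl⟩
    · rw [hm₀, Memory.setWord_word_ne _ _ _ (by decide), hcnt]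
    · intro u _
      rw [hm₀, Memory.setWord_word_ne _ _ _ (by decide)]
  all_goals
    first
      | rintro k m₁ t hf ⟨L', hp, hsuf, hc, hco, rfl⟩
      | rintro k m₁ hf ⟨L', hp, hsuf, hc, hco, rfl⟩
    have h26 : m₁.word 26 0 = x := by
      rw [hf.word 26 (by decide), hm₀, Memory.setWord_word_ne _ _ _ (by decide), hx]
    have h27 : m₁.word 27 0 = v := by
      rw [hf.word 27 (by decide), hm₀, Memory.setWord_word_self, Function.update_self]
    have h2 : m₁.word 2 = m.word 2 := by
      rw [hf.word 2 (by decide), hm₀, Memory.setWord_word_ne _ _ _ (by decide)]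
    have h3 : m₁.word 3 = m.word 3 := by
      rw [hf.word 3 (by decide), hm₀, Memory.setWord_word_ne _ _ _ (by decide)]
    have h12 : m₁.word 12 = m.word 12 := by
      rw [hf.word 12 (by decide), hm₀, Memory.setWord_word_ne _ _ _ (by decide)]
    have hr3 : m₁.real 3 = m.real 3 := hf.real 3 (by decide)
    have hr5 : m₁.real 5 = m.real 5 := hf.real 5 (by decide)
    have hr6 : m₁.real 6 = m.real 6 := hf.real 6 (by decide)
    have hlen := hsuf.length_le
    have hrep' := hrep.suffix hsuf
    have hL'x : ∀ e ∈ L', e.1 ≠ x := fun e he => hxL e (hsuf.subset he)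
    have hhx : ∀ y, m.real 3 (m.word 3 y) = h y := fun y => by rw [hh]
    rw [← hp] at hw ⊢
    simp only [Test.Holds, WExp.eval, RExp.eval, h26, h27, h2, h3, h12, hr3, hr5, hr6, hc, hb, hhx]
    clear_value m₀
  · intro hcond
    simp only [run_wset, WExp.eval, WExp.cost, Test.cost, RExp.cost, h27, hc]
    refine ⟨by omega, by omega, 90 * (L'.length - 1), ?_, by omega⟩
    cases L' with
    | nil => simp at hcond
    | cons e L₂ =>
      obtain ⟨t, s⟩ := e
      obtain ⟨hr1, hr2, hr3'⟩ := hrep'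
      simp only at hr1 hr2
      simp only [List.length_cons, show base + (L₂.length + 1) - 1 = base + L₂.length by omega, hr1,
        hr2] at hcond
      refine ⟨L₂, ?_, (List.suffix_cons _ _).trans hsuf, ?_, fun u hu => ?_, by simp⟩
      · exact (push_pop hcond.2).symm
      · simp [Memory.setWord_word_self]
      · rw [Memory.setWord_word_self, Function.update_of_ne hu, hco u hu]
  · intro hcond ht
    simp only [Test.cost, RExp.cost, WExp.cost] at ht
    rw [run_ite]
    simp (disch := decide) only [run_seq, run_wset, run_rset, run_ite, run_skip, WExp.eval, WExp.cost, Test.cost,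
        RExp.eval, RExp.cost, Test.Holds, h26, h27, h2, h3, h12, hr3, hr5, hr6, hc, hb, hhx,
        Memory.setWord_word_self,
        Memory.setWord_word_ne, Memory.setWord_real, Memory.setReal_word, Memory.setReal_real_self,
        Function.update_self]
    cases L' with
    | nil =>
      refine ⟨fun _ => ?_, fun hc0 => by simp at hc0⟩
      have hp0 : push h (m.real 5) x [] = [(x, 0)] := rfl
      rw [hp0] at hw ⊢
      simp only [List.length_cons, List.length_nil] at hw ht ⊢
      refine ⟨by omega, by omega, by omega, by omega, by omega, by omega, trivial,
        fun u hu => ?_, ⟨by simp, by simp, trivial⟩, fun j hj => ?_, fun y hy => ?_⟩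
      · rw [Function.update_of_ne hu, hco u hu]
      · rw [Function.update_of_ne (by omega)]
      · rw [Function.update_of_ne hy]
    | cons e L₂ =>
      obtain ⟨t', s⟩ := e
      have hrep₀ := hrep'
      obtain ⟨hr1, hr2, hr3'⟩ := hrep'
      simp only at hr1 hr2
      simp only [List.length_cons, show base + (L₂.length + 1) - 1 = base + L₂.length by omega, hr1,
        hr2] at hcond ⊢
      refine ⟨fun hc0 => by omega, fun _ => ⟨fun hd => ?_, fun hd => ?_⟩⟩
      · have hpp : push h (m.real 5) x ((t', s) :: L₂) = (t', s) :: L₂ := by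
          rw [push, if_neg (fun hle => hcond ⟨by omega, hle⟩), if_pos hd]
        rw [hpp] at hw ⊢
        simp only [List.length_cons] at hw ht ⊢
        exact ⟨by omega, trivial, hco, hrep₀, fun _ _ => trivial, fun _ _ => trivial⟩
      · have hpp : push h (m.real 5) x ((t', s) :: L₂) =
            (x, (h x - h t') / (m.real 5 t' - m.real 5 x)) :: (t', s) :: L₂ := by
          rw [push, if_neg (fun hle => hcond ⟨by omega, hle⟩), if_neg hd]
        rw [hpp] at hw ⊢
        simp only [List.length_cons] at hw ht ⊢
        refine ⟨by omega, by omega, by omega, by omega, by omega, by omega, trivial,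
          fun u hu => ?_, ⟨by simp, by simp, ?_⟩, fun j hj => ?_, fun y hy => ?_⟩
        · rw [Function.update_of_ne hu, hco u hu]
        · refine hrep₀.congr (fun j hj1 hj2 => ?_) fun e he => ?_
          · rw [List.length_cons] at hj2
            rw [Function.update_of_ne (by omega)]
          · rw [Function.update_of_ne (hL'x e he)]
        · rw [Function.update_of_ne (by omega)]
        · rw [Function.update_of_ne hy]

end RealRAM

namespace LineEnvelope

variable {ι : Type*} {h d : ι → ℝ}

theorem Linked.pairwise {L : List (ι × ℝ)} (hL : Linked h d L) :
    L.Pairwise fun e e' => d e.1 < d e'.1 := by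
  induction L with
  | nil => exact List.Pairwise.nil
  | cons e L ih =>
    refine List.pairwise_cons.2 ⟨fun e' he' => ?_, ih hL.tail⟩
    cases L with
    | nil => simp at he'
    | cons y L => exact hL.2.1.trans_le (hL.tail.head_le e' he').2

/-- The slopes on a stack are strictly monotone, so its slots are distinct. A stack thus fits into
the segment of memory that belongs to the slots of its node. -/
theorem Linked.length_le {h d : ℕ → ℝ} {L : List (ℕ × ℝ)} (hL : Linked h d L) {a b : ℕ}
    (hab : ∀ e ∈ L, a ≤ e.1 ∧ e.1 < b) : L.length ≤ b - a := by
  have hnd : (L.map Prod.fst).Nodup := by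
    rw [List.Nodup, List.pairwise_map]
    exact hL.pairwise.imp fun {e e'} hlt he => by rw [he] at hlt; exact lt_irrefl _ hlt
  rw [← List.length_map (f := Prod.fst), ← List.toFinset_card_of_nodup hnd, ← Nat.card_Ico]
  refine Finset.card_le_card fun x hx => ?_
  obtain ⟨e, he, rfl⟩ := List.mem_map.1 (List.mem_toFinset.1 hx)
  exact Finset.mem_Ico.2 (hab e he)

end LineEnvelope

/-! ### Sorting the slots and building the envelopes. -/

namespace RealRAM

open LineEnvelope

variable {w : ℕ} {m : Memory} {Q : Memory → ℕ → Prop}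

/-- The permutation `order` lists the slots by decreasing length. -/
structure SortedSlots (S : ℕ) (order : ℕ → ℕ) (len : ℕ → ℝ) : Prop where
  lt : ∀ i < S, order i < S
  surj : ∀ x < S, ∃ i < S, order i = x
  anti : ∀ i j, i ≤ j → j < S → len (order j) ≤ len (order i)

/-- The stacks in memory hold the lists `hs`. -/
def StacksRepr (N : ℕ) (m : Memory) (hs : ℕ → List (ℕ × ℝ)) : Prop :=
  ∀ v < N, m.word 13 v = (hs v).length ∧ StackRepr (m.word 12) (m.real 6) (m.word 2 v) (hs v)

/-- Sort the slots by decreasing length (word array 11) and compute the envelope stacks. -/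
def sortSlots : Prog :=
  .seq (forLoop 23 (.lit 0) (var 0) (.wset 13 (var 23) (.lit 0)))
  (.seq treeBuild
  (.seq (.wset 24 (.lit 0) (.lit 0))
  (.loop (.conj (.wle (.lit 1) (var 21)) (.neg (.rle (.load 20 (.load 20 (.lit 1))) .zero)))
    (.seq (.wset 26 (.lit 0) (.load 20 (.lit 1)))
    (.seq (.wset 11 (var 24) (var 26))
    (.seq (.wset 24 (.lit 0) (.add (var 24) (.lit 1)))
    (.seq (.rset 20 (var 26) .zero)
    (.seq (treeUpdate (var 26)) pushLine))))))))

theorem SlotArrays.len_pos {N : ℕ} {T : ImpreciseTerrain (Fin N)} {S : ℕ} {off adj src : ℕ → ℕ}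
    {len : ℕ → ℝ} (h : SlotArrays T S off adj src len) {x : ℕ} (hx : x < S) : 0 < len x := by
  obtain ⟨v, u, -, -, -, -, hvu, he⟩ := h x hx
  exact he ▸ T.dist_pos_of_adj hvu

theorem sum_length_update {N v : ℕ} (hv : v < N) (hs : ℕ → List (ℕ × ℝ)) (L : List (ℕ × ℝ)) :
    ∑ u ∈ Finset.range N, (Function.update hs v L u).length + (hs v).length =
      ∑ u ∈ Finset.range N, (hs u).length + L.length := by
  have h1 := Finset.add_sum_erase (Finset.range N) (fun u => (Function.update hs v L u).length)
    (Finset.mem_range.2 hv)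
  have h2 := Finset.add_sum_erase (Finset.range N) (fun u => (hs u).length)
    (Finset.mem_range.2 hv)
  have h3 : ∑ u ∈ (Finset.range N).erase v, (Function.update hs v L u).length =
      ∑ u ∈ (Finset.range N).erase v, (hs u).length :=
    Finset.sum_congr rfl fun u hu => by rw [Function.update_of_ne (Finset.ne_of_mem_erase hu)]
  simp only [Function.update_self] at h1
  omega

/-- Invariant of the sorting loop. -/
structure SortInv {N : ℕ} (m₀ : Memory) (S : ℕ) (h : ℕ → ℝ) (m : Memory) (ord : List ℕ)
    (hs : ℕ → List (ℕ × ℝ)) : Prop where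
  nodup : ord.Nodup
  lt : ∀ x ∈ ord, x < S
  count : m.word 24 0 = ord.length
  order : ∀ i (hi : i < ord.length), m.word 11 i = ord[i]
  key_mem : ∀ x ∈ ord, m.real 20 x = 0
  key_not_mem : ∀ x < S, x ∉ ord → m.real 20 x = m₀.real 5 x
  tree : TreeOK S (m.word 20) (m.real 20)
  sorted : ord.Pairwise fun x y => m₀.real 5 y ≤ m₀.real 5 x
  rest : ∀ x ∈ ord, ∀ y < S, y ∉ ord → m₀.real 5 y ≤ m₀.real 5 x
  repr : ∀ v < N, m.word 13 v = (hs v).length ∧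
    StackRepr (m.word 12) (m.real 6) (m₀.word 2 v) (hs v)
  envelope : ∀ v < N, IsEnvelope h (m₀.real 5) {x | x ∈ ord ∧ m₀.word 10 x = v} (hs v)

/-- One round of tournament sort: the winner is appended to the order and its key is erased to zero.
As slots arrive by decreasing length, the new line is no steeper than those on its stack, as
`IsEnvelope.push` demands. -/
theorem run_sortStep {N : ℕ} {T : ImpreciseTerrain (Fin N)} {S L : ℕ} {m₀ : Memory} {h : ℕ → ℝ}
    (hh : h = fun y => m.real 3 (m.word 3 y))
    (hsl : Slots T S (m₀.word 2) (m₀.word 3))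
    (hsa : SlotArrays T S (m₀.word 2) (m₀.word 3) (m₀.word 10) (m₀.real 5))
    (hw : N + S ≤ w) (hL : S < 2 ^ L) (hM : m.word 21 0 = S)
    (e2 : m.word 2 = m₀.word 2) (e10 : m.word 10 = m₀.word 10)
    (e5 : m.real 5 = m₀.real 5) {ord : List ℕ} {hs : ℕ → List (ℕ × ℝ)}
    (hI : SortInv (N := N) m₀ S h m ord hs) (hS : 1 ≤ S) (hroot : ¬ m.real 20 (m.word 20 1) ≤ 0) :
    Run w (.seq (.wset 26 (.lit 0) (.load 20 (.lit 1)))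
      (.seq (.wset 11 (var 24) (var 26))
      (.seq (.wset 24 (.lit 0) (.add (var 24) (.lit 1)))
      (.seq (.rset 20 (var 26) .zero)
      (.seq (treeUpdate (var 26)) pushLine))))) m fun m' t => ∃ ord' hs',
        SortInv (N := N) m₀ S h m' ord' hs' ∧ ord'.length = ord.length + 1 ∧ ord'.length ≤ S ∧
        t + 90 * ∑ v ∈ Finset.range N, (hs' v).length ≤
          90 * ∑ v ∈ Finset.range N, (hs v).length + (50 * L + 400) := by
  set x := m.word 20 1 with hx
  have hxS : x < S := hI.tree.root_lt hS
  have hxo : x ∉ ord := fun hmem => hroot (hI.key_mem x hmem).le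
  have hnd : (ord ++ [x]).Nodup := by
    rw [List.nodup_append]
    refine ⟨hI.nodup, by simp, fun a ha b hb => ?_⟩
    rw [List.mem_singleton.1 hb]
    exact fun e => hxo (e ▸ ha)
  have hlen : ord.length + 1 ≤ S := by
    have h1 : (ord ++ [x]).toFinset.card = ord.length + 1 := by
      rw [List.toFinset_card_of_nodup hnd]; simp
    rw [← h1, ← Finset.card_range S]
    refine Finset.card_le_card fun y hy => ?_
    simp only [List.mem_toFinset, List.mem_append, List.mem_singleton] at hy
    rcases hy with hy | rfl
    · exact Finset.mem_range.2 (hI.lt y hy)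
    · exact Finset.mem_range.2 hxS
  have hdom : ∀ y < S, y ∉ ord → m₀.real 5 y ≤ m₀.real 5 x := fun y hy hyo => by
    rw [← hI.key_not_mem y hy hyo, ← hI.key_not_mem x hxS hxo]
    exact hI.tree.le_root hy
  obtain ⟨v, u, hv, -, hvx, hxv, -, -⟩ := hsa x hxS
  have henv := hI.envelope v v.2
  have henv' := henv.push (x := x) fun p hp => hI.rest p hp.1 x hxS hxo
  have hset : insert x {x | x ∈ ord ∧ m₀.word 10 x = v} =
      {y | y ∈ ord ++ [x] ∧ m₀.word 10 y = v} := by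
    ext y
    simp only [Set.mem_insert_iff, Set.mem_ofPred_eq, List.mem_append, List.mem_singleton]
    constructor
    · rintro (rfl | ⟨h1, h2⟩)
      · exact ⟨Or.inr rfl, hv⟩
      · exact ⟨Or.inl h1, h2⟩
    · rintro ⟨h1 | h1, h2⟩
      · exact Or.inr ⟨h1, h2⟩
      · exact Or.inl h1
  rw [hset] at henv'
  set L' := push h (m₀.real 5) x (hs v) with hL'
  have hslot : ∀ (v : Fin N) (ord : List ℕ), (∀ y ∈ ord, y < S) → ∀ y,
      y ∈ ord → m₀.word 10 y = v → m₀.word 2 v ≤ y ∧ y < m₀.word 2 (v + 1) := by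
    intro v ord hlt y hy he
    obtain ⟨v', u', h1, -, h2, h3, -⟩ := hsa y (hlt y hy)
    obtain rfl : v = v' := Fin.ext (he.symm.trans h1)
    exact ⟨h2, h3⟩
  have hlt' : ∀ y ∈ ord ++ [x], y < S := fun y hy => by
    rcases List.mem_append.1 hy with hy | hy
    · exact hI.lt y hy
    · rw [List.mem_singleton.1 hy]; exact hxS
  -- Each stack stays inside the segment of its node, so stacks of different nodes never overlap.
  have hbound : ∀ (v : Fin N) (ord : List ℕ) (L : List (ℕ × ℝ)), (∀ y ∈ ord, y < S) →
      IsEnvelope h (m₀.real 5) {x | x ∈ ord ∧ m₀.word 10 x = v} L →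
      m₀.word 2 v + L.length ≤ m₀.word 2 (v + 1) := by
    intro v ord L hlt he
    have h1 := he.linked.length_le (a := m₀.word 2 v) (b := m₀.word 2 (v + 1)) fun e hel =>
      hslot v ord hlt e.1 (he.mem e hel).1 (he.mem e hel).2
    have h2 := hsl.mono v
    omega
  have hbv := hbound v _ _ hI.lt henv
  have hbv' := hbound v _ _ hlt' henv'
  have hoS : m₀.word 2 (v + 1) ≤ S := by
    have := hsl.mono_le (show (v : ℕ) + 1 ≤ N from v.2) le_rfl
    rwa [hsl.last] at this
  have hc := hI.count
  simp (disch := decide) only [run_seq (c := .wset _ _ _), run_seq (c := .rset _ _ _), run_wset,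
    run_rset, WExp.eval, WExp.cost, RExp.eval, RExp.cost, Memory.setWord_word_self,
    Memory.setWord_word_ne, ← hx, hc, Function.update_self]
  refine ⟨by omega, by omega, by omega, by omega, by omega, by omega, by omega, ?_⟩
  set m₁ := ((((m.setWord 26 0 x).setWord 11 ord.length x).setWord 24 0 (ord.length + 1)).setReal
    20 x 0) with hm₁
  have h26₁ : m₁.word 26 0 = x := by
    simp (disch := decide) [hm₁, Memory.setWord_word_self, Memory.setWord_word_ne,
      Memory.setReal_word]
  have h11₁ : m₁.word 11 = Function.update (m.word 11) ord.length x := by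
    simp (disch := decide) [hm₁, Memory.setWord_word_self, Memory.setWord_word_ne,
      Memory.setReal_word]
  have h24₁ : m₁.word 24 0 = ord.length + 1 := by
    simp (disch := decide) [hm₁, Memory.setWord_word_self, Memory.setReal_word]
  have hw₁ : ∀ a, a ≠ 26 → a ≠ 11 → a ≠ 24 → m₁.word a = m.word a := fun a h1 h2 h3 => by
    simp [hm₁, Memory.setReal_word, Memory.setWord_word_ne, h1, h2, h3]
  have hr₁ : ∀ a, a ≠ 20 → m₁.real a = m.real a := fun a h1 => by
    simp [hm₁, Memory.setReal_real_ne, h1, Memory.setWord_real]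
  have h20₁ : m₁.real 20 = Function.update (m.real 20) x 0 := by
    simp [hm₁, Memory.setReal_real_self, Memory.setWord_real]
  clear_value m₁
  refine Run.seq ((run_treeUpdate (M := S) (L := L) (ky := m.real 20)
    (by rw [hw₁ _ (by decide) (by decide) (by decide), hM])
    (by simp only [WExp.eval, h26₁]; exact hxS) (by omega) hL (fun y hy => by
      simp only [WExp.eval, h26₁] at hy
      rw [h20₁, Function.update_of_ne hy])
    (by rw [hw₁ _ (by decide) (by decide) (by decide)]; exact hI.tree)).mono ?_)
  rintro m₂ t₂ hf₂ ⟨ht₂, htree⟩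
  have hw₂ : ∀ a, a ≠ 26 → a ≠ 11 → a ≠ 24 → a ≠ 20 → a ≠ 22 → m₂.word a = m.word a :=
    fun a h1 h2 h3 h4 h5 => by
      rw [hf₂.word a (by simp [treeUpdate, climb, fixNode, Prog.words, h4, h5]), hw₁ a h1 h2 h3]
  have hr₂ : ∀ a, a ≠ 20 → m₂.real a = m.real a := fun a h1 => by
    rw [hf₂.real a (by simp [treeUpdate, climb, fixNode, Prog.reals]), hr₁ a h1]
  have h3₂ : m₂.word 3 = m.word 3 := hw₂ 3 (by decide) (by decide) (by decide) (by decide) (by decide)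
  have h12₂ : m₂.word 12 = m.word 12 :=
    hw₂ 12 (by decide) (by decide) (by decide) (by decide) (by decide)
  have h13₂ : m₂.word 13 = m.word 13 :=
    hw₂ 13 (by decide) (by decide) (by decide) (by decide) (by decide)
  have h5₂ : m₂.real 5 = m₀.real 5 := by rw [hr₂ 5 (by decide), e5]
  have hpush := run_pushLine (w := w) (m := m₂) (x := x) (v := v) (base := m₀.word 2 v)
    (L := hs v) (h := h) (by rw [hh, h3₂, hr₂ 3 (by decide)])
    (by rw [hf₂.word 26 (by decide), h26₁])
    (by rw [hw₂ 10 (by decide) (by decide) (by decide) (by decide) (by decide), e10, hv])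
    (by rw [hw₂ 2 (by decide) (by decide) (by decide) (by decide) (by decide), e2])
    (by rw [h13₂]; exact (hI.repr v v.2).1)
    (by rw [h12₂, hr₂ 6 (by decide)]; exact (hI.repr v v.2).2)
    (fun e he hex => hxo (hex ▸ (henv.mem e he).1)) (by omega) (by omega) (by omega)
    (by rw [h5₂, ← hL']; omega)
  rw [h5₂, ← hL'] at hpush
  refine hpush.mono ?_
  rintro m₃ t₃ hf₃ ⟨ht₃, hcv, hcu, hrep, hst, hsm⟩
  refine ⟨ord ++ [x], Function.update hs v L', ⟨hnd, hlt', ?_, ?_, ?_, ?_, ?_, ?_, ?_, ?_, ?_⟩,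
    by simp, by simpa using hlen, ?_⟩
  · rw [hf₃.word 24 (by decide), hf₂.word 24 (by decide), h24₁]; simp
  · intro i hi
    rw [hf₃.word 11 (by decide), hf₂.word 11 (by decide), h11₁]
    rw [List.length_append, List.length_singleton] at hi
    by_cases hio : i = ord.length
    · subst hio; simp
    · rw [Function.update_of_ne hio, List.getElem_append_left (by omega)]
      exact hI.order i (by omega)
  · intro y hy
    rw [hf₃.real 20 (by decide), hf₂.real 20 (by decide), h20₁]
    by_cases hyx : y = x
    · subst hyx; simp
    · rw [Function.update_of_ne hyx]
      rcases List.mem_append.1 hy with hy | hy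
      · exact hI.key_mem y hy
      · exact absurd (List.mem_singleton.1 hy) hyx
  · intro y hy hyo
    rw [hf₃.real 20 (by decide), hf₂.real 20 (by decide), h20₁]
    simp only [List.mem_append, List.mem_singleton, not_or] at hyo
    rw [Function.update_of_ne hyo.2]
    exact hI.key_not_mem y hy hyo.1
  · rw [hf₃.word 20 (by decide), hf₃.real 20 (by decide), hf₂.real 20 (by decide)]
    exact htree
  · rw [List.pairwise_append]
    refine ⟨hI.sorted, by simp, fun a ha b hb => ?_⟩
    rw [List.mem_singleton.1 hb]
    exact hI.rest a ha x hxS hxo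
  · intro a ha y hy hyo
    simp only [List.mem_append, List.mem_singleton, not_or] at hyo
    rcases List.mem_append.1 ha with ha | ha
    · exact hI.rest a ha y hy hyo.1
    · rw [List.mem_singleton.1 ha]
      exact hdom y hy hyo.1
  · intro u hu
    by_cases huv : u = v
    · subst huv
      rw [Function.update_self]
      exact ⟨hcv, hrep⟩
    · rw [Function.update_of_ne huv, hcu u huv, h13₂]
      refine ⟨(hI.repr u hu).1, (hI.repr u hu).2.congr (fun j hj1 hj2 => ?_) fun e he => ?_⟩
      · have hbu := hbound ⟨u, hu⟩ _ _ hI.lt (hI.envelope u hu)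
        simp only at hbu
        rw [hst j, h12₂]
        rcases Nat.lt_or_gt_of_ne huv with hlt | hlt
        · have := hsl.mono_le (show u + 1 ≤ v from hlt) v.2.le
          omega
        · have := hsl.mono_le (show (v : ℕ) + 1 ≤ u from hlt) hu.le
          omega
      · rw [hsm, hr₂ 6 (by decide)]
        exact fun hex => hxo (hex ▸ ((hI.envelope u hu).mem e he).1)
  · intro u hu
    by_cases huv : u = v
    · subst huv
      rw [Function.update_self]
      exact henv'
    · rw [Function.update_of_ne huv]
      have hse : {y | y ∈ ord ++ [x] ∧ m₀.word 10 y = u} = {y | y ∈ ord ∧ m₀.word 10 y = u} := by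
        ext y
        simp only [Set.mem_ofPred_eq, List.mem_append, List.mem_singleton]
        refine ⟨fun ⟨h1, h2⟩ => ⟨h1.resolve_right fun e => huv ?_, h2⟩, fun ⟨h1, h2⟩ => ⟨Or.inl h1, h2⟩⟩
        rw [← h2, e, hv]
      rw [hse]
      exact hI.envelope u hu
  · have hsum := sum_length_update v.2 hs L'
    simp only [WExp.cost] at ht₂
    omega

/-- Each of the `S` rounds costs a logarithmic tree update plus amortized constant time for the
push. -/
theorem run_sortSlots {N : ℕ} {T : ImpreciseTerrain (Fin N)} {S L : ℕ} {h : ℕ → ℝ}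
    (hh : h = fun y => m.real 3 (m.word 3 y)) (hN : m.word 0 0 = N)
    (hsl : Slots T S (m.word 2) (m.word 3))
    (hsa : SlotArrays T S (m.word 2) (m.word 3) (m.word 10) (m.real 5))
    (hkey : ∀ x < S, m.real 20 x = m.real 5 x)
    (hw : N + 2 * S ≤ w) (hL : S < 2 ^ L) (hM : m.word 21 0 = S) :
    Run w sortSlots m fun m' t => t ≤ 1000 * (N + S + 1) + 50 * L * S ∧
      m'.word 24 0 = S ∧ SortedSlots S (m'.word 11) (m.real 5) ∧
      ∃ hs, StacksRepr N m' hs ∧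
        ∀ v < N, IsEnvelope h (m.real 5) {x | x < S ∧ m.word 10 x = v} (hs v) := by
  refine Run.seq ((run_forLoop (l := 0) (n := N) (c := 10) (I := fun i m' => ∀ v < i, m'.word 13 v = 0)
    (by decide) rfl (by omega) (by omega) ?_ (by simp) ?_).mono ?_)
  · intro m' hf
    simp only [WExp.eval]
    rw [hf.word 0 (by decide), hN]
  · intro i m' _ hi hf hvi hI
    simp only [run_wset, WExp.eval, WExp.cost, hvi]
    refine ⟨by omega, by omega, fun v hv => ?_, by omega⟩
    rw [Memory.setWord_word_ne _ _ _ (by decide), Memory.setWord_word_self]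
    by_cases hvi : v = i
    · subst hvi; simp
    · rw [Function.update_of_ne hvi]
      exact hI v (by omega)
  rintro m₁ t₁ hf₁ ⟨hcnt, ht₁⟩
  simp only [WExp.cost] at ht₁
  have hM₁ : m₁.word 21 0 = S := by rw [hf₁.word 21 (by decide), hM]
  refine Run.seq ((run_treeBuild hM₁ (by omega)).mono ?_)
  rintro m₂ t₂ hf₂ ⟨ht₂, htree⟩
  simp only [run_seq (c := .wset _ _ _), run_wset, WExp.eval, WExp.cost]
  refine ⟨by omega, by omega, ?_⟩
  set m₃ := m₂.setWord 24 0 0 with hm₃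
  have hw₃ : ∀ a, a ∉ [13, 20, 22, 23, 24] → m₃.word a = m.word a := fun a ha => by
    simp only [List.mem_cons, not_or] at ha
    rw [hm₃, Memory.setWord_word_ne _ _ _ ha.2.2.2.2.1,
      hf₂.word a (by simp [treeBuild, fixNode, Prog.words, ha.2.1, ha.2.2.1]),
      hf₁.word a (by simp [forLoop, Prog.words, ha.1, ha.2.2.2.1])]
  have hr₃ : m₃.real = m.real := by
    funext a
    rw [hm₃, Memory.setWord_real, hf₂.real a (by simp [treeBuild, fixNode, Prog.reals]),
      hf₁.real a (by simp [forLoop, Prog.reals])]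
  have hI₃ : SortInv (N := N) m S h m₃ [] fun _ => [] := by
    refine ⟨List.nodup_nil, by simp, ?_, by simp, by simp, ?_, ?_, List.Pairwise.nil, by simp, ?_, ?_⟩
    · rw [hm₃]; simp [Memory.setWord_word_self]
    · intro x hx _
      rw [hr₃, hkey x hx]
    · rw [hm₃, Memory.setWord_word_ne _ _ _ (by decide), Memory.setWord_real,
        hf₂.real 20 (by decide)]
      exact htree
    · intro v hv
      refine ⟨?_, trivial⟩
      rw [hm₃, Memory.setWord_word_ne _ _ _ (by decide), hf₂.word 13 (by decide), hcnt v hv]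
      rfl
    · intro v hv
      simpa using isEnvelope_empty h (m.real 5)
  clear_value m₃
  -- The budget combines the rounds that remain with the potential of all stacks.
  refine Run.loop (I := fun k m' => ∃ ord hs, SortInv (N := N) m S h m' ord hs ∧ ord.length ≤ S ∧
    k = (50 * L + 500) * (S - ord.length) + 90 * ∑ v ∈ Finset.range N, (hs v).length)
    (k := (50 * L + 500) * S) ?_ ?_ ?_
  · exact ⟨[], fun _ => [], hI₃, by simp, by simp⟩
  · rintro k m₄ hf₄ ⟨ord, hs, hI, hle, rfl⟩ hb
    have hM₄ : m₄.word 21 0 = S := by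
      rw [hf₄.word 21 (by decide), hw₃ 21 (by decide), hM]
    simp only [Test.Holds, WExp.eval, RExp.eval, hM₄] at hb
    refine (run_sortStep (L := L) (T := T) (N := N) (m₀ := m) (S := S) (h := h) ?_ hsl hsa
      (by omega) hL hM₄ ?_ ?_ ?_ hI hb.1 hb.2).mono ?_
    · rw [hh, hf₄.word 3 (by decide), hf₄.real 3 (by decide), hr₃, hw₃ 3 (by decide)]
    · rw [hf₄.word 2 (by decide), hw₃ 2 (by decide)]
    · rw [hf₄.word 10 (by decide), hw₃ 10 (by decide)]
    · rw [hf₄.real 5 (by decide), hr₃]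
    rintro m₅ t₅ hf₅ ⟨ord', hs', hI', hl1, hl2, ht₅⟩
    refine ⟨_, ⟨ord', hs', hI', hl2, rfl⟩, ?_⟩
    obtain ⟨r, hr⟩ : ∃ r, S = ord.length + 1 + r := Nat.exists_eq_add_of_le (by omega)
    rw [show S - ord'.length = r by omega, show S - ord.length = r + 1 by omega, Nat.mul_succ]
    simp only [Test.cost, WExp.cost, RExp.cost]
    omega
  · rintro k m₄ t₄ hf₄ ⟨ord, hs, hI, hle, rfl⟩ hb ht₄
    have hM₄ : m₄.word 21 0 = S := by
      rw [hf₄.word 21 (by decide), hw₃ 21 (by decide), hM]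
    simp only [Test.Holds, WExp.eval, RExp.eval, hM₄, not_and, not_not] at hb
    simp only [Test.cost, WExp.cost, RExp.cost] at ht₄
    -- Lengths are positive and erased keys are zero, so a nonpositive root means that every slot
    -- has been taken.
    have hall : ∀ x, x < S → x ∈ ord := fun x hx => by
      by_contra hxo
      have h1 := hI.key_not_mem x hx hxo
      have h2 := hI.tree.le_root hx
      have h3 := hsa.len_pos hx
      have h4 := hb (by omega)
      linarith
    have hmem : ∀ x, x ∈ ord ↔ x < S := fun x => ⟨hI.lt x, hall x⟩
    have hlen : ord.length = S := by
      rw [← List.toFinset_card_of_nodup hI.nodup, ← Finset.card_range S]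
      congr 1
      ext x
      simp [hmem]
    refine ⟨?_, by rw [hI.count, hlen], ⟨fun i hi => ?_, fun x hx => ?_, fun i j hij hj => ?_⟩, hs,
      fun v hv => ?_, fun v hv => ?_⟩
    · have e1 : (50 * L + 500) * S = 50 * L * S + 500 * S := by ring
      omega
    · rw [hI.order i (by omega)]
      exact hI.lt _ (List.getElem_mem _)
    · obtain ⟨i, hi, he⟩ := List.getElem_of_mem (hall x hx)
      exact ⟨i, by omega, by rw [hI.order i hi, he]⟩
    · rcases hij.lt_or_eq with hlt | rfl
      · rw [hI.order i (by omega), hI.order j (by omega)]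
        exact List.pairwise_iff_getElem.1 hI.sorted i j (by omega) (by omega) hlt
      · exact le_rfl
    · rw [hf₄.word 2 (by decide), hw₃ 2 (by decide)]
      exact hI.repr v hv
    · have := hI.envelope v hv
      simpa only [hmem] using this

end RealRAM

/-! ### Optimal vertices for all slots by a second sweep. -/

namespace RealRAM

open LineEnvelope

variable {w : ℕ} {m : Memory} {Q : Memory → ℕ → Prop}

/-- Remove entries from the stack of the node in word variable 27 until the next entry is longer
than the slot in word variable 26, and store the left end point of the top entry. -/
def findVertex : Prog :=
  .seq (.loop (.conj (.wle (.lit 2) (.load 13 (var 27)))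
      (.rle (.load 5 (fromTop 2)) (.load 5 (var 26))))
    (.wset 13 (var 27) (.sub (.load 13 (var 27)) (.lit 1))))
  (.seq (.rset 7 (var 26) (.load 6 (fromTop 1)))
  (.rset 8 (var 26) (lineAt (fromTop 1) (.load 6 (fromTop 1)))))

/-- From top to bottom the slopes on a stack increase. The search stops where the top has slope at
most `δ` and the next entry, if any, has slope above `δ`; this is the situation of
`IsEnvelope.isVertex`. Again pops are paid for by the stack length. -/
theorem run_findVertex {x v base : ℕ} {P : Set ℕ} {H L L₀ : List (ℕ × ℝ)} {e₀ : ℕ × ℝ} {h : ℕ → ℝ}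
    (hh : h = fun y => m.real 3 (m.word 3 y))
    (hx : m.word 26 0 = x) (hv : m.word 27 0 = v) (hb : m.word 2 v = base)
    (hcnt : m.word 13 v = L.length) (hrep : StackRepr (m.word 12) (m.real 6) base L)
    (hLH : L <:+ H) (hL₀ : L = e₀ :: L₀) (he₀ : m.real 5 e₀.1 ≤ m.real 5 x)
    (henv : IsEnvelope h (m.real 5) P H) (hxw : x ≤ w) (hvw : v ≤ w) (hLw : L.length ≤ w) :
    Run w findVertex m fun m' t => ∃ e' L', e' :: L' <:+ L ∧ m.real 5 e'.1 ≤ m.real 5 x ∧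
      m'.word 13 v = L'.length + 1 ∧ (∀ u, u ≠ v → m'.word 13 u = m.word 13 u) ∧
      IsVertex P h (m.real 5) (m.real 5 x) (m'.real 7 x) (m'.real 8 x) ∧
      (∀ y, y ≠ x → m'.real 7 y = m.real 7 y ∧ m'.real 8 y = m.real 8 y) ∧
      t + 60 * (L'.length + 1) ≤ 60 * L.length + 100 := by
  refine Run.seq (Run.loop (I := fun k m' => ∃ e' L', e' :: L' <:+ L ∧
    m.real 5 e'.1 ≤ m.real 5 x ∧ m'.word 13 v = L'.length + 1 ∧
    (∀ u, u ≠ v → m'.word 13 u = m.word 13 u) ∧ k = 60 * (L'.length + 1)) (k := 60 * L.length)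
    ?_ ?_ ?_)
  · exact ⟨e₀, L₀, hL₀ ▸ List.suffix_rfl, he₀, by rw [hcnt, hL₀]; rfl, fun _ _ => rfl,
      by rw [hL₀]; rfl⟩
  all_goals
    first
      | rintro k m₁ t hf ⟨⟨s, p⟩, L', hsuf, hd, hc, hco, rfl⟩
      | rintro k m₁ hf ⟨⟨s, p⟩, L', hsuf, hd, hc, hco, rfl⟩
    have h26 : m₁.word 26 0 = x := by rw [hf.word 26 (by decide), hx]
    have h27 : m₁.word 27 0 = v := by rw [hf.word 27 (by decide), hv]
    have h2 : m₁.word 2 = m.word 2 := hf.word 2 (by decide)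
    have h3 : m₁.word 3 = m.word 3 := hf.word 3 (by decide)
    have h12 : m₁.word 12 = m.word 12 := hf.word 12 (by decide)
    have hr : m₁.real = m.real := funext fun a => hf.real a (by simp [Prog.reals])
    have hlen := hsuf.length_le
    obtain ⟨hr1, hr2, hr3⟩ := hrep.suffix hsuf
    simp only [List.length_cons] at hr1 hr2 hlen
    have hhx : ∀ y, m.real 3 (m.word 3 y) = h y := fun y => by rw [hh]
    simp only [Test.Holds, WExp.eval, RExp.eval, h26, h27, h2, h12, hr, hc, hb]
  · rintro ⟨hc1, hc2⟩
    simp only [run_wset, WExp.eval, WExp.cost, Test.cost, RExp.cost, h27, hc]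
    refine ⟨by omega, by omega, 60 * L'.length, ?_, by omega⟩
    cases L' with
    | nil => simp at hc1
    | cons e L₂ =>
      simp only [List.length_cons, show base + (L₂.length + 1 + 1) - 2 = base + L₂.length by omega,
        hr3.1] at hc2
      refine ⟨e, L₂, (List.suffix_cons _ _).trans hsuf, hc2, ?_, fun u hu => ?_, rfl⟩
      · simp [Memory.setWord_word_self]
      · rw [Memory.setWord_word_self, Function.update_of_ne hu, hco u hu]
  · intro hcond ht
    simp only [Test.cost, RExp.cost, WExp.cost] at ht
    simp (disch := decide) only [run_seq, run_rset, WExp.eval, WExp.cost,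
        RExp.eval, RExp.cost, h26, h27, h2, h3, h12, hr, hc, hb, hhx,
        Memory.setReal_word, Memory.setReal_real_self,
        Memory.setReal_real_ne, Function.update_self,
        show base + (L'.length + 1) - 1 = base + L'.length by omega, hr1, hr2]
    refine ⟨by omega, by omega, (s, p), L', hsuf, hd, rfl, hco, ?_, fun y hy => ?_, by omega⟩
    · refine henv.isVertex (hsuf.trans hLH) hd fun e L₂ he => ?_
      subst he
      simp only [List.length_cons, show base + (L₂.length + 1 + 1) - 2 = base + L₂.length by omega,
        hr3.1] at hcond
      by_contra hlt
      exact hcond ⟨by omega, (not_le.1 hlt).le⟩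
    · exact ⟨Function.update_of_ne hy _ _, Function.update_of_ne hy _ _⟩

/-- Compute an optimal vertex of the envelope for every slot (real arrays 7 and 8). -/
def findVertices : Prog :=
  .loop (.wle (.lit 1) (var 24))
    (.seq (.wset 24 (.lit 0) (.sub (var 24) (.lit 1)))
    (.seq (.wset 26 (.lit 0) (.load 11 (var 24)))
    (.seq (.wset 27 (.lit 0) (.load 10 (var 26)))
    findVertex)))

/-- Slots are processed by increasing length, so an entry popped for one slot is not needed for any
later one. Pops are never undone, and the total time is linear. -/
theorem run_findVertices {N : ℕ} {T : ImpreciseTerrain (Fin N)} {S : ℕ} {h : ℕ → ℝ}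
    (hh : h = fun y => m.real 3 (m.word 3 y))
    (hsl : Slots T S (m.word 2) (m.word 3))
    (hsa : SlotArrays T S (m.word 2) (m.word 3) (m.word 10) (m.real 5))
    (hso : SortedSlots S (m.word 11) (m.real 5)) (hc : m.word 24 0 = S)
    {hs : ℕ → List (ℕ × ℝ)} (hrep : StacksRepr N m hs)
    (henv : ∀ v < N, IsEnvelope h (m.real 5) {x | x < S ∧ m.word 10 x = v} (hs v))
    (hw : N + S ≤ w) :
    Run w findVertices m fun m' t => t ≤ 300 * (N + S + 1) ∧
      ∀ x < S, IsVertex {y | y < S ∧ m.word 10 y = m.word 10 x} h (m.real 5) (m.real 5 x)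
        (m'.real 7 x) (m'.real 8 x) := by
  have hbound : ∀ v < N, (hs v).length ≤ m.word 2 (v + 1) - m.word 2 v := fun v hv => by
    refine (henv v hv).linked.length_le fun e he => ?_
    obtain ⟨h1, h2⟩ := (henv v hv).mem e he
    obtain ⟨v', u', h3, -, h4, h5, -⟩ := hsa _ h1
    rw [← h2, h3]
    exact ⟨h4, h5⟩
  have hsum : ∑ v ∈ Finset.range N, (hs v).length ≤ S := by
    calc ∑ v ∈ Finset.range N, (hs v).length
        ≤ ∑ v ∈ Finset.range N, (m.word 2 (v + 1) - m.word 2 v) :=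
          Finset.sum_le_sum fun v hv => hbound v (Finset.mem_range.1 hv)
      _ = S := hsl.sum_eq
  -- The remaining stacks `Ls` are suffixes of the envelopes. Their top entries are no longer than
  -- any unprocessed slot of the same node, so they never become empty.
  refine Run.loop (I := fun k m' => ∃ (c : ℕ) (Ls : ℕ → List (ℕ × ℝ)), m'.word 24 0 = c ∧ c ≤ S ∧
    (∀ v < N, Ls v <:+ hs v ∧ m'.word 13 v = (Ls v).length) ∧
    (∀ i < c, ∃ e L', Ls (m.word 10 (m.word 11 i)) = e :: L' ∧
      m.real 5 e.1 ≤ m.real 5 (m.word 11 i)) ∧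
    (∀ i, c ≤ i → i < S → IsVertex {y | y < S ∧ m.word 10 y = m.word 10 (m.word 11 i)} h (m.real 5)
      (m.real 5 (m.word 11 i)) (m'.real 7 (m.word 11 i)) (m'.real 8 (m.word 11 i))) ∧
    k = 150 * c + 60 * ∑ v ∈ Finset.range N, (Ls v).length)
    (k := 150 * S + 60 * ∑ v ∈ Finset.range N, (hs v).length) ?_ ?_ ?_
  · refine ⟨S, hs, hc, le_rfl, fun v hv => ⟨List.suffix_rfl, (hrep v hv).1⟩, fun i hi => ?_,
      fun i h1 h2 => by omega, rfl⟩
    have hx := hso.lt i hi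
    obtain ⟨v, u, hv, -⟩ := hsa _ hx
    have hE := henv v v.2
    rw [hv]
    have hmem : m.word 11 i ∈ {x | x < S ∧ m.word 10 x = v} := ⟨hx, hv⟩
    cases hL : hs v with
    | nil =>
      obtain ⟨e, he, -⟩ := hE.cover _ hmem 0 le_rfl
      rw [hL] at he
      simp at he
    | cons e L => exact ⟨e, L, rfl, hE.head_le e L hL _ hmem⟩
  · rintro k m₁ hf ⟨c, Ls, hc₁, hcS, hLs, hne, hdone, rfl⟩ hb
    simp only [Test.Holds, WExp.eval, hc₁] at hb
    obtain ⟨c, rfl⟩ : ∃ c', c = c' + 1 := ⟨c - 1, by omega⟩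
    have hxS := hso.lt c (by omega)
    have hx := hne c (by omega)
    obtain ⟨v, u, hv, -⟩ := hsa _ hxS
    set x := m.word 11 c with hxdef
    rw [hv] at hx
    obtain ⟨e, L, hL, hle⟩ := hx
    have h11 : m₁.word 11 = m.word 11 := hf.word 11 (by decide)
    have h10 : m₁.word 10 = m.word 10 := hf.word 10 (by decide)
    simp (disch := decide) only [run_seq (c := .wset _ _ _), run_wset, WExp.eval, WExp.cost,
      Memory.setWord_word_self, Memory.setWord_word_ne, hc₁, Nat.add_sub_cancel,
      Function.update_self, h11, h10, ← hxdef, hv]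
    refine ⟨by omega, by omega, by omega, by omega, by omega, by omega, ?_⟩
    set m₂ := ((m₁.setWord 24 0 c).setWord 26 0 x).setWord 27 0 v with hm₂
    have hw₂ : ∀ a, a ∉ [13, 24, 26, 27] → m₂.word a = m.word a := fun a ha => by
      simp only [List.mem_cons, not_or] at ha
      simp only [hm₂, Memory.setWord_word_ne, ha.2.1, ha.2.2.1, ha.2.2.2.1, ne_eq,
        not_false_eq_true]
      exact hf.word a (by simp [findVertex, Prog.words, ha.1, ha.2.1, ha.2.2.1, ha.2.2.2.1])
    have hr₂ : ∀ a, a ∉ [7, 8] → m₂.real a = m.real a := fun a ha => by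
      simp only [List.mem_cons, not_or] at ha
      exact hf.real a (by simp [findVertex, Prog.reals, ha.1, ha.2.1])
    have hr₂' : m₂.real = m₁.real := rfl
    have h13₂ : m₂.word 13 = m₁.word 13 := by
      simp (disch := decide) [hm₂, Memory.setWord_word_ne]
    have h24₂ : m₂.word 24 0 = c := by
      simp (disch := decide) [hm₂, Memory.setWord_word_ne, Memory.setWord_word_self]
    have h26₂ : m₂.word 26 0 = x := by
      simp (disch := decide) [hm₂, Memory.setWord_word_ne, Memory.setWord_word_self]
    have h27₂ : m₂.word 27 0 = v := by
      simp [hm₂, Memory.setWord_word_self]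
    clear_value m₂
    have h5₂ := hr₂ 5 (by decide)
    have hrun := run_findVertex (w := w) (m := m₂) (x := x) (v := v) (base := m.word 2 v)
      (P := {y | y < S ∧ m.word 10 y = v}) (H := hs v) (L := Ls v) (L₀ := L) (e₀ := e) (h := h)
      (by rw [hh, hw₂ 3 (by decide), hr₂ 3 (by decide)]) h26₂ h27₂
      (by rw [hw₂ 2 (by decide)]) (by rw [h13₂]; exact (hLs v v.2).2)
      (by
        rw [hw₂ 12 (by decide), hr₂ 6 (by decide)]
        exact (hrep v v.2).2.suffix (hLs v v.2).1)
      (hLs v v.2).1 hL (by rw [h5₂]; exact hle) (by rw [h5₂]; exact henv v v.2) (by omega) (by omega)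
      (by
        have h1 := (hLs v v.2).1.length_le
        have h2 := hbound v v.2
        have h3 := hsl.mono_le (show (v : ℕ) + 1 ≤ N from v.2) le_rfl
        rw [hsl.last] at h3
        omega)
    rw [h5₂] at hrun
    refine hrun.mono ?_
    rintro m₃ t₃ hf₃ ⟨e', L', hsuf, hle', hcv, hcu, hvert, hother, ht₃⟩
    refine ⟨_, ⟨c, Function.update Ls v (e' :: L'), ?_, by omega, ?_, ?_, ?_, rfl⟩, ?_⟩
    · rw [hf₃.word 24 (by decide), h24₂]
    · intro u hu
      by_cases huv : u = v
      · subst huv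
        rw [Function.update_self]
        exact ⟨hsuf.trans (hLs v v.2).1, hcv⟩
      · rw [Function.update_of_ne huv, hcu u huv, h13₂]
        exact hLs u hu
    · intro i hi
      by_cases hiv : m.word 10 (m.word 11 i) = v
      · rw [hiv, Function.update_self]
        exact ⟨e', L', rfl, hle'.trans (hso.anti i c (by omega) (by omega))⟩
      · rw [Function.update_of_ne hiv]
        exact hne i (by omega)
    · intro i hi1 hi2
      by_cases hix : m.word 11 i = x
      · rw [hix, hv]
        exact hvert
      · obtain ⟨h7, h8⟩ := hother _ hix
        rw [h7, h8, hr₂']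
        refine hdone i ?_ hi2
        rcases Nat.lt_or_ge c i with h | h
        · exact h
        · exact absurd (by rw [show i = c by omega]) hix
    · have hs' := sum_length_update v.2 Ls (e' :: L')
      simp only [List.length_cons] at hs'
      simp only [Test.cost, WExp.cost]
      omega
  · rintro k m₁ t hf ⟨c, Ls, hc₁, hcS, hLs, hne, hdone, rfl⟩ hb ht
    simp only [Test.Holds, WExp.eval, hc₁] at hb
    simp only [Test.cost, WExp.cost] at ht
    refine ⟨by omega, fun x hx => ?_⟩
    obtain ⟨i, hi, rfl⟩ := hso.surj x hx
    exact hdone i (by omega) hi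

end RealRAM

/-! ### Levels of the envelope, one line at a time. -/

namespace LineEnvelope

variable {ι : Type*} {A : Set ι} {h d : ι → ℝ}

theorem isLevel_empty (h d : ι → ℝ) (y : ℝ) : IsLevel (∅ : Set ι) h d 0 y :=
  ⟨⟨le_rfl, by simp⟩, Or.inl rfl⟩

/-- With positive slopes, a line admits height `y` exactly from its own crossing on. The level is
thus the maximum of 0 and all crossings, and can be updated line by line. -/
theorem IsLevel.insert_of_le {m y : ℝ} {x : ι} (H : IsLevel A h d m y) (hd : ∀ s ∈ A, 0 < d s)
    (hx : 0 < d x) (hle : m ≤ (y - h x) / d x) : IsLevel (insert x A) h d ((y - h x) / d x) y := by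
  have hxe : y = h x + d x * ((y - h x) / d x) := by field_simp; ring
  refine ⟨⟨H.1.1.trans hle, fun s hs => ?_⟩, Or.inr ⟨x, Or.inl rfl, hxe⟩⟩
  rcases hs with rfl | hs
  · exact hxe.le
  · have h1 := H.1.2 s hs
    have h2 := mul_le_mul_of_nonneg_left hle (hd s hs).le
    linarith

theorem IsLevel.insert_of_lt {m y : ℝ} {x : ι} (H : IsLevel A h d m y) (hx : 0 < d x)
    (hlt : (y - h x) / d x < m) : IsLevel (insert x A) h d m y := by
  rw [div_lt_iff₀ hx] at hlt
  refine ⟨⟨H.1.1, fun s hs => ?_⟩, H.2.imp_right fun ⟨s, hs, he⟩ => ⟨s, Or.inr hs, he⟩⟩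
  rcases hs with rfl | hs
  · linarith
  · exact H.1.2 s hs

end LineEnvelope

/-! ### Best-first search with single edges. -/

namespace ImpreciseTerrain

variable {V : Type*}

/-- The search invariant while the edges in `X` are still to be examined. -/
structure SearchInvExcept (T : ImpreciseTerrain V) (Q : Set V) (O K : Set (V × ℝ))
    (X : Set (V × V)) : Prop where
  source : ∀ q ∈ Q, (∃ z, (q, z) ∈ O) ∨ ∃ k, (q, k) ∈ K ∧ T.high q ≤ k
  isMax : ∀ v z, (v, z) ∈ O → T.IsMaxElev Q v z
  expanded : ∀ v z, (v, z) ∈ O → ∀ (R : Realization T) (u : V), (v, u) ∉ X → R.elev v ≤ z →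
    R.FlowStep v u → (∃ z, (u, z) ∈ O) ∨ ∃ k, (u, k) ∈ K ∧ R.elev u ≤ k
  attained : ∀ v k, (v, k) ∈ K → ∃ y, T.ReachedAt Q v y ∧ k ≤ y

variable {T : ImpreciseTerrain V} {Q : Set V} {O K K' : Set (V × ℝ)} {X : Set (V × V)}

theorem SearchInvExcept.searchInv (h : T.SearchInvExcept Q O K X)
    (hX : ∀ p ∈ X, ¬ T.graph.Adj p.1 p.2) : T.SearchInv Q O K :=
  ⟨h.source, h.isMax, fun v z hv R u hR hf => h.expanded v z hv R u
    (fun hx => hX _ hx ((R.flowStep_iff v u).1 hf).1) hR hf, h.attained⟩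

/-- Once `v` is output all its keys are obsolete, and the only obligations that can be open are
those for the edges out of `v`. -/
theorem SearchInv.extract (h : T.SearchInv Q O K) {v : V} {z : ℝ} (hv : (v, z) ∈ K)
    (hmax : ∀ x ∈ K, x.2 ≤ z) (hO : ∀ z, (v, z) ∉ O) :
    T.SearchInvExcept Q (insert (v, z) O) {p | p ∈ K ∧ p.1 ≠ v} {p | p.1 = v} := by
  have hlift : ∀ (u : V) (y : ℝ), ((∃ z, (u, z) ∈ O) ∨ ∃ k, (u, k) ∈ K ∧ y ≤ k) →
      (∃ z', (u, z') ∈ insert (v, z) O) ∨ ∃ k, (u, k) ∈ {p | p ∈ K ∧ p.1 ≠ v} ∧ y ≤ k := by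
    rintro u y (⟨z', hz'⟩ | ⟨k, hk, hle⟩)
    · exact Or.inl ⟨z', Or.inr hz'⟩
    · by_cases huv : u = v
      · subst huv; exact Or.inl ⟨z, Or.inl rfl⟩
      · exact Or.inr ⟨k, ⟨hk, huv⟩, hle⟩
  refine ⟨fun q hq => hlift q _ (h.source q hq), fun u y hy => ?_, fun u y hy R t hX hR hf => ?_,
    fun u k hk => h.attained u k hk.1⟩
  · rcases hy with hy | hy
    · obtain ⟨rfl, rfl⟩ := Prod.mk.inj hy
      exact h.isMaxElev hv hmax hO
    · exact h.isMax u y hy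
  · rcases hy with hy | hy
    · exact absurd (Prod.mk.inj hy).1 hX
    · exact hlift t _ (h.expanded u y hy R t hR hf)

/-- An edge is settled for one of three reasons: its end has been output, the best candidate is
below the lower bound so that no flow is possible, or a sufficient key is pending. Keys may only
grow, and only to elevations realized by a step from `v`. -/
theorem SearchInvExcept.relax (h : T.SearchInvExcept Q O K X) {v u : V} {e z : ℝ}
    (hz : (v, z) ∈ O) (hO : ∀ z', (v, z') ∈ O → z' = z)
    (he : ∀ R : Realization T, R.elev v ≤ z → R.FlowStep v u → R.elev u ≤ e)
    (hK : ∀ t k, (t, k) ∈ K → ∃ k', (t, k') ∈ K' ∧ k ≤ k')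
    (hatt : ∀ t k, (t, k) ∈ K' → (t, k) ∈ K ∨ ∃ R : Realization T, R.elev v ≤ z ∧ R.FlowStep v t ∧
      k = R.elev t)
    (hu : (∃ z', (u, z') ∈ O) ∨ e < T.low u ∨ ∃ k, (u, k) ∈ K' ∧ e ≤ k) [Finite V] :
    T.SearchInvExcept Q O K' (X \ {(v, u)}) := by
  have hlift : ∀ (t : V) (y : ℝ), ((∃ z, (t, z) ∈ O) ∨ ∃ k, (t, k) ∈ K ∧ y ≤ k) →
      (∃ z', (t, z') ∈ O) ∨ ∃ k, (t, k) ∈ K' ∧ y ≤ k := by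
    rintro t y (h1 | ⟨k, hk, hle⟩)
    · exact Or.inl h1
    · obtain ⟨k', hk', hle'⟩ := hK t k hk
      exact Or.inr ⟨k', hk', hle.trans hle'⟩
  refine ⟨fun q hq => hlift q _ (h.source q hq), h.isMax, fun t y hy R s hX hR hf => ?_,
    fun t k hk => ?_⟩
  · by_cases hts : (t, s) = (v, u)
    · obtain ⟨rfl, rfl⟩ := Prod.mk.inj hts
      obtain rfl := hO y hy
      have hes := he R hR hf
      rcases hu with h1 | h1 | ⟨k, hk, hle⟩
      · exact Or.inl h1
      · have := R.low_le s
        linarith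
      · exact Or.inr ⟨k, hk, hes.trans hle⟩
    · exact hlift s _ (h.expanded t y hy R s (fun hx => hX ⟨hx, hts⟩) hR hf)
  · rcases hatt t k hk with h1 | ⟨R, hR, hf, rfl⟩
    · exact h.attained t k h1
    · exact ReachedAt.flowsTo (h.isMax v z hz).1 hR (Relation.ReflTransGen.single hf)

end ImpreciseTerrain

/-! ### The best elevation over a single edge. -/

namespace RealRAM

open LineEnvelope ImpreciseTerrain

/-- The tables that the search uses. -/
structure Tables {N : ℕ} (T : ImpreciseTerrain (Fin N)) (S : ℕ) (m : Memory) : Prop where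
  slots : Slots T S (m.word 2) (m.word 3)
  arrays : SlotArrays T S (m.word 2) (m.word 3) (m.word 10) (m.real 5)
  low : ∀ v : Fin N, m.real 2 v = T.low v
  high : ∀ v : Fin N, m.real 3 v = T.high v
  vertex : ∀ x < S, IsVertex {y | y < S ∧ m.word 10 y = m.word 10 x}
    (fun y => m.real 3 (m.word 3 y)) (m.real 5) (m.real 5 x) (m.real 7 x) (m.real 8 x)

variable {w : ℕ} {m m' : Memory} {Q : Memory → ℕ → Prop} {N : ℕ} {T : ImpreciseTerrain (Fin N)}
  {S : ℕ}

theorem Tables.congr (h : Tables T S m) (hw : ∀ a ∈ [2, 3, 10], m'.word a = m.word a)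
    (hr : ∀ a ∈ [2, 3, 5, 7, 8], m'.real a = m.real a) : Tables T S m' := by
  have h2 := hw 2 (by simp)
  have h3 := hw 3 (by simp)
  have h10 := hw 10 (by simp)
  have r2 := hr 2 (by simp)
  have r3 := hr 3 (by simp)
  have r5 := hr 5 (by simp)
  have r7 := hr 7 (by simp)
  have r8 := hr 8 (by simp)
  refine ⟨?_, ?_, ?_, ?_, ?_⟩
  · rw [h2, h3]; exact h.slots
  · rw [h2, h3, h10, r5]; exact h.arrays
  · rw [r2]; exact h.low
  · rw [r3]; exact h.high
  · rw [h3, h10, r3, r5, r7, r8]; exact h.vertex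

/-- The slots of the node `v`. -/
def slotsOf (m : Memory) (v : ℕ) : Set ℕ := {y | m.word 2 v ≤ y ∧ y < m.word 2 (v + 1)}

theorem Tables.slot (h : Tables T S m) {v : Fin N} {x : ℕ} (hx : x ∈ slotsOf m v) :
    x < S ∧ m.word 10 x = v ∧ ∃ u : Fin N, m.word 3 x = u ∧ T.graph.Adj v u ∧
      m.real 5 x = dist (T.pos v) (T.pos u) := by
  have h1 := h.slots.mono_le (show (v : ℕ) + 1 ≤ N from v.2) le_rfl
  rw [h.slots.last] at h1
  have hxS : x < S := lt_of_lt_of_le hx.2 h1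
  obtain ⟨v', u, hv', hu, h2, h3, hadj, hlen⟩ := h.arrays x hxS
  have hvv : v' = v := by
    apply Fin.ext
    rcases Nat.lt_trichotomy v' v with hlt | heq | hlt
    · have := h.slots.mono_le (show (v' : ℕ) + 1 ≤ v from hlt) v.2.le
      have := hx.1
      omega
    · exact heq
    · have := h.slots.mono_le (show (v : ℕ) + 1 ≤ v' from hlt) v'.2.le
      have := hx.2
      omega
  subst hvv
  exact ⟨hxS, hv', u, hu, hadj, hlen⟩

theorem Tables.slotsOf_eq (h : Tables T S m) (v : Fin N) :
    {y | y < S ∧ m.word 10 y = v} = slotsOf m v := by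
  ext x
  constructor
  · rintro ⟨h1, h2⟩
    obtain ⟨v', u, h3, -, h4, h5, -⟩ := h.arrays x h1
    rw [h2] at h3
    obtain rfl := Fin.ext h3
    exact ⟨h4, h5⟩
  · exact fun hx => ⟨(h.slot hx).1, (h.slot hx).2.1⟩

/-- Translates between the lines stored for the slots of `v` and the constraints of the flow step.
-/
theorem Tables.feasible_iff (h : Tables T S m) (v : Fin N) {μ y : ℝ} :
    Feasible (slotsOf m v) (fun y => m.real 3 (m.word 3 y)) (m.real 5) μ y ↔
      0 ≤ μ ∧ ∀ s, T.graph.Adj v s → y ≤ T.high s + dist (T.pos v) (T.pos s) * μ := by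
  refine and_congr_right fun _ => ⟨fun hf s hs => ?_, fun hf x hx => ?_⟩
  · obtain ⟨x, h1, h2, hxs⟩ := h.slots.slot_of_adj v s hs
    obtain ⟨-, -, u, hu, -, hlen⟩ := h.slot ⟨h1, h2⟩
    obtain rfl := Fin.ext (hxs.symm.trans hu)
    have := hf x ⟨h1, h2⟩
    simp only [hu, h.high, hlen] at this
    exact this
  · obtain ⟨-, -, u, hu, hadj, hlen⟩ := h.slot hx
    simp only [hu, h.high, hlen]
    exact hf u hadj

/-- `e` is the largest of the candidates for the elevation at the end of slot `x`. -/
def IsBest (m : Memory) (x : ℕ) (a b ma mb e : ℝ) : Prop :=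
  a - m.real 5 x * ma ≤ e ∧ b - m.real 5 x * mb ≤ e ∧
    (a ≤ m.real 8 x ∧ m.real 8 x ≤ b → m.real 8 x - m.real 5 x * m.real 7 x ≤ e) ∧
    (e = a - m.real 5 x * ma ∨ e = b - m.real 5 x * mb ∨
      (a ≤ m.real 8 x ∧ m.real 8 x ≤ b) ∧ e = m.real 8 x - m.real 5 x * m.real 7 x)

/-- The largest candidate bounds every direct flow to `u` by `sub_le_of_isVertex`. It is attained as
soon as it respects the lower bound of `u`, since each candidate comes from a feasible point. -/
theorem Tables.expand (h : Tables T S m) {v u : Fin N} {x : ℕ} (hx : x ∈ slotsOf m v)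
    (hu : m.word 3 x = u) {z ma mb e : ℝ} (hlz : T.low v ≤ z) (hzh : z ≤ T.high v)
    (ha : IsLevel (slotsOf m v) (fun y => m.real 3 (m.word 3 y)) (m.real 5) ma (T.low v))
    (hb : IsLevel (slotsOf m v) (fun y => m.real 3 (m.word 3 y)) (m.real 5) mb z)
    (he : IsBest m x (T.low v) z ma mb e) :
    (T.low u ≤ e → ∃ R : Realization T, R.elev v ≤ z ∧ R.FlowStep v u ∧ R.elev u = e) ∧
    ∀ R : Realization T, R.elev v ≤ z → R.FlowStep v u → R.elev u ≤ e := by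
  obtain ⟨hxS, hsrc, u', hu', hadj, hlen⟩ := h.slot hx
  obtain rfl := Fin.ext (hu.symm.trans hu')
  have hvert := h.vertex x hxS
  rw [hsrc, h.slotsOf_eq] at hvert
  constructor
  · intro hlow
    obtain ⟨y, μ, hf, h1, h2, rfl⟩ : ∃ y μ, Feasible (slotsOf m v)
        (fun y => m.real 3 (m.word 3 y)) (m.real 5) μ y ∧ T.low v ≤ y ∧ y ≤ z ∧
        e = y - m.real 5 x * μ := by
      rcases he.2.2.2 with h1 | h1 | ⟨⟨h1, h2⟩, h3⟩
      · exact ⟨_, _, ha.1, le_rfl, hlz, h1⟩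
      · exact ⟨_, _, hb.1, hlz, le_rfl, h1⟩
      · exact ⟨_, _, hvert.1, h1, h2, h3⟩
    rw [h.feasible_iff] at hf
    rw [hlen] at hlow ⊢
    obtain ⟨R, e1, e2, e3⟩ := exists_flowStep hadj h1 (h2.trans hzh) hf.1 hf.2 hlow
    exact ⟨R, e1.trans_le h2, e2, e3⟩
  · intro R hR hf
    obtain ⟨-, μ, h0, he', hall⟩ := hf.exists_steepness
    have hfe := (h.feasible_iff v).2 ⟨h0, hall⟩
    rw [he', ← hlen]
    rcases sub_le_of_isVertex (fun s hs => by
        obtain ⟨h1, -⟩ := h.slot hs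
        exact h.arrays.len_pos h1) hvert (h.arrays.len_pos hxS) ha hb hfe (R.low_le v) hR with
      ⟨h1, h2, h3⟩ | h1 | h1
    · exact h3.trans (he.2.2.1 ⟨h1, h2⟩)
    · exact h1.trans he.1
    · exact h1.trans he.2.1

/-! ## The levels of a node -/

/-- Raise the real variable `a` to the level of the line of the slot in word variable 24 at `y`. -/
def raiseLevel (a : ℕ) (y : RExp) : Prog :=
  .seq (.rset 24 (.lit 0) (.div (.sub y (.load 3 (.load 3 (var 24)))) (.load 5 (var 24))))
  (.ite (.rle (rvar a) (rvar 24)) (.rset a (.lit 0) (rvar 24)) .skip)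

/-- Compute the levels of the node in word variable 26 at its lower bound (real variable 22) and at
its output elevation (real variable 23). -/
def findLevels : Prog :=
  .seq (.rset 22 (.lit 0) .zero)
  (.seq (.rset 23 (.lit 0) .zero)
  (forLoop 24 (.load 2 (var 26)) (.load 2 (.add (var 26) (.lit 1)))
    (.seq (raiseLevel 22 (.load 2 (var 26))) (raiseLevel 23 (.load 4 (var 26))))))

theorem slots_insert (a i : ℕ) (h : a ≤ i) :
    insert i {y | a ≤ y ∧ y < i} = {y | a ≤ y ∧ y < i + 1} := by
  ext y
  simp only [Set.mem_insert_iff, Set.mem_ofPred_eq]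
  omega

/-- The level at `low v` and the one at the output elevation are raised in the same scan, starting
from 0, the level of the empty set of lines. -/
theorem run_findLevels (h : Tables T S m) {v : Fin N} (hv : m.word 26 0 = v) (hw : N + S ≤ w) :
    Run w findLevels m fun m' t =>
      t ≤ 120 * (m.word 2 (v + 1) - m.word 2 v) + 50 ∧
      IsLevel (slotsOf m v) (fun y => m.real 3 (m.word 3 y)) (m.real 5) (m'.real 22 0) (T.low v) ∧
      IsLevel (slotsOf m v) (fun y => m.real 3 (m.word 3 y)) (m.real 5) (m'.real 23 0)
        (m.real 4 v) := by
  have hS := h.slots.mono_le (show (v : ℕ) + 1 ≤ N from v.2) le_rfl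
  rw [h.slots.last] at hS
  simp only [findLevels, run_seq (c := .rset _ _ _), run_rset, WExp.eval, RExp.eval, WExp.cost,
    RExp.cost]
  refine ⟨by omega, by omega, ?_⟩
  set m₁ := (m.setReal 22 0 0).setReal 23 0 0 with hm₁
  have hw₁ : m₁.word = m.word := rfl
  have hr₁ : ∀ a, a ∉ [22, 23] → m₁.real a = m.real a := fun a ha => by
    simp only [List.mem_cons, not_or] at ha
    simp [hm₁, Memory.setReal_real_ne, ha.1, ha.2.1]
  have h22 : m₁.real 22 0 = 0 := by
    simp (disch := decide) [hm₁, Memory.setReal_real_ne, Memory.setReal_real_self]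
  have h23 : m₁.real 23 0 = 0 := by simp [hm₁, Memory.setReal_real_self]
  clear_value m₁
  refine (run_forLoop (l := m.word 2 v) (n := m.word 2 (v + 1)) (c := 80)
    (I := fun i m' => IsLevel {y | m.word 2 v ≤ y ∧ y < i} (fun y => m.real 3 (m.word 3 y))
      (m.real 5) (m'.real 22 0) (T.low v) ∧ IsLevel {y | m.word 2 v ≤ y ∧ y < i}
      (fun y => m.real 3 (m.word 3 y)) (m.real 5) (m'.real 23 0) (m.real 4 v))
    (by decide) ?_ (h.slots.mono v) (by omega) ?_ ?_ ?_).mono ?_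
  · simp only [WExp.eval, hw₁, hv]
  · intro m₂ hf
    simp only [WExp.eval, hf.word 26 (by decide), hf.word 2 (by decide), hw₁, hv]
  · have he : {y | m.word 2 v ≤ y ∧ y < m.word 2 v} = ∅ := by
      ext y; simp
    rw [Memory.setWord_real, h22, h23, he]
    exact ⟨isLevel_empty _ _ _, isLevel_empty _ _ _⟩
  · rintro i m₂ hi1 hi2 hf hi ⟨hI1, hI2⟩
    have hw26 : m₂.word 26 0 = v := by rw [hf.word 26 (by decide), hw₁, hv]
    have hw3 : m₂.word 3 = m.word 3 := by rw [hf.word 3 (by decide), hw₁]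
    have e2 : m₂.real 2 = m.real 2 := by rw [hf.real 2 (by decide), hr₁ 2 (by decide)]
    have e3 : m₂.real 3 = m.real 3 := by rw [hf.real 3 (by decide), hr₁ 3 (by decide)]
    have e4 : m₂.real 4 = m.real 4 := by rw [hf.real 4 (by decide), hr₁ 4 (by decide)]
    have e5 : m₂.real 5 = m.real 5 := by rw [hf.real 5 (by decide), hr₁ 5 (by decide)]
    obtain ⟨hxS, -⟩ := h.slot (v := v) (x := i) ⟨hi1, hi2⟩
    have hpos := h.arrays.len_pos hxS
    have hd : ∀ y ∈ {y | m.word 2 v ≤ y ∧ y < i}, 0 < m.real 5 y := fun y hy =>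
      h.arrays.len_pos (lt_trans hy.2 hxS)
    simp (disch := decide) only [raiseLevel, run_seq, run_rset, run_ite, run_skip, Test.Holds,
      WExp.eval, RExp.eval, WExp.cost, RExp.cost, Test.cost, hi, hw26, hw3, e2, e3, e4, e5,
      Memory.setReal_word, Memory.setReal_real_self, Memory.setReal_real_ne, Function.update_self,
      h.low, Memory.setWord_real, ← slots_insert _ _ hi1]
    refine ⟨by omega, fun c1 => ⟨by omega, by omega, fun c2 => ⟨by omega, ⟨?_, ?_⟩, by omega⟩,
      fun c2 => ⟨⟨?_, ?_⟩, by omega⟩⟩, fun c1 => ⟨by omega, fun c2 => ⟨by omega, ⟨?_, ?_⟩, by omega⟩,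
      fun c2 => ⟨⟨?_, ?_⟩, by omega⟩⟩⟩
    · exact hI1.insert_of_le hd hpos c1
    · exact hI2.insert_of_le hd hpos c2
    · exact hI1.insert_of_le hd hpos c1
    · exact hI2.insert_of_lt hpos (not_le.1 c2)
    · exact hI1.insert_of_lt hpos (not_le.1 c1)
    · exact hI2.insert_of_le hd hpos c2
    · exact hI1.insert_of_lt hpos (not_le.1 c1)
    · exact hI2.insert_of_lt hpos (not_le.1 c2)
  · rintro m₂ t hf ⟨hI, ht⟩
    simp only [WExp.cost] at ht
    exact ⟨by omega, hI⟩

/-- Real variable 24 is set to the largest candidate for the slot in word variable 24. -/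
def bestCandidate : Prog :=
  .seq (.rset 24 (.lit 0) (.sub (.load 2 (var 26)) (.mul (.load 5 (var 24)) (rvar 22))))
  (.seq (.rset 25 (.lit 0) (.sub (.load 4 (var 26)) (.mul (.load 5 (var 24)) (rvar 23))))
  (.seq (.ite (.rle (rvar 24) (rvar 25)) (.rset 24 (.lit 0) (rvar 25)) .skip)
  (.ite (.conj (.rle (.load 2 (var 26)) (.load 8 (var 24)))
      (.rle (.load 8 (var 24)) (.load 4 (var 26))))
    (.seq (.rset 25 (.lit 0) (.sub (.load 8 (var 24)) (.mul (.load 5 (var 24)) (.load 7 (var 24)))))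
      (.ite (.rle (rvar 24) (rvar 25)) (.rset 24 (.lit 0) (rvar 25)) .skip))
    .skip)))

theorem run_bestCandidate {v x : ℕ} (hv : m.word 26 0 = v) (hx : m.word 24 0 = x) :
    Run w bestCandidate m fun m' t => t ≤ 150 ∧
      IsBest m x (m.real 2 v) (m.real 4 v) (m.real 22 0) (m.real 23 0) (m'.real 24 0) := by
  simp (disch := decide) only [bestCandidate, run_seq, run_rset, run_ite, run_skip, Test.Holds,
      WExp.eval, RExp.eval, WExp.cost, RExp.cost, Test.cost, hv, hx,
      Memory.setReal_word, Memory.setReal_real_self, Memory.setReal_real_ne, Function.update_self,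
      IsBest]
  refine ⟨by omega, by omega, fun c1 => ⟨by omega, fun c2 => ⟨by omega, fun c3 => ⟨by omega, by omega,
    ?_⟩, fun c3 => ⟨by omega, ?_⟩⟩, fun c2 => ⟨by omega, ?_⟩⟩, fun c1 => ⟨fun c2 => ⟨by omega,
    fun c3 => ⟨by omega, by omega, ?_⟩, fun c3 => ⟨by omega, ?_⟩⟩, fun c2 => ⟨by omega, ?_⟩⟩⟩
  · exact ⟨c1.trans c3, c3, fun _ => le_rfl, Or.inr (Or.inr ⟨c2, trivial⟩)⟩
  · exact ⟨c1, le_rfl, fun _ => (not_le.1 c3).le, Or.inr (Or.inl trivial)⟩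
  · exact ⟨c1, le_rfl, fun c => absurd c c2, Or.inr (Or.inl trivial)⟩
  · exact ⟨c3, (not_le.1 c1).le.trans c3, fun _ => le_rfl, Or.inr (Or.inr ⟨c2, trivial⟩)⟩
  · exact ⟨le_rfl, (not_le.1 c1).le, fun _ => (not_le.1 c3).le, Or.inl trivial⟩
  · exact ⟨le_rfl, (not_le.1 c1).le, fun c => absurd c c2, Or.inl trivial⟩

end RealRAM

namespace ImpreciseTerrain

variable {V : Type*} {T : ImpreciseTerrain V} {Q : Set V} {O K : Set (V × ℝ)} {X Y : Set (V × V)}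

theorem SearchInvExcept.mono (h : T.SearchInvExcept Q O K X) (hXY : X ⊆ Y) :
    T.SearchInvExcept Q O K Y :=
  ⟨h.source, h.isMax, fun v z hv R u hX => h.expanded v z hv R u fun hx => hX (hXY hx), h.attained⟩

end ImpreciseTerrain

namespace RealRAM

open LineEnvelope ImpreciseTerrain

variable {w : ℕ} {m m' : Memory} {N : ℕ} {T : ImpreciseTerrain (Fin N)} {S : ℕ}
  {Q : Finset (Fin N)} {B : ℝ}

/-! ## The search -/

/-- The output pairs: nodes with flag 1 in `w4`, with their elevations. -/
def outSet (N : ℕ) (w4 : ℕ → ℕ) (r4 : ℕ → ℝ) : Set (Fin N × ℝ) := {p | w4 p.1 = 1 ∧ r4 p.1 = p.2}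

/-- The pending pairs: nodes with flag 0 and a key above the sentinel `B`. -/
def keySet (N : ℕ) (B : ℝ) (w4 : ℕ → ℕ) (ky : ℕ → ℝ) : Set (Fin N × ℝ) :=
  {p | w4 p.1 = 0 ∧ ky p.1 = p.2 ∧ B < p.2}

/-- State of the search in memory; the edges in `X` are still to be examined. -/
structure QueueState (T : ImpreciseTerrain (Fin N)) (Q : Finset (Fin N)) (B : ℝ) (w4 : ℕ → ℕ)
    (r4 ky : ℕ → ℝ) (tr : ℕ → ℕ) (X : Set (Fin N × Fin N)) : Prop where
  flag : ∀ v : Fin N, w4 v = 0 ∨ w4 v = 1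
  bound : ∀ v : Fin N, B ≤ ky v
  done : ∀ v : Fin N, w4 v = 1 → ky v = B
  tree : TreeOK N tr ky
  inv : T.SearchInvExcept Q (outSet N w4 r4) (keySet N B w4 ky) X

variable {w4 : ℕ → ℕ} {r4 ky : ℕ → ℝ} {tr : ℕ → ℕ} {X : Set (Fin N × Fin N)}

/-- The queue holds one key per node. Overwriting a smaller key loses nothing, as the invariant only
asks for keys that are large enough. -/
theorem QueueState.relax_update (h : QueueState T Q B w4 r4 ky tr X) (hB : ∀ v, B < T.low v)
    {v u : Fin N} (hv : w4 v = 1) {e : ℝ} {tr' : ℕ → ℕ}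
    (hval : T.low u ≤ e → ∃ R : Realization T, R.elev v ≤ r4 v ∧ R.FlowStep v u ∧ R.elev u = e)
    (hcomp : ∀ R : Realization T, R.elev v ≤ r4 v → R.FlowStep v u → R.elev u ≤ e)
    (hu : w4 u = 0) (hlow : T.low u ≤ e) (hky : ky u < e)
    (htree : TreeOK N tr' (Function.update ky u e)) :
    QueueState T Q B w4 r4 (Function.update ky u e) tr' (X \ {(v, u)}) := by
  have hne : ∀ t : Fin N, t ≠ u → Function.update ky u e t = ky t := fun t ht =>
    Function.update_of_ne (fun he => ht (Fin.ext he)) _ _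
  refine ⟨h.flag, fun t => ?_, fun t ht => ?_, htree, h.inv.relax (z := r4 v) ⟨hv, rfl⟩
    (fun z' hz' => hz'.2.symm) hcomp ?_ ?_ ?_⟩
  · by_cases htu : t = u
    · subst htu
      rw [Function.update_self]
      exact (hB t).le.trans hlow
    · rw [hne t htu]; exact h.bound t
  · have htu : t ≠ u := fun he => by subst he; omega
    rw [hne t htu]
    exact h.done t ht
  · rintro t k ⟨h1, h2, h3⟩
    by_cases htu : t = u
    · subst htu
      have h2' : ky t = k := h2
      exact ⟨e, ⟨h1, Function.update_self _ _ _, (hB t).trans_le hlow⟩, h2' ▸ hky.le⟩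
    · exact ⟨k, ⟨h1, (hne t htu).trans h2, h3⟩, le_rfl⟩
  · rintro t k ⟨h1, h2, h3⟩
    by_cases htu : t = u
    · subst htu
      obtain ⟨R, hR1, hR2, hR3⟩ := hval hlow
      refine Or.inr ⟨R, hR1, hR2, ?_⟩
      have h2' : Function.update ky t e t = k := h2
      rw [hR3, ← h2', Function.update_self]
    · exact Or.inl ⟨h1, (hne t htu).symm.trans h2, h3⟩
  · exact Or.inr (Or.inr ⟨e, ⟨hu, Function.update_self _ _ _, (hB u).trans_le hlow⟩, le_rfl⟩)

/-- If nothing is written, then `u` has been output, cannot receive water directly from `v`, or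
already has a sufficient key. -/
theorem QueueState.relax_skip (h : QueueState T Q B w4 r4 ky tr X) (hB : ∀ v, B < T.low v)
    {v u : Fin N} (hv : w4 v = 1) {e : ℝ}
    (hcomp : ∀ R : Realization T, R.elev v ≤ r4 v → R.FlowStep v u → R.elev u ≤ e)
    (hu : w4 u = 0 → T.low u ≤ e → e ≤ ky u) :
    QueueState T Q B w4 r4 ky tr (X \ {(v, u)}) := by
  refine ⟨h.flag, h.bound, h.done, h.tree, h.inv.relax (z := r4 v) ⟨hv, rfl⟩
    (fun z' hz' => hz'.2.symm) hcomp (fun t k hk => ⟨k, hk, le_rfl⟩) (fun t k hk => Or.inl hk) ?_⟩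
  rcases h.flag u with h0 | h1
  · rcases lt_or_ge e (T.low u) with h2 | h2
    · exact Or.inr (Or.inl h2)
    · have h3 := hu h0 h2
      exact Or.inr (Or.inr ⟨ky u, ⟨h0, rfl, (hB u).trans_le (h2.trans h3)⟩, h3⟩)
  · exact Or.inl ⟨r4 u, h1, rfl⟩

/-- Output nodes carry the sentinel key, so a root above the sentinel is a node not yet output.
Resetting its key to `B` removes it from the queue. -/
theorem QueueState.extract (h : QueueState T Q B w4 r4 ky tr ∅)
    (hroot : B < ky (tr 1)) {v : Fin N} (hv : tr 1 = v) {tr' : ℕ → ℕ}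
    (htree : TreeOK N tr' (Function.update ky v B)) :
    w4 v = 0 ∧ T.IsMaxElev Q v (ky v) ∧
    QueueState T Q B (Function.update w4 v 1) (Function.update r4 v (ky v))
      (Function.update ky v B) tr' {p | p.1 = v} := by
  have hne : ∀ t : Fin N, t ≠ v → (t : ℕ) ≠ v := fun t ht he => ht (Fin.ext he)
  have hS := h.inv.searchInv (by simp)
  rw [hv] at hroot
  have hv0 : w4 v = 0 := by
    rcases h.flag v with h0 | h1
    · exact h0
    · have := h.done v h1
      linarith
  have hK : (v, ky v) ∈ keySet N B w4 ky := ⟨hv0, rfl, hroot⟩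
  have hmax : ∀ x ∈ keySet N B w4 ky, x.2 ≤ ky v := by
    rintro ⟨t, k⟩ ⟨-, h2, -⟩
    have h3 : ky t = k := h2
    rw [← hv, ← h3]
    exact h.tree.le_root t.2
  have hO : ∀ z, (v, z) ∉ outSet N w4 r4 := fun z hz => by
    have : w4 v = 1 := hz.1
    omega
  refine ⟨hv0, hS.isMaxElev hK hmax hO, fun t => ?_, fun t => ?_, fun t ht => ?_, htree, ?_⟩
  · by_cases htv : t = v
    · subst htv; simp
    · rw [Function.update_of_ne (hne t htv)]; exact h.flag t
  · by_cases htv : t = v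
    · subst htv; simp
    · rw [Function.update_of_ne (hne t htv)]; exact h.bound t
  · by_cases htv : t = v
    · subst htv; simp
    · rw [Function.update_of_ne (hne t htv)] at ht ⊢; exact h.done t ht
  · have e1 : outSet N (Function.update w4 v 1) (Function.update r4 v (ky v)) =
        insert (v, ky v) (outSet N w4 r4) := by
      ext ⟨t, z⟩
      by_cases htv : t = v
      · subst htv
        simp [outSet, hv0, eq_comm]
      · simp [outSet, Function.update_of_ne (hne t htv), htv]
    have e2 : keySet N B (Function.update w4 v 1) (Function.update ky v B) =
        {p | p ∈ keySet N B w4 ky ∧ p.1 ≠ v} := by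
      ext ⟨t, z⟩
      by_cases htv : t = v
      · subst htv
        simp [keySet]
      · simp [keySet, Function.update_of_ne (hne t htv), htv]
    rw [e1, e2]
    exact hS.extract hK hmax hO

/-- Examine the slot in word variable 24 of the node in word variable 26. -/
def relaxSlot : Prog :=
  .seq bestCandidate
  (.ite (.conj (.wle (.load 4 (.load 3 (var 24))) (.lit 0))
      (.conj (.rle (.load 2 (.load 3 (var 24))) (rvar 24))
        (.neg (.rle (rvar 24) (.load 20 (.load 3 (var 24)))))))
    (.seq (.rset 20 (.load 3 (var 24)) (rvar 24)) (treeUpdate (.load 3 (var 24))))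
    .skip)

theorem run_relaxSlot (h : Tables T S m) (hB : ∀ v, B < T.low v) {L : ℕ} (hw : N + S ≤ w)
    (hL : N < 2 ^ L) {v : Fin N} {x : ℕ} (hx : x ∈ slotsOf m v) (hv26 : m.word 26 0 = v)
    (hx24 : m.word 24 0 = x) (hM : m.word 21 0 = N) (hv1 : m.word 4 v = 1)
    (hlz : T.low v ≤ m.real 4 v) (hzh : m.real 4 v ≤ T.high v)
    (ha : IsLevel (slotsOf m v) (fun y => m.real 3 (m.word 3 y)) (m.real 5) (m.real 22 0) (T.low v))
    (hb : IsLevel (slotsOf m v) (fun y => m.real 3 (m.word 3 y)) (m.real 5) (m.real 23 0)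
      (m.real 4 v))
    (hq : QueueState T Q B (m.word 4) (m.real 4) (m.real 20) (m.word 20) X) :
    Run w relaxSlot m fun m' t => t ≤ 50 * L + 300 ∧ ∀ u : Fin N, m.word 3 x = u →
      QueueState T Q B (m.word 4) (m.real 4) (m'.real 20) (m'.word 20) (X \ {(v, u)}) := by
  refine Run.seq ((run_bestCandidate hv26 hx24).mono ?_)
  rintro m₁ t₁ hf₁ ⟨ht₁, hbest⟩
  rw [h.low] at hbest
  have hw₁ : m₁.word = m.word := funext fun a => hf₁.word a (by simp [bestCandidate, Prog.words])
  have r2 : m₁.real 2 = m.real 2 := hf₁.real 2 (by decide)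
  have r20 : m₁.real 20 = m.real 20 := hf₁.real 20 (by decide)
  obtain ⟨-, -, u, hu, -, -⟩ := h.slot hx
  obtain ⟨hval, hcomp⟩ := h.expand hx hu hlz hzh ha hb hbest
  rw [run_ite]
  simp only [Test.Holds, Test.cost, WExp.eval, RExp.eval, WExp.cost, RExp.cost, hw₁, hx24, hu, r2,
    r20, h.low]
  constructor
  · rintro ⟨c1, c2, c3⟩
    simp only [run_seq, run_rset, WExp.eval, RExp.eval, WExp.cost, RExp.cost, hw₁, hx24, hu]
    refine ⟨by omega, (run_treeUpdate (M := N) (L := L) (ky := m.real 20) ?_ ?_ (by omega) hL ?_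
      ?_).mono ?_⟩
    · rw [Memory.setReal_word, hw₁, hM]
    · simp only [WExp.eval, Memory.setReal_word, hw₁, hx24, hu]
      exact u.2
    · intro y hy
      simp only [WExp.eval, Memory.setReal_word, hw₁, hx24, hu] at hy
      rw [Memory.setReal_real_self, r20, Function.update_of_ne hy]
    · rw [Memory.setReal_word, hw₁]
      exact hq.tree
    · rintro m₂ t₂ hf₂ ⟨ht₂, htree⟩
      simp only [WExp.cost] at ht₂
      rw [Memory.setReal_real_self, r20] at htree
      refine ⟨by omega, fun u' hu' => ?_⟩
      obtain rfl := Fin.ext hu'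
      rw [hf₂.real 20 (by decide), Memory.setReal_real_self, r20]
      exact hq.relax_update hB hv1 hval hcomp (by omega) c2 (not_le.1 c3) htree
  · intro hc
    rw [run_skip]
    refine ⟨by omega, fun u' hu' => ?_⟩
    obtain rfl := Fin.ext hu'
    rw [r20, hw₁]
    exact hq.relax_skip hB hv1 hcomp fun h0 h1 => by
      by_contra hlt
      exact hc ⟨by omega, h1, hlt⟩

/-- Output the node at the root of the tree and examine its edges. -/
def visitNode : Prog :=
  .seq (.wset 26 (.lit 0) (.load 20 (.lit 1)))
  (.seq (.wset 4 (var 26) (.lit 1))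
  (.seq (.rset 4 (var 26) (.load 20 (var 26)))
  (.seq (.rset 20 (var 26) (rvar 21))
  (.seq (treeUpdate (var 26))
  (.seq findLevels
  (forLoop 24 (.load 2 (var 26)) (.load 2 (.add (var 26) (.lit 1))) relaxSlot))))))

/-- The cost is one tree update plus one logarithmic examination per slot of the visited node;
summed over all visits this charges every slot once. -/
theorem run_visitNode (h : Tables T S m) (hB : ∀ v, B < T.low v) (hBm : m.real 21 0 = B) {L : ℕ}
    (hw : N + S + 1 ≤ w) (hL : N < 2 ^ L) (hM : m.word 21 0 = N) (hN : 1 ≤ N)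
    (hroot : B < m.real 20 (m.word 20 1))
    (hq : QueueState T Q B (m.word 4) (m.real 4) (m.real 20) (m.word 20) ∅) :
    Run w visitNode m fun m' t => ∃ v : Fin N, m.word 4 v = 0 ∧
      m'.word 4 = Function.update (m.word 4) v 1 ∧
      QueueState T Q B (m'.word 4) (m'.real 4) (m'.real 20) (m'.word 20) ∅ ∧
      t ≤ 50 * L + 200 + (50 * L + 500) * (m.word 2 (v + 1) - m.word 2 v) := by
  obtain ⟨v, hv⟩ : ∃ v : Fin N, m.word 20 1 = v := ⟨⟨_, hq.tree.root_lt hN⟩, rfl⟩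
  have hvN := v.2
  have hoS := h.slots.mono_le (show (v : ℕ) + 1 ≤ N from v.2) le_rfl
  rw [h.slots.last] at hoS
  simp (disch := decide) only [visitNode, run_seq (c := .wset _ _ _), run_seq (c := .rset _ _ _),
    run_wset, run_rset, WExp.eval, WExp.cost, RExp.eval, RExp.cost, Memory.setWord_word_self,
    Memory.setWord_word_ne, Memory.setReal_real_ne, Memory.setReal_word, Memory.setWord_real, hv,
    hBm, Function.update_self]
  refine ⟨by omega, by omega, by omega, by omega, by omega, by omega, ?_⟩
  set m₁ := (((m.setWord 26 0 v).setWord 4 v 1).setReal 4 v (m.real 20 v)).setReal 20 v B with hm₁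
  have h26 : m₁.word 26 0 = v := by
    simp (disch := decide) [hm₁, Memory.setWord_word_self, Memory.setWord_word_ne,
      Memory.setReal_word]
  have h4 : m₁.word 4 = Function.update (m.word 4) v 1 := by
    simp (disch := decide) [hm₁, Memory.setWord_word_self, Memory.setWord_word_ne,
      Memory.setReal_word]
  have hr4 : m₁.real 4 = Function.update (m.real 4) v (m.real 20 v) := by
    simp (disch := decide) [hm₁, Memory.setReal_real_self, Memory.setReal_real_ne,
      Memory.setWord_real]
  have hr20 : m₁.real 20 = Function.update (m.real 20) v B := by
    simp (disch := decide) [hm₁, Memory.setReal_real_self, Memory.setReal_real_ne,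
      Memory.setWord_real]
  have hw₁ : ∀ a, a ∉ [4, 26] → m₁.word a = m.word a := fun a ha => by
    simp only [List.mem_cons, not_or] at ha
    simp [hm₁, Memory.setReal_word, Memory.setWord_word_ne, ha.1, ha.2.1]
  have hr₁ : ∀ a, a ∉ [4, 20] → m₁.real a = m.real a := fun a ha => by
    simp only [List.mem_cons, not_or] at ha
    simp [hm₁, Memory.setReal_real_ne, Memory.setWord_real, ha.1, ha.2.1]
  clear_value m₁
  refine Run.seq ((run_treeUpdate (M := N) (L := L) (ky := m.real 20)
    (by rw [hw₁ 21 (by decide), hM]) (by simp only [WExp.eval, h26]; exact hvN) (by omega) hL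
    (fun y hy => by
      simp only [WExp.eval, h26] at hy
      rw [hr20, Function.update_of_ne hy])
    (by rw [hw₁ 20 (by decide)]; exact hq.tree)).mono ?_)
  rintro m₂ t₂ hf₂ ⟨ht₂, htree⟩
  simp only [WExp.cost] at ht₂
  rw [hr20] at htree
  obtain ⟨hv0, hmaxe, hq₂⟩ := hq.extract hroot hv htree
  have htab : Tables T S m₂ := h.congr
    (fun a ha => by
      simp only [List.mem_cons, List.not_mem_nil, or_false] at ha
      rcases ha with rfl | rfl | rfl <;>
        rw [hf₂.word _ (by decide), hw₁ _ (by decide)])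
    (fun a ha => by
      simp only [List.mem_cons, List.not_mem_nil, or_false] at ha
      rcases ha with rfl | rfl | rfl | rfl | rfl <;>
        rw [hf₂.real _ (by decide), hr₁ _ (by decide)])
  have e2 : m₂.word 2 = m.word 2 := by rw [hf₂.word 2 (by decide), hw₁ 2 (by decide)]
  have e4 : m₂.real 4 v = m.real 20 v := by
    rw [hf₂.real 4 (by decide), hr4, Function.update_self]
  have hrl := run_findLevels (w := w) htab (v := v) (by rw [hf₂.word 26 (by decide), h26])
    (by omega)
  rw [e2, e4] at hrl
  refine Run.seq (hrl.mono ?_)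
  rintro m₃ t₃ hf₃ ⟨ht₃, hl1, hl2⟩
  have hw₃ : ∀ a, a ≠ 24 → m₃.word a = m₂.word a := fun a ha =>
    hf₃.word a (by simp [findLevels, raiseLevel, forLoop, Prog.words, ha])
  have hr₃ : ∀ a, a ∉ [22, 23, 24] → m₃.real a = m₂.real a := fun a ha => by
    simp only [List.mem_cons, not_or] at ha
    exact hf₃.real a (by simp [findLevels, raiseLevel, forLoop, Prog.reals, ha.1, ha.2.1, ha.2.2.1])
  obtain ⟨R, -, hRe⟩ := hmaxe.1
  have hlz : T.low v ≤ m.real 20 v := hRe ▸ R.low_le v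
  have hzh : m.real 20 v ≤ T.high v := hRe ▸ R.le_high v
  have hs2 : m₃.word 2 = m.word 2 := by rw [hw₃ 2 (by decide), e2]
  have h4₃ : m₃.word 4 = Function.update (m.word 4) v 1 := by
    rw [hw₃ 4 (by decide), hf₂.word 4 (by decide), h4]
  have hr4₃ : m₃.real 4 = Function.update (m.real 4) v (m.real 20 v) := by
    rw [hr₃ 4 (by decide), hf₂.real 4 (by decide), hr4]
  have h26₃ : m₃.word 26 0 = v := by rw [hw₃ 26 (by decide), hf₂.word 26 (by decide), h26]
  have htab₃ : Tables T S m₃ := htab.congr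
    (fun a ha => by
      simp only [List.mem_cons, List.not_mem_nil, or_false] at ha
      rcases ha with rfl | rfl | rfl <;> exact hw₃ _ (by decide))
    (fun a ha => by
      simp only [List.mem_cons, List.not_mem_nil, or_false] at ha
      rcases ha with rfl | rfl | rfl | rfl | rfl <;> exact hr₃ _ (by decide))
  -- Before slot `i` is examined, the open edges are those from `v` to nodes not listed in the
  -- earlier slots of `v`. After the last slot no genuine edge is open.
  refine (run_forLoop (l := m.word 2 v) (n := m.word 2 (v + 1)) (c := 50 * L + 300)
    (I := fun i m' => QueueState T Q B (m₃.word 4) (m₃.real 4) (m'.real 20) (m'.word 20)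
      {p | p.1 = v ∧ ∀ x, m.word 2 v ≤ x → x < i → m₃.word 3 x ≠ p.2})
    (by decide) ?_ (h.slots.mono v) (by omega) ?_ ?_ ?_).mono ?_
  · simp only [WExp.eval, hs2, h26₃]
  · intro m₄ hf
    simp only [WExp.eval, hf.word 26 (by decide), hf.word 2 (by decide), hs2, h26₃]
  · have hX : {p : Fin N × Fin N | p.1 = v ∧ ∀ x, m.word 2 v ≤ x → x < m.word 2 v →
        m₃.word 3 x ≠ p.2} = {p | p.1 = v} := by
      ext p
      simp only [Set.mem_ofPred_eq, and_iff_left_iff_imp]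
      intro _ x h1 h2
      omega
    rw [Memory.setWord_real, Memory.setWord_word_ne _ _ _ (by decide), hX, h4₃, hr4₃,
      hr₃ 20 (by decide), hw₃ 20 (by decide), hf₂.real 20 (by decide), hr20]
    exact hq₂
  · intro i m₄ hi1 hi2 hf hi hI
    have htab₄ : Tables T S m₄ := htab₃.congr
      (fun a ha => by
        simp only [List.mem_cons, List.not_mem_nil, or_false] at ha
        rcases ha with rfl | rfl | rfl <;> exact hf.word _ (by decide))
      (fun a ha => by
        simp only [List.mem_cons, List.not_mem_nil, or_false] at ha
        rcases ha with rfl | rfl | rfl | rfl | rfl <;> exact hf.real _ (by decide))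
    have w4e : m₄.word 4 = m₃.word 4 := hf.word 4 (by decide)
    have r4e : m₄.real 4 = m₃.real 4 := hf.real 4 (by decide)
    have w3e : m₄.word 3 = m₃.word 3 := hf.word 3 (by decide)
    have w2e : m₄.word 2 = m.word 2 := by rw [hf.word 2 (by decide), hs2]
    have r4v : m₃.real 4 v = m.real 20 v := by rw [hr4₃, Function.update_self]
    have hx : i ∈ slotsOf m₄ v := by
      simp only [slotsOf, w2e]
      exact ⟨hi1, hi2⟩
    obtain ⟨-, -, u, hu, -, -⟩ := htab₄.slot hx
    have hso : slotsOf m₂ v = slotsOf m₄ v := by simp only [slotsOf, w2e, e2]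
    have hfun : (fun y => m₂.real 3 (m₂.word 3 y)) = fun y => m₄.real 3 (m₄.word 3 y) := by
      rw [w3e, hw₃ 3 (by decide), hf.real 3 (by decide), hr₃ 3 (by decide)]
    have r5e : m₂.real 5 = m₄.real 5 := by rw [hf.real 5 (by decide), hr₃ 5 (by decide)]
    refine (run_relaxSlot (L := L) htab₄ hB (by omega) hL hx ?_ hi ?_ ?_ ?_ ?_ ?_ ?_
      (by rw [w4e, r4e]; exact hI)).mono ?_
    · rw [hf.word 26 (by decide), h26₃]
    · rw [hf.word 21 (by decide), hw₃ 21 (by decide), hf₂.word 21 (by decide), hw₁ 21 (by decide), hM]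
    · rw [w4e, h4₃, Function.update_self]
    · rw [r4e, r4v]; exact hlz
    · rw [r4e, r4v]; exact hzh
    · rw [hf.real 22 (by decide), ← hso, ← hfun, ← r5e]
      exact hl1
    · rw [hf.real 23 (by decide), ← hso, ← hfun, ← r5e, r4e, r4v]
      exact hl2
    · rintro m₅ t₅ hf₅ ⟨ht₅, hq₅⟩
      refine ⟨?_, ht₅⟩
      have hq₆ := hq₅ u hu
      rw [Memory.setWord_real, Memory.setWord_word_ne _ _ _ (by decide)]
      rw [w4e, r4e] at hq₆
      refine ⟨hq₆.flag, hq₆.bound, hq₆.done, hq₆.tree, hq₆.inv.mono ?_⟩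
      rintro ⟨a, b⟩ ⟨⟨h1, h2⟩, h3⟩
      refine ⟨h1, fun x hx1 hx2 hxe => ?_⟩
      rcases Nat.lt_or_ge x i with hxi | hxi
      · exact h2 x hx1 hxi hxe
      · obtain rfl : x = i := by omega
        rw [w3e, hxe] at hu
        exact h3 (Prod.ext h1 (Fin.ext hu))
  · rintro m₄ t₄ hf ⟨hI, ht₄⟩
    simp only [WExp.cost] at ht₄
    have w4e : m₄.word 4 = m₃.word 4 := hf.word 4 (by decide)
    have r4e : m₄.real 4 = m₃.real 4 := hf.real 4 (by decide)
    refine ⟨v, hv0, by rw [w4e, h4₃], ?_, ?_⟩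
    · rw [w4e, r4e]
      refine ⟨hI.flag, hI.bound, hI.done, hI.tree, ?_⟩
      have hSI := hI.inv.searchInv ?_
      · exact ⟨hSI.source, hSI.isMax, fun a z ha R b _ => hSI.expanded a z ha R b, hSI.attained⟩
      · rintro ⟨a, b⟩ ⟨h1, h2⟩ hadj
        have h1' : a = v := h1
        subst h1'
        obtain ⟨x, hx1, hx2, hx3⟩ := htab₃.slots.slot_of_adj a b hadj
        rw [hs2] at hx1 hx2
        exact h2 x hx1 hx2 hx3
    · set D := m.word 2 (v + 1) - m.word 2 v
      have e1 : D * (50 * L + 300 + (1 + 1 + 1 + 1 + 1) + 15) = 50 * L * D + 320 * D := by ring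
      have e2 : (50 * L + 500) * D = 50 * L * D + 500 * D := by ring
      rw [e1] at ht₄
      rw [e2]
      omega

end RealRAM

/-! ### Initialization, the main loop and the whole program. -/

namespace RealRAM

open LineEnvelope ImpreciseTerrain

variable {w : ℕ} {m m' : Memory} {N : ℕ} {T : ImpreciseTerrain (Fin N)} {S : ℕ}
  {Q : Finset (Fin N)} {B : ℝ}

theorem Encodes.congr (h : Encodes T Q m) (hw : ∀ a ∈ [0, 1, 2, 3], m'.word a = m.word a)
    (hr : ∀ a ∈ [0, 1, 2, 3], m'.real a = m.real a) : Encodes T Q m' := by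
  have w0 := hw 0 (by simp)
  have w1 := hw 1 (by simp)
  have w2 := hw 2 (by simp)
  have w3 := hw 3 (by simp)
  have r0 := hr 0 (by simp)
  have r1 := hr 1 (by simp)
  have r2 := hr 2 (by simp)
  have r3 := hr 3 (by simp)
  refine ⟨?_, ?_, ?_, ?_, ?_, ?_, ?_, ?_⟩
  · rw [w0]; exact h.numNodes
  · rw [w1]; exact h.mem_Q
  · rw [w2]; exact h.offset_zero
  · rw [w2, w3]; exact h.adjacency
  · rw [r0]; exact h.xcoord
  · rw [r1]; exact h.ycoord
  · rw [r2]; exact h.low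
  · rw [r3]; exact h.high

/-- Set real variable 21 to a number below all elevations. -/
def setSentinel : Prog :=
  .seq (.rset 21 (.lit 0) .zero)
  (.seq (forLoop 23 (.lit 0) (var 0)
    (.ite (.rle (.load 2 (var 23)) (rvar 21)) (.rset 21 (.lit 0) (.load 2 (var 23))) .skip))
  (.rset 21 (.lit 0) (.sub (rvar 21) .one)))

/-- The minimum of 0 and all lower bounds, minus one, is strictly below every elevation, so an empty
queue entry cannot be mistaken for a key. -/
theorem run_setSentinel (h : Encodes T Q m) (hw : N ≤ w) :
    Run w setSentinel m fun m' t => t ≤ 50 * N + 50 ∧ ∀ v, m'.real 21 0 < T.low v := by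
  have hN := h.numNodes
  simp only [setSentinel, run_seq (c := .rset _ _ _), run_rset, WExp.eval, RExp.eval, WExp.cost,
    RExp.cost]
  refine ⟨by omega, Run.seq ((run_forLoop (l := 0) (n := N) (c := 20)
    (I := fun i m' => ∀ v : Fin N, (v : ℕ) < i → m'.real 21 0 ≤ T.low v)
    (by decide) rfl (by omega) hw ?_ (by simp) ?_).mono ?_)⟩
  · intro m₁ hf
    simp only [WExp.eval, hf.word 0 (by decide), Memory.setReal_word, hN]
  · intro i m₁ _ hi hf hvi hI
    have r2 : m₁.real 2 i = T.low ⟨i, hi⟩ := by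
      rw [hf.real 2 (by decide), Memory.setReal_real_ne _ _ _ (by decide)]
      exact h.low ⟨i, hi⟩
    simp (disch := decide) only [run_rset, run_ite, run_skip, Test.Holds, WExp.eval, RExp.eval,
      WExp.cost, RExp.cost, Test.cost, hvi, r2, Memory.setReal_real_self, Memory.setWord_real,
      Function.update_self]
    refine ⟨fun hc => ⟨by omega, fun v hv => ?_, by omega⟩, fun hc => ⟨fun v hv => ?_, by omega⟩⟩
    · rcases Nat.lt_succ_iff_lt_or_eq.1 hv with h1 | h1
      · exact hc.trans (hI v h1)
      · exact (congrArg T.low (Fin.ext h1.symm)).le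
    · rcases Nat.lt_succ_iff_lt_or_eq.1 hv with h1 | h1
      · exact hI v h1
      · exact (not_le.1 hc).le.trans (congrArg T.low (Fin.ext h1.symm)).le
  · rintro m₁ t hf ⟨hI, ht⟩
    simp only [run_rset, WExp.eval, RExp.eval, WExp.cost, RExp.cost, Memory.setReal_real_self,
      Function.update_self] at ht ⊢
    refine ⟨by omega, by omega, fun v => ?_⟩
    have := hI v v.2
    linarith

/-- Initialize the search: enqueue the nodes of `Q`. -/
def initNodes : Prog :=
  .seq (.wset 21 (.lit 0) (var 0))
  (.seq (forLoop 23 (.lit 0) (var 0)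
    (.seq (.wset 4 (var 23) (.lit 0))
    (.ite (.wle (.lit 1) (.load 1 (var 23))) (.rset 20 (var 23) (.load 3 (var 23)))
      (.rset 20 (var 23) (rvar 21)))))
  treeBuild)

theorem run_initNodes (h : Encodes T Q m) (hB : ∀ v, B < T.low v) (hBm : m.real 21 0 = B)
    (hw : 2 * N ≤ w) :
    Run w initNodes m fun m' t => t ≤ 200 * N + 150 ∧ m'.word 21 0 = N ∧
      (∀ v < N, m'.word 4 v = 0) ∧
      QueueState T Q B (m'.word 4) (m'.real 4) (m'.real 20) (m'.word 20) ∅ := by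
  have hN := h.numNodes
  simp only [initNodes, run_seq (c := .wset _ _ _), run_wset, WExp.eval, WExp.cost, hN]
  refine ⟨by omega, by omega, Run.seq ((run_forLoop (l := 0) (n := N) (c := 30)
    (I := fun i m' => ∀ v : Fin N, (v : ℕ) < i → m'.word 4 v = 0 ∧
      m'.real 20 v = if v ∈ Q then T.high v else B)
    (by decide) rfl (by omega) (by omega) ?_ (by simp) ?_).mono ?_)⟩
  · intro m₁ hf
    simp (disch := decide) only [WExp.eval, hf.word 0 (by decide), Memory.setWord_word_ne, hN]
  · intro i m₁ _ hi hf hvi hI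
    have r3 : m₁.real 3 i = T.high ⟨i, hi⟩ := by
      rw [hf.real 3 (by decide), Memory.setWord_real]
      exact h.high ⟨i, hi⟩
    have w1 : m₁.word 1 i = if (⟨i, hi⟩ : Fin N) ∈ Q then 1 else 0 := by
      rw [hf.word 1 (by decide), Memory.setWord_word_ne _ _ _ (by decide)]
      exact h.mem_Q ⟨i, hi⟩
    have r21 : m₁.real 21 0 = B := by rw [hf.real 21 (by decide), Memory.setWord_real, hBm]
    have hne : ∀ v : Fin N, (v : ℕ) < i + 1 → v = ⟨i, hi⟩ ∨ ((v : ℕ) < i ∧ (v : ℕ) ≠ i) := by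
      intro v hv
      rcases Nat.lt_succ_iff_lt_or_eq.1 hv with h1 | h1
      · exact Or.inr ⟨h1, h1.ne⟩
      · exact Or.inl (Fin.ext h1)
    simp (disch := decide) only [run_seq, run_wset, run_rset, run_ite, Test.Holds, WExp.eval,
      RExp.eval, WExp.cost, RExp.cost, Test.cost, hvi, r3, w1, r21, Memory.setReal_real_self,
      Memory.setWord_real, Memory.setReal_word, Memory.setWord_word_self, Memory.setWord_word_ne]
    refine ⟨by omega, by omega, fun hc => ⟨by omega, fun v hv => ?_, by omega⟩,
      fun hc => ⟨by omega, fun v hv => ?_, by omega⟩⟩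
    · rcases hne v hv with rfl | ⟨h1, h2⟩
      · have hq : (⟨i, hi⟩ : Fin N) ∈ Q := by
          by_contra hq
          rw [if_neg hq] at hc
          omega
        simp [hq]
      · rw [Function.update_of_ne h2, Function.update_of_ne h2]
        exact hI v h1
    · rcases hne v hv with rfl | ⟨h1, h2⟩
      · have hq : (⟨i, hi⟩ : Fin N) ∉ Q := by
          intro hq
          rw [if_pos hq] at hc
          omega
        simp [hq]
      · rw [Function.update_of_ne h2, Function.update_of_ne h2]
        exact hI v h1
  · rintro m₁ t₁ hf₁ ⟨hI, ht₁⟩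
    simp only [WExp.cost] at ht₁
    have hM : m₁.word 21 0 = N := by
      rw [hf₁.word 21 (by decide), Memory.setWord_word_self, Function.update_self]
    refine (run_treeBuild hM hw).mono ?_
    rintro m₂ t₂ hf₂ ⟨ht₂, htree⟩
    have w4e : m₂.word 4 = m₁.word 4 := hf₂.word 4 (by decide)
    have r20e : m₂.real 20 = m₁.real 20 := hf₂.real 20 (by decide)
    refine ⟨by omega, by rw [hf₂.word 21 (by decide), hM], fun v hv => ?_, ?_⟩
    · rw [w4e]; exact (hI ⟨v, hv⟩ hv).1
    rw [w4e, r20e]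
    have hz : ∀ v : Fin N, m₁.word 4 v = 0 := fun v => (hI v v.2).1
    have hk : ∀ v : Fin N, m₁.real 20 v = if v ∈ Q then T.high v else B := fun v => (hI v v.2).2
    have hBh : ∀ v, B < T.high v := fun v => (hB v).trans_le (T.low_le_high v)
    have hO : ∀ x, x ∉ outSet N (m₁.word 4) (m₂.real 4) := fun x hx => by
      have h1 : m₁.word 4 x.1 = 1 := hx.1
      rw [hz] at h1
      omega
    have hkey : ∀ v k, (v, k) ∈ keySet N B (m₁.word 4) (m₁.real 20) ↔ v ∈ Q ∧ k = T.high v := by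
      intro v k
      constructor
      · rintro ⟨-, h1, h2⟩
        simp only [hk] at h1 h2
        by_cases hq : v ∈ Q
        · rw [if_pos hq] at h1
          exact ⟨hq, h1.symm⟩
        · rw [if_neg hq] at h1
          linarith
      · rintro ⟨hq, rfl⟩
        exact ⟨hz v, by simp only [hk, if_pos hq], hBh v⟩
    refine ⟨fun v => Or.inl (hz v), fun v => ?_, fun v hv => ?_, htree, ⟨fun q hq => ?_,
      fun v z hv => absurd hv (hO _), fun v z hv => absurd hv (hO _), fun v k hvk => ?_⟩⟩
    · rw [hk]
      split_ifs
      · exact (hBh v).le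
      · exact le_rfl
    · rw [hz] at hv
      omega
    · exact Or.inr ⟨T.high q, (hkey _ _).2 ⟨hq, rfl⟩, le_rfl⟩
    · obtain ⟨hq, rfl⟩ := (hkey _ _).1 hvk
      exact ⟨_, T.reachedAt_high hq, le_rfl⟩

def search : Prog :=
  .loop (.conj (.wle (.lit 1) (var 21)) (.neg (.rle (.load 20 (.load 20 (.lit 1))) (rvar 21))))
    visitNode

theorem sum_remaining_update {N v : ℕ} (hv : v < N) {w4 : ℕ → ℕ} (h0 : w4 v = 0) (f : ℕ → ℕ) :
    ∑ u ∈ Finset.range N, (if Function.update w4 v 1 u = 0 then f u else 0) + f v =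
      ∑ u ∈ Finset.range N, if w4 u = 0 then f u else 0 := by
  rw [← Finset.add_sum_erase _ _ (Finset.mem_range.2 hv),
    ← Finset.add_sum_erase (a := v) _ (fun u => if w4 u = 0 then f u else 0) (Finset.mem_range.2 hv)]
  have h3 : ∑ u ∈ (Finset.range N).erase v, (if Function.update w4 v 1 u = 0 then f u else 0) =
      ∑ u ∈ (Finset.range N).erase v, if w4 u = 0 then f u else 0 :=
    Finset.sum_congr rfl fun u hu => by rw [Function.update_of_ne (Finset.ne_of_mem_erase hu)]
  rw [h3]
  simp [h0]
  omega

/-- The budget reserves for every node not yet output the cost of visiting it. Degrees sum to `S`,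
so the total is of order `(N + S) L`. -/
theorem run_search (h : Tables T S m) (hB : ∀ v, B < T.low v) (hBm : m.real 21 0 = B) {L : ℕ}
    (hw : N + S + 1 ≤ w) (hL : N < 2 ^ L) (hM : m.word 21 0 = N) (hz : ∀ v < N, m.word 4 v = 0)
    (hq : QueueState T Q B (m.word 4) (m.real 4) (m.real 20) (m.word 20) ∅) :
    Run w search m fun m' t => t ≤ (50 * L + 500) * (N + S + 1) ∧ HoldsPoDel T Q m' := by
  let f : ℕ → ℕ := fun v => 50 * L + 250 + (50 * L + 500) * (m.word 2 (v + 1) - m.word 2 v)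
  have hsum : ∑ v ∈ Finset.range N, (if m.word 4 v = 0 then f v else 0) =
      (50 * L + 250) * N + (50 * L + 500) * S := by
    rw [Finset.sum_congr rfl (g := f) fun v hv => if_pos (hz v (Finset.mem_range.1 hv)),
      Finset.sum_add_distrib, ← Finset.mul_sum, h.slots.sum_eq]
    simp [mul_comm]
  refine Run.loop (I := fun k m' =>
    QueueState T Q B (m'.word 4) (m'.real 4) (m'.real 20) (m'.word 20) ∅ ∧
    k = ∑ v ∈ Finset.range N, if m'.word 4 v = 0 then f v else 0)
    (k := (50 * L + 250) * N + (50 * L + 500) * S) ⟨hq, hsum.symm⟩ ?_ ?_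
  · rintro k m₁ hf ⟨hq₁, rfl⟩ hb
    have hM₁ : m₁.word 21 0 = N := by rw [hf.word 21 (by decide), hM]
    have hB₁ : m₁.real 21 0 = B := by rw [hf.real 21 (by decide), hBm]
    have h2₁ : m₁.word 2 = m.word 2 := hf.word 2 (by decide)
    simp only [Test.Holds, WExp.eval, RExp.eval, hM₁, hB₁, not_le] at hb
    have htab : Tables T S m₁ := h.congr
      (fun a ha => by
        simp only [List.mem_cons, List.not_mem_nil, or_false] at ha
        rcases ha with rfl | rfl | rfl <;> exact hf.word _ (by decide))
      (fun a ha => by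
        simp only [List.mem_cons, List.not_mem_nil, or_false] at ha
        rcases ha with rfl | rfl | rfl | rfl | rfl <;> exact hf.real _ (by decide))
    refine (run_visitNode htab hB hB₁ hw hL hM₁ hb.1 hb.2 hq₁).mono ?_
    rintro m₂ t₂ hf₂ ⟨v, hv0, hv4, hq₂, ht₂⟩
    refine ⟨_, ⟨hq₂, rfl⟩, ?_⟩
    have hs := sum_remaining_update v.2 hv0 f
    rw [hv4]
    rw [h2₁] at ht₂
    have hfv : f v = 50 * L + 250 + (50 * L + 500) * (m.word 2 (v + 1) - m.word 2 v) := rfl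
    simp only [Test.cost, WExp.cost, RExp.cost]
    omega
  · rintro k m₁ t hf ⟨hq₁, rfl⟩ hb ht
    have hM₁ : m₁.word 21 0 = N := by rw [hf.word 21 (by decide), hM]
    have hB₁ : m₁.real 21 0 = B := by rw [hf.real 21 (by decide), hBm]
    simp only [Test.Holds, WExp.eval, RExp.eval, hM₁, hB₁, not_and, not_not] at hb
    simp only [Test.cost, WExp.cost, RExp.cost] at ht
    -- The root dominates all keys, so at exit no key exceeds the sentinel and nothing is pending.
    have hK : ∀ x, x ∉ keySet N B (m₁.word 4) (m₁.real 20) := by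
      rintro ⟨v, k⟩ ⟨-, h1, h2⟩
      have h1' : m₁.real 20 v = k := h1
      have h3 := hq₁.tree.le_root v.2
      have h4 := hb (by have := v.2; omega)
      simp only at h2
      linarith
    have hS := hq₁.inv.searchInv (by simp)
    have hmem := hS.mem_iff hK
    have hout : ∀ v : Fin N, v ∈ T.poDel Q ↔ m₁.word 4 v = 1 := fun v => by
      rw [← hmem v]
      exact ⟨fun ⟨z, hz⟩ => hz.1, fun h1 => ⟨m₁.real 4 v, h1, rfl⟩⟩
    refine ⟨?_, fun v hv => (hout v).1 hv, fun v hv => ?_, fun v hv => ?_⟩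
    · have e1 : (50 * L + 250) * N = 50 * L * N + 250 * N := by ring
      have e2 : (50 * L + 500) * S = 50 * L * S + 500 * S := by ring
      have e3 : (50 * L + 500) * (N + S + 1) =
        50 * L * N + 500 * N + 50 * L * S + 500 * S + 50 * L + 500 := by ring
      omega
    · exact (hq₁.flag v).resolve_right fun h1 => hv ((hout v).2 h1)
    · exact hS.isMax v _ ⟨(hout v).1 hv, rfl⟩

/-- The program that computes the potential downstream area. -/
def poDelProg : Prog :=
  .seq initSlots (.seq sortSlots (.seq findVertices (.seq setSentinel (.seq initNodes search))))

theorem run_poDelProg (h : Encodes T Q m) (hS : m.word 2 N = S) {L : ℕ}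
    (hw : 2 * (N + S + 1) ≤ w) (hL : N + S < 2 ^ L) :
    Run w poDelProg m fun m' t => t ≤ (100 * L + 5000) * (N + S + 1) ∧ HoldsPoDel T Q m' := by
  refine Run.seq ((run_initSlots h hS (by omega)).mono ?_)
  rintro m₁ t₁ hf₁ ⟨ht₁, hM₁, hsa, hkey⟩
  have h₁ : Encodes T Q m₁ := h.congr
    (fun a ha => by
      simp only [List.mem_cons, List.not_mem_nil, or_false] at ha
      rcases ha with rfl | rfl | rfl | rfl <;> exact hf₁.word _ (by decide))
    (fun a ha => by
      simp only [List.mem_cons, List.not_mem_nil, or_false] at ha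
      rcases ha with rfl | rfl | rfl | rfl <;> exact hf₁.real _ (by decide))
  have hsl₁ : Slots T S (m₁.word 2) (m₁.word 3) := by
    have := h₁.slots
    rwa [hf₁.word 2 (by decide), hS, ← hf₁.word 2 (by decide)] at this
  rw [← hf₁.word 2 (by decide), ← hf₁.word 3 (by decide)] at hsa
  refine Run.seq ((run_sortSlots (L := L) rfl h₁.numNodes hsl₁ hsa hkey (by omega) (by omega)
    hM₁).mono ?_)
  rintro m₂ t₂ hf₂ ⟨ht₂, hc₂, hso, hs, hrep, henv⟩
  have h₂ : Encodes T Q m₂ := h₁.congr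
    (fun a ha => by
      simp only [List.mem_cons, List.not_mem_nil, or_false] at ha
      rcases ha with rfl | rfl | rfl | rfl <;> exact hf₂.word _ (by decide))
    (fun a ha => by
      simp only [List.mem_cons, List.not_mem_nil, or_false] at ha
      rcases ha with rfl | rfl | rfl | rfl <;> exact hf₂.real _ (by decide))
  rw [← hf₂.word 2 (by decide), ← hf₂.word 3 (by decide)] at hsl₁
  rw [← hf₂.word 2 (by decide), ← hf₂.word 3 (by decide), ← hf₂.word 10 (by decide),
    ← hf₂.real 5 (by decide)] at hsa
  rw [← hf₂.real 5 (by decide)] at hso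
  rw [← hf₂.real 3 (by decide), ← hf₂.word 3 (by decide), ← hf₂.word 10 (by decide),
    ← hf₂.real 5 (by decide)] at henv
  refine Run.seq ((run_findVertices rfl hsl₁ hsa hso hc₂ hrep henv (by omega)).mono ?_)
  rintro m₃ t₃ hf₃ ⟨ht₃, hvert⟩
  have h₃ : Encodes T Q m₃ := h₂.congr
    (fun a ha => by
      simp only [List.mem_cons, List.not_mem_nil, or_false] at ha
      rcases ha with rfl | rfl | rfl | rfl <;> exact hf₃.word _ (by decide))
    (fun a ha => by
      simp only [List.mem_cons, List.not_mem_nil, or_false] at ha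
      rcases ha with rfl | rfl | rfl | rfl <;> exact hf₃.real _ (by decide))
  have htab₃ : Tables T S m₃ := by
    rw [← hf₃.word 2 (by decide), ← hf₃.word 3 (by decide)] at hsl₁
    rw [← hf₃.word 2 (by decide), ← hf₃.word 3 (by decide), ← hf₃.word 10 (by decide),
      ← hf₃.real 5 (by decide)] at hsa
    rw [← hf₃.real 3 (by decide), ← hf₃.word 3 (by decide), ← hf₃.word 10 (by decide),
      ← hf₃.real 5 (by decide)] at hvert
    exact ⟨hsl₁, hsa, h₃.low, h₃.high, hvert⟩
  refine Run.seq ((run_setSentinel h₃ (by omega)).mono ?_)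
  rintro m₄ t₄ hf₄ ⟨ht₄, hB⟩
  have h₄ : Encodes T Q m₄ := h₃.congr
    (fun a ha => by
      simp only [List.mem_cons, List.not_mem_nil, or_false] at ha
      rcases ha with rfl | rfl | rfl | rfl <;> exact hf₄.word _ (by decide))
    (fun a ha => by
      simp only [List.mem_cons, List.not_mem_nil, or_false] at ha
      rcases ha with rfl | rfl | rfl | rfl <;> exact hf₄.real _ (by decide))
  refine Run.seq ((run_initNodes h₄ hB rfl (by omega)).mono ?_)
  rintro m₅ t₅ hf₅ ⟨ht₅, hM₅, hz, hq⟩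
  have htab₅ : Tables T S m₅ := htab₃.congr
    (fun a ha => by
      simp only [List.mem_cons, List.not_mem_nil, or_false] at ha
      rcases ha with rfl | rfl | rfl <;>
        exact (hf₅.word _ (by decide)).trans (hf₄.word _ (by decide)))
    (fun a ha => by
      simp only [List.mem_cons, List.not_mem_nil, or_false] at ha
      rcases ha with rfl | rfl | rfl | rfl | rfl <;>
        exact (hf₅.real _ (by decide)).trans (hf₄.real _ (by decide)))
  refine (run_search (L := L) htab₅ hB (by rw [hf₅.real 21 (by decide)]) (by omega) (by omega) hM₅ hz
    hq).mono ?_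
  rintro m₆ t₆ hf₆ ⟨ht₆, hres⟩
  refine ⟨?_, hres⟩
  have e1 : (100 * L + 5000) * (N + S + 1) =
      50 * L * S + (50 * L + 500) * (N + S + 1) + 50 * L * N + 50 * L + 4500 * (N + S + 1) := by ring
  rw [e1]
  omega

/-- Without isolated nodes every node owns at least one slot. -/
theorem numNodes_le (h : Encodes T Q m) (hiso : ∀ v, ∃ u, T.graph.Adj v u) :
    N ≤ 2 * T.numEdges := by
  have hsl := h.slots
  have : ∀ n ≤ N, n ≤ m.word 2 n := by
    intro n
    induction n with
    | zero => simp
    | succ n ih =>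
      intro hn
      obtain ⟨u, hu⟩ := hiso ⟨n, hn⟩
      obtain ⟨x, h1, h2, -⟩ := hsl.slot_of_adj _ _ hu
      simp only at h1 h2
      have := ih (by omega)
      omega
  rw [← hsl.card]
  exact this N le_rfl

/-! ### From step counts to real logarithms. -/

theorem log_two_ge_half : (1 : ℝ) / 2 ≤ Real.log 2 := by
  have := Real.log_two_gt_d9
  norm_num at this ⊢
  linarith

/-- Conversion of the step count to the bound `O(x log x)`. -/
theorem time_le_of_nat {t y x : ℕ} (hx : 1 ≤ x) (hy : y ≤ 2 * x)
    (ht : t ≤ (100 * (Nat.log 2 y + 1) + 5000) * y) :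
    (t : ℝ) ≤ 21200 * (x * Real.log (x + 1)) := by
  have hx1 : (1 : ℝ) ≤ x := by exact_mod_cast hx
  have hl2 := log_two_ge_half
  have hmono : Real.log 2 ≤ Real.log (x + 1) := Real.log_le_log (by norm_num) (by linarith)
  have hlog : (Nat.log 2 y : ℝ) ≤ 2 * Real.log 2 + 2 * Real.log (x + 1) := by
    rcases Nat.eq_zero_or_pos y with rfl | hy0
    · simp only [Nat.log_zero_right, Nat.cast_zero]
      linarith
    · have h1 : ((2 ^ Nat.log 2 y : ℕ) : ℝ) ≤ 2 * (x + 1) := by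
        have : 2 ^ Nat.log 2 y ≤ 2 * (x + 1) := (Nat.pow_log_le_self 2 (by omega)).trans (by omega)
        exact_mod_cast this
      have h2 := Real.log_le_log (by positivity) h1
      rw [Nat.cast_pow, Real.log_pow, Real.log_mul (by norm_num) (by positivity)] at h2
      push_cast at h2
      have h3 : (0 : ℝ) ≤ Nat.log 2 y := Nat.cast_nonneg _
      nlinarith
  have ht' : (t : ℝ) ≤ (100 * (Nat.log 2 y + 1) + 5000) * y := by exact_mod_cast ht
  have hy' : (y : ℝ) ≤ 2 * x := by exact_mod_cast hy
  -- Since `log (x + 1) ≥ log 2 ≥ 1 / 2`, the constant 5100 costs at most `10200 log (x + 1)`, and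
  -- the binary logarithm at most `400 log (x + 1)`.
  have hf : (100 * ((Nat.log 2 y : ℝ) + 1) + 5000) ≤ 10600 * Real.log (x + 1) := by linarith
  have h0 : 0 ≤ Real.log (x + 1) := by linarith
  calc (t : ℝ) ≤ (100 * (Nat.log 2 y + 1) + 5000) * y := ht'
    _ ≤ (10600 * Real.log (x + 1)) * (2 * x) := by gcongr
    _ = 21200 * (x * Real.log (x + 1)) := by ring

end RealRAM

theorem mainTheorem5 :
    -- the search with `ExpandDown` terminates and outputs exactly `PoDel(Q)`
    (∀ (N : ℕ) (T : ImpreciseTerrain (Fin N)) (Q : Finset (Fin N)),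
      Acc (fun s' s => T.SearchStep s s') (T.searchStart Q) ∧
      ∀ s, Relation.ReflTransGen T.SearchStep (T.searchStart Q) s →
        (¬ ∃ s', T.SearchStep s s') →
        s.queue = 0 ∧
        (s.output.map Prod.fst).Nodup ∧
        (∀ p, p ∈ s.output.map Prod.fst ↔ p ∈ T.poDel Q) ∧
        (∀ p z, (p, z) ∈ s.output ↔ T.IsMaxElev Q p z)) ∧
    -- a real RAM program computes this output in `O(n log n)` time, `n` the number of edges
    (∃ (prog : RealRAM.Prog) (C : ℕ),
      ∀ (N : ℕ) (T : ImpreciseTerrain (Fin N)) (Q : Finset (Fin N)) (m : RealRAM.Memory),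
        RealRAM.Encodes T Q m →
        ∃ (m' : RealRAM.Memory) (t : ℕ),
          RealRAM.Exec (C * (N + T.numEdges + 1)) prog m m' t ∧
          RealRAM.HoldsPoDel T Q m' ∧
          (t : ℝ) ≤ C * ((N + T.numEdges + 1) * Real.log (N + T.numEdges + 2)) ∧
          ((∀ v, ∃ u, T.graph.Adj v u) → 2 ≤ T.numEdges →
            (t : ℝ) ≤ C * (T.numEdges * Real.log T.numEdges))) := by
  refine ⟨fun N T Q => ⟨T.acc_searchStep _, fun s hs hstuck => T.search_correct Q s hs hstuck⟩,
    RealRAM.poDelProg, 300000, fun N T Q m h => ?_⟩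
  have hS := h.slots.card
  obtain ⟨m', t, he, ht, hres⟩ := RealRAM.run_poDelProg (w := 300000 * (N + T.numEdges + 1)) h rfl
    (L := Nat.log 2 (N + m.word 2 N + 1) + 1) (by omega)
    (lt_trans (Nat.lt_succ_self _) (Nat.lt_pow_succ_log_self (by norm_num) _))
  have htime := RealRAM.time_le_of_nat (x := N + T.numEdges + 1) (by omega) (by omega) ht
  have hlog0 : 0 ≤ Real.log (N + T.numEdges + 2) := Real.log_nonneg (by
    have h1 : (0 : ℝ) ≤ N := Nat.cast_nonneg _
    have h2 : (0 : ℝ) ≤ T.numEdges := Nat.cast_nonneg _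
    linarith)
  have htime' : (t : ℝ) ≤ 21200 * ((N + T.numEdges + 1) * Real.log (N + T.numEdges + 2)) := by
    push_cast at htime
    convert htime using 4
    ring
  refine ⟨m', t, he, hres, htime'.trans ?_, fun hiso hn => htime'.trans ?_⟩
  · push_cast
    gcongr
    norm_num
  · have hN : (N : ℝ) ≤ 2 * T.numEdges := by exact_mod_cast RealRAM.numNodes_le h hiso
    have hn2 : (2 : ℝ) ≤ T.numEdges := by exact_mod_cast hn
    -- With `N ≤ 2 n` the argument is at most `3 n + 2`, which is at most `n ^ 3` for `n ≥ 2`, with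
    -- equality at 2. Likewise `N + n + 1 ≤ 4 n`, and the constant becomes `21200 * 12`.
    have hlog : Real.log (N + T.numEdges + 2) ≤ 3 * Real.log T.numEdges := by
      rw [show (3 : ℝ) = ((3 : ℕ) : ℝ) by norm_num, ← Real.log_pow]
      refine Real.log_le_log (by positivity) ?_
      nlinarith [mul_nonneg (sub_nonneg.2 hn2) (sub_nonneg.2 hn2)]
    calc (21200 : ℝ) * ((N + T.numEdges + 1) * Real.log (N + T.numEdges + 2))
        ≤ 21200 * ((4 * T.numEdges) * (3 * Real.log T.numEdges)) := by
          gcongr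
          linarith
      _ = 254400 * (T.numEdges * Real.log T.numEdges) := by ring
      _ ≤ (300000 : ℕ) * (T.numEdges * Real.log T.numEdges) := by
          have : 0 ≤ Real.log T.numEdges := Real.log_nonneg (by linarith)
          push_cast
          gcongr
          norm_num
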